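/- For each $n\in\mathbb N$ let $s(n),t(n)\in\mathbb N$ with $s(n)/n\to\kappa$ and $t(n)/n\to\mu$ for some $\kappa,\mu\in(0,\infty)$. Write $I_m=\{1,\dots,m\}$, let $\sim_n$ be an equivalence relation on $I_{s(n)}\times I_{t(n)}$, and let $X_n=\big(n^{-1/2}a_n(p,q)\big)_{p\le s(n),\,q\le t(n)}$ be a random matrix with complex entries such that the families $\big(a_n(p,q)\big)_{(p,q)\in c}$, with $c$ running through the equivalence classes of $\sim_n$, are independent. Assume that, as $n\to\infty$, (MP1) $\max_{p}\#\{(q,p',q')\in I_{t(n)}\times I_{s(n)}\times I_{t(n)}:(p,q)\sim_n(p',q')\}=o(n^2)$; (MP2) there is a constant $B<\infty$ such that, for all $n$, $\#\{q':(p,q)\sim_n(p',q')\}\le B$ for all $p,q,p'$ and $\#\{p':(p,q)\sim_n(p',q')\}\le B$ for all $p,q,q'$; (MP3) $\#\{(p,q,q'):(p,q)\sim_n(p,q'),\ q\ne q'\}=o(n^2)$ and $\#\{(p,p',q):(p,q)\sim_n(p',q),\ p\neq p'\}=o(n^2)$. Assume moreover that $\mathbb E\,a_n(p,q)=0$ and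 $\mathbb E\big(a_n(p,q)\overline{a_n(p,q)}\big)=1$ for all $n,p,q$, and that $\sup_{n}\max_{p,q}\mathbb E|a_n(p,q)|^k<\infty$ for every $k\in\mathbb N$. Let $L_n(X_n^*X_n)=\frac1n\sum_{j=1}^{t(n)}\delta_{\lambda_j}$, where $\lambda_1,\dots,\lambda_{t(n)}$ are the eigenvalues of $X_n^*X_n$ with multiplicity. Then, as $n\to\infty$, the mean empirical eigenvalue measure $\mathbb E(L_n(X_n^*X_n))$ converges weakly to a finite measure on $\mathbb R$ of total mass $\mu$ whose $k$-th moment is finite and equal to $$\sum_{i=1}^k \#\mathrm{NC}^{(i)}(k)\,\kappa^i\mu^{k-i+1}\qquad\text{for every } k\ge1,$$ where $\mathrm{NC}^{(i)}(k)$ is the set of noncrossing partitions of $\{1,\dots,k\}$ with exactly $i$ blocks. If $\mu=1$, the limit is the Marčenko–Pastur distribution $$\max\{0,1-\kappa\}\,\delta_0+\frac{\sqrt{4\kappa-(x-1-\kappa)^2}}{2\pi x}\,\mathbf 1_{[(1-\sqrt\kappa)^2,(1+\sqrt\kappa)^2]}(x)\,dx .$$ -/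

import Mathlib

open Filter Topology MeasureTheory ProbabilityTheory Asymptotics
open scoped NNReal ENNReal Matrix

noncomputable section

namespace SampleCov

/-- A partition of `{1, …, k}` (indexed by `Fin k`) is noncrossing if there are no
`a < b < c < d` with `a, c` in one block and `b, d` in a different block. -/
def IsNoncrossing {k : ℕ} (π : Finpartition (Finset.univ : Finset (Fin k))) : Prop :=
  ∀ A ∈ π.parts, ∀ B ∈ π.parts, ∀ a b c d : Fin k,
    a < b → b < c → c < d → a ∈ A → c ∈ A → b ∈ B → d ∈ B → A = B

/-- The number of noncrossing partitions of a `k`-element linearly ordered set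
with exactly `i` blocks. -/
def ncCount (i k : ℕ) : ℕ :=
  {π : Finpartition (Finset.univ : Finset (Fin k)) |
    π.parts.card = i ∧ IsNoncrossing π}.ncard

/-- The empirical eigenvalue measure, normalized by `1 / n`:
`L_n(M) = (1 / n) ∑_j δ_{λ_j}`, the sum being over all eigenvalues of `M` with multiplicity.
The size of `M` is allowed to differ from `n`. -/
def empiricalMeasure (n : ℕ) {m : ℕ} (M : Matrix (Fin m) (Fin m) ℂ) (hM : M.IsHermitian) :
    Measure ℝ :=
  ((n : ℝ≥0)⁻¹) • ∑ j, Measure.dirac (hM.eigenvalues j)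

/-- The random matrix `X_n = (n^{-1/2} a_n(p, q))`. -/
def scaledMatrix (n : ℕ) {s t : ℕ} {Ω : Type*} (a : Fin s × Fin t → Ω → ℂ) (ω : Ω) :
    Matrix (Fin s) (Fin t) ℂ :=
  Matrix.of fun p q => ((1 / Real.sqrt n : ℝ) : ℂ) * a (p, q) ω

/-- The random measure `L_n(X_n^* X_n)`. -/
def sampleCovMeasure (n : ℕ) {s t : ℕ} {Ω : Type*} (a : Fin s × Fin t → Ω → ℂ) (ω : Ω) :
    Measure ℝ :=
  empiricalMeasure n ((scaledMatrix n a ω)ᴴ * scaledMatrix n a ω)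
    (Matrix.isHermitian_conjTranspose_mul_self _)

theorem sampleCovMeasure_univ (n : ℕ) {s t : ℕ} {Ω : Type*} (a : Fin s × Fin t → Ω → ℂ)
    (ω : Ω) : sampleCovMeasure n a ω Set.univ = (((n : ℝ≥0)⁻¹ * t : ℝ≥0) : ℝ≥0∞) := by
  rw [sampleCovMeasure, empiricalMeasure, Measure.smul_apply, Measure.finsetSum_apply]
  simp only [measure_univ, Finset.sum_const, Finset.card_univ, Fintype.card_fin, nsmul_eq_mul,
    mul_one, ENNReal.smul_def, smul_eq_mul]
  push_cast
  rfl

/-- The mean empirical eigenvalue measure `E(L_n(X_n^* X_n))`, that is, the measure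
`B ↦ ∫ L_n(X_n(ω)^* X_n(ω))(B) dP(ω)`. -/
def meanMeasure (n : ℕ) {s t : ℕ} {Ω : Type*} [MeasurableSpace Ω] (P : Measure Ω)
    (a : Fin s × Fin t → Ω → ℂ) : Measure ℝ :=
  P.bind (sampleCovMeasure n a)

instance (n : ℕ) {s t : ℕ} {Ω : Type*} [MeasurableSpace Ω] (P : Measure Ω)
    [IsProbabilityMeasure P] (a : Fin s × Fin t → Ω → ℂ) :
    IsFiniteMeasure (meanMeasure n P a) := by
  refine ⟨lt_of_le_of_lt (Measure.bind_apply_le _ MeasurableSet.univ) ?_⟩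
  simp only [sampleCovMeasure_univ, lintegral_const, measure_univ, mul_one]
  exact ENNReal.coe_lt_top

/-- `E(L_n(X_n^* X_n))` as an element of the space of finite measures on `ℝ`, which carries the
topology of weak convergence (tested against bounded continuous functions). -/
def meanFiniteMeasure (n : ℕ) {s t : ℕ} {Ω : Type*} [MeasurableSpace Ω] (P : Measure Ω)
    [IsProbabilityMeasure P] (a : Fin s × Fin t → Ω → ℂ) : FiniteMeasure ℝ :=
  ⟨meanMeasure n P a, inferInstance⟩

/-- The families of entries `(a(p, q))_{(p, q) ∈ c}`, where `c` runs through the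
equivalence classes of `r`, are independent. -/
def IndepClasses {s t : ℕ} {Ω : Type*} [MeasurableSpace Ω] (P : Measure Ω)
    (r : Setoid (Fin s × Fin t)) (a : Fin s × Fin t → Ω → ℂ) : Prop :=
  iIndepFun (fun (c : Quotient r) (ω : Ω) (x : {x : Fin s × Fin t // Quotient.mk r x = c}) =>
    a x.1 ω) P

/-- Condition (MP1):
`max_p #{(q, p', q') : (p, q) ∼_n (p', q')} = o(n²)`. -/
def MP1 (s t : ℕ → ℕ) (r : ∀ n, Setoid (Fin (s n) × Fin (t n))) : Prop :=
  (fun n : ℕ => ((Finset.univ.sup fun p : Fin (s n) =>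
      {x : Fin (t n) × Fin (s n) × Fin (t n) | (r n) (p, x.1) (x.2.1, x.2.2)}.ncard : ℕ) : ℝ))
    =o[atTop] fun n : ℕ => (n : ℝ) ^ 2

/-- Condition (MP2): the numbers `#{q' : (p, q) ∼_n (p', q')}` and `#{p' : (p, q) ∼_n (p', q')}`
are bounded by a finite constant which does not depend on `n`. -/
def MP2 (s t : ℕ → ℕ) (r : ∀ n, Setoid (Fin (s n) × Fin (t n))) : Prop :=
  ∃ B : ℕ, ∀ n : ℕ,
    (∀ (p : Fin (s n)) (q : Fin (t n)) (p' : Fin (s n)),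
      {q' : Fin (t n) | (r n) (p, q) (p', q')}.ncard ≤ B) ∧
    (∀ (p : Fin (s n)) (q : Fin (t n)) (q' : Fin (t n)),
      {p' : Fin (s n) | (r n) (p, q) (p', q')}.ncard ≤ B)

/-- Condition (MP3): `#{(p, q, q') : (p, q) ∼_n (p, q'), q ≠ q'} = o(n²)` and
`#{(p, p', q) : (p, q) ∼_n (p', q), p ≠ p'} = o(n²)`. -/
def MP3 (s t : ℕ → ℕ) (r : ∀ n, Setoid (Fin (s n) × Fin (t n))) : Prop :=
  ((fun n : ℕ => (({x : Fin (s n) × Fin (t n) × Fin (t n) |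
      (r n) (x.1, x.2.1) (x.1, x.2.2) ∧ x.2.1 ≠ x.2.2}.ncard : ℕ) : ℝ))
    =o[atTop] fun n : ℕ => (n : ℝ) ^ 2) ∧
  ((fun n : ℕ => (({x : Fin (s n) × Fin (s n) × Fin (t n) |
      (r n) (x.1, x.2.2) (x.2.1, x.2.2) ∧ x.1 ≠ x.2.1}.ncard : ℕ) : ℝ))
    =o[atTop] fun n : ℕ => (n : ℝ) ^ 2)

/-- The Marčenko–Pastur distribution with parameter `κ > 0`:
`max(0, 1 - κ) δ_0 + √(4κ - (x - 1 - κ)²) / (2πx) 1_{[(1 - √κ)², (1 + √κ)²]}(x) dx`. -/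
def marchenkoPastur (κ : ℝ) : Measure ℝ :=
  ENNReal.ofReal (max 0 (1 - κ)) • Measure.dirac 0 +
    volume.withDensity (fun x : ℝ => ENNReal.ofReal
      (Set.indicator (Set.Icc ((1 - Real.sqrt κ) ^ 2) ((1 + Real.sqrt κ) ^ 2))
        (fun x => Real.sqrt (4 * κ - (x - 1 - κ) ^ 2) / (2 * Real.pi * x)) x))

end SampleCov

end

/-! The proof is the method of moments. With `A` the unscaled matrix, the `k`-th moment of the mean
measure is `n^(-k-1)` times the expected trace of `(A^* A)^k`, and the trace is a sum over closed
walks of length `2k` in the complete bipartite graph on rows and columns, starting at a column.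
Label each edge by its equivalence class. Independence and centering kill every walk with a label
used only once, so at most `k` labels matter. By (MP2) a step along an already used label has
boundedly many targets; hence there are only `O(n^k)` walks with fewer than `k` labels
(`ncard_few_labels_le`), which is negligible against `n^(k+1)`. With exactly `k` labels each label
is used twice.

Such a walk may be a depth-first tour of a plane tree. If it is not, deleting backtracks leads to
two consecutive equally labelled edges that do not backtrack, or to two equally labelled edges with
distinct labels between them. (MP3) and (MP1) make the number of these walks `o(n^(k+1))`
(`ncard_badWalks_le`). A tour with `k` labels has expectation exactly 1, since each class
contributes one entry and its conjugate. `norm_integral_trace_pow_sub_le` collects these facts.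

The limiting moment is therefore a sum over plane trees with `k` edges, each vertex weighted by `κ`
or `μ` according to the parity of its depth. Cutting a tree at its first edge and a noncrossing
partition at its last element gives the same recursion (`treeSum_eq_ncSum`).

The limit is written down explicitly, as a dilated Marčenko–Pastur law. In the coordinate `x = 1 + κ
+ 2√κ cos θ`, multiplication by `x` is tridiagonal on the functions `sin ((m+1)θ)`, and the
generating function of the moments obeys the same tridiagonal recurrence (`eq_coeff_ncSeries`).
Since the limit has compact support, convergence of moments gives weak convergence
(`tendsto_of_tendsto_moments`). -/

namespace SampleCov

/-! ### Labelled walks, and how their number grows under extension -/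

section Walks

variable {V Q : Type*}

/-- The list of consecutive pairs of a list of vertices. -/
def edges (w : List V) : List (V × V) := w.zip w.tail

@[simp] lemma edges_nil : edges ([] : List V) = [] := rfl
@[simp] lemma edges_singleton (v : V) : edges [v] = [] := rfl
@[simp] lemma edges_cons_cons (v u : V) (l : List V) :
    edges (v :: u :: l) = (v, u) :: edges (u :: l) := rfl

lemma length_edges (w : List V) : (edges w).length = w.length - 1 := by
  simp [edges]

lemma edges_append_cons (x : List V) (v : V) (y : List V) :
    edges (x ++ v :: y) = edges (x ++ [v]) ++ edges (v :: y) := by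
  induction x with
  | nil => simp
  | cons a x ih =>
    cases x with
    | nil => simp
    | cons b x => simpa using ih

lemma edges_concat_concat (x : List V) (v u : V) :
    edges (x ++ [v, u]) = edges (x ++ [v]) ++ [(v, u)] := by
  rw [edges_append_cons]; rfl

lemma edges_drop (w : List V) (i : ℕ) : edges (w.drop i) = (edges w).drop i := by
  simp [edges, List.zip, List.drop_zipWith, List.tail_drop]

lemma edges_take (w : List V) (i : ℕ) : edges (w.take (i + 1)) = (edges w).take i := by
  induction i generalizing w with
  | zero => cases w <;> simp
  | succ i ih =>
    match w with
    | [] => simp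
    | [v] => simp
    | v :: u :: l =>
      have := ih (u :: l)
      simp only [List.take_succ_cons, edges_cons_cons] at this ⊢
      rw [this]

lemma edges_reverse (w : List V) : edges w.reverse = ((edges w).map Prod.swap).reverse := by
  induction w with
  | nil => rfl
  | cons v l ih =>
    cases l with
    | nil => rfl
    | cons u l =>
      rw [edges_cons_cons, List.map_cons, List.reverse_cons, List.reverse_cons, List.reverse_cons,
        List.append_assoc, List.singleton_append, edges_concat_concat, ← List.reverse_cons, ih]
      rfl

/-- The list of labels of the edges of a walk. -/
def labels (lab : V → V → Option Q) (w : List V) : List (Option Q) :=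
  (edges w).map fun e => lab e.1 e.2

variable {lab : V → V → Option Q}

@[simp] lemma labels_singleton (v : V) : labels lab [v] = [] := rfl
@[simp] lemma labels_cons_cons (v u : V) (l : List V) :
    labels lab (v :: u :: l) = lab v u :: labels lab (u :: l) := rfl

lemma length_labels (w : List V) : (labels lab w).length = w.length - 1 := by
  simp [labels, length_edges]

lemma labels_append_cons (x : List V) (v : V) (y : List V) :
    labels lab (x ++ v :: y) = labels lab (x ++ [v]) ++ labels lab (v :: y) := by
  simp [labels, edges_append_cons x v y]

lemma labels_concat_concat (x : List V) (v u : V) :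
    labels lab (x ++ [v, u]) = labels lab (x ++ [v]) ++ [lab v u] := by
  simp [labels, edges_concat_concat]

lemma labels_drop (w : List V) (i : ℕ) : labels lab (w.drop i) = (labels lab w).drop i := by
  simp [labels, edges_drop]

lemma labels_take (w : List V) (i : ℕ) :
    labels lab (w.take (i + 1)) = (labels lab w).take i := by
  simp [labels, edges_take]

lemma labels_reverse (hsymm : ∀ u v, lab u v = lab v u) (w : List V) :
    labels lab w.reverse = (labels lab w).reverse := by
  simp only [labels, edges_reverse, List.map_reverse, List.map_map]
  congr 2
  funext e
  simp [hsymm e.1 e.2]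

/-- The number of distinct labels of a walk. -/
noncomputable def numLabels (lab : V → V → Option Q) (w : List V) : ℕ :=
  by classical exact (labels lab w).toFinset.card

lemma numLabels_eq [DecidableEq Q] (w : List V) :
    numLabels lab w = (labels lab w).toFinset.card := by
  rw [numLabels]; congr!

/-- A walk is valid if all its edges carry labels. -/
def Valid (lab : V → V → Option Q) (w : List V) : Prop := none ∉ labels lab w

lemma numLabels_reverse (hsymm : ∀ u v, lab u v = lab v u) (w : List V) :
    numLabels lab w.reverse = numLabels lab w := by
  classical
  rw [numLabels_eq, numLabels_eq, labels_reverse hsymm, List.toFinset_reverse]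

lemma valid_reverse (hsymm : ∀ u v, lab u v = lab v u) (w : List V) :
    Valid lab w.reverse ↔ Valid lab w := by
  simp [Valid, labels_reverse hsymm]

/-- The number of walks in `W` with at most `d + r` labels is at most `c |V| ^ r`, and all walks in
`W` have `m + 1` vertices and at least `d` labels. -/
structure Bounded (lab : V → V → Option Q) (W : Set (List V)) (m d : ℕ) (N c : ℕ) : Prop where
  length : ∀ w ∈ W, w.length = m + 1
  le_numLabels : ∀ w ∈ W, d ≤ numLabels lab w
  finite : W.Finite
  card : ∀ r, {w ∈ W | numLabels lab w ≤ d + r}.ncard ≤ c * N ^ r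

lemma ncard_le_of_injOn_prod {α β γ : Type*} (S : Set α) (f : α → β × γ) (T : Set β)
    (U : β → Set γ) (b : ℕ) (hf : Set.InjOn f S) (hT : T.Finite) (hfT : ∀ x ∈ S, (f x).1 ∈ T)
    (hU : ∀ y ∈ T, (U y).Finite) (hfU : ∀ x ∈ S, (f x).2 ∈ U (f x).1)
    (hb : ∀ y ∈ T, (U y).ncard ≤ b) : S.ncard ≤ b * T.ncard := by
  classical
  lift T to Finset β using hT
  have hsub : f '' S ⊆ ⋃ y ∈ T, (fun z => (y, z)) '' U y := by
    rintro _ ⟨x, hx, rfl⟩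
    simp only [Set.mem_iUnion]
    exact ⟨(f x).1, by simpa using hfT x hx, (f x).2, hfU x hx, rfl⟩
  have hfin : (⋃ y ∈ T, (fun z => (y, z)) '' U y).Finite :=
    T.finite_toSet.biUnion fun y hy => (hU y hy).image _
  rw [← hf.ncard_image]
  refine (Set.ncard_le_ncard hsub hfin).trans ((Finset.set_ncard_biUnion_le _ _).trans ?_)
  refine (Finset.sum_le_card_nsmul _ _ b fun y hy => ?_).trans ?_
  · exact (Set.ncard_image_le (hU y (by simpa using hy))).trans (hb y (by simpa using hy))
  · simp [mul_comm]

/-- The one-step extensions to the right of the walks in `W`. -/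
def extendRight (lab : V → V → Option Q) (W : Set (List V)) : Set (List V) :=
  {w | Valid lab w ∧ ∃ w' ∈ W, ∃ u, w = w' ++ [u]}

/-- The one-step extensions to the left of the walks in `W`. -/
def extendLeft (lab : V → V → Option Q) (W : Set (List V)) : Set (List V) :=
  {w | Valid lab w ∧ ∃ w' ∈ W, ∃ u, w = u :: w'}

lemma numLabels_append_le (w : List V) (u : V) :
    numLabels lab w ≤ numLabels lab (w ++ [u]) := by
  classical
  rw [numLabels_eq, numLabels_eq]
  rcases List.eq_nil_or_concat' w with rfl | ⟨x, v, rfl⟩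
  · simp [labels]
  · apply Finset.card_le_card
    intro a
    rw [List.append_assoc, List.singleton_append, labels_concat_concat]
    simp +contextual

/-- The form in which (MP2) enters all counts: a step that must reuse a label has a number of
targets independent of the size of the graph. -/
lemma ncard_old_label_le [Finite V] {B : ℕ}
    (hB : ∀ v (c : Q), {u | lab v u = some c}.ncard ≤ B) (v : V) (l : List (Option Q)) :
    {u | lab v u ≠ none ∧ lab v u ∈ l}.ncard ≤ l.length * B := by
  classical
  induction l with
  | nil => simp
  | cons a l ih =>
    have hsub : {u | lab v u ≠ none ∧ lab v u ∈ a :: l} ⊆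
        {u | lab v u ≠ none ∧ lab v u = a} ∪ {u | lab v u ≠ none ∧ lab v u ∈ l} := by
      rintro u ⟨h, hu⟩
      rcases List.mem_cons.1 hu with hu | hu
      exacts [Or.inl ⟨h, hu⟩, Or.inr ⟨h, hu⟩]
    have h1 : {u | lab v u ≠ none ∧ lab v u = a}.ncard ≤ B := by
      cases a with
      | none =>
        simp
      | some c =>
        exact (Set.ncard_le_ncard (fun u hu => hu.2) (Set.toFinite _)).trans (hB v c)
    calc _ ≤ _ := Set.ncard_le_ncard hsub (Set.toFinite _)
      _ ≤ _ := Set.ncard_union_le _ _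
      _ ≤ B + l.length * B := add_le_add h1 ih
      _ = _ := by rw [List.length_cons]; ring

/-- Split by the label of the new edge. A used label leaves at most `m * B` targets. A fresh label
leaves up to `card V` targets, but then the shorter walk has one label fewer, which pays for this
factor. So only the constant grows. -/
lemma Bounded.extendRight [Fintype V] {B : ℕ}
    (hB : ∀ v (c : Q), {u | lab v u = some c}.ncard ≤ B) {W : Set (List V)} {m d c : ℕ}
    (hW : Bounded lab W m d (Fintype.card V) c) :
    Bounded lab (extendRight lab W) (m + 1) d (Fintype.card V) (c * (1 + m * B)) := by
  classical
  have hsplit : ∀ w ∈ W, ∃ x v, w = x ++ [v] := fun w hw => by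
    rcases List.eq_nil_or_concat' w with rfl | ⟨x, v, rfl⟩
    · simpa using hW.length _ hw
    · exact ⟨x, v, rfl⟩
  refine ⟨?_, ?_, ?_, ?_⟩
  · rintro _ ⟨-, w, hw, u, rfl⟩
    simp [hW.length w hw]
  · rintro _ ⟨-, w, hw, u, rfl⟩
    exact (hW.le_numLabels w hw).trans (numLabels_append_le w u)
  · refine ((hW.finite.prod (Set.finite_univ (α := V))).image fun x => x.1 ++ [x.2]).subset ?_
    rintro _ ⟨-, w, hw, u, rfl⟩
    exact ⟨(w, u), by simpa using hw, rfl⟩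
  · intro r
    set N := Fintype.card V
    set Wr : ℕ → Set (List V) := fun r => {w ∈ W | numLabels lab w ≤ d + r} with hWr
    have hfin : ∀ r, (Wr r).Finite := fun r => hW.finite.subset fun w hw => hw.1
    set old : Set (List V × V) := {p | p.1 ∈ Wr r ∧ ∃ x v, p.1 = x ++ [v] ∧ lab v p.2 ≠ none ∧
      lab v p.2 ∈ labels lab p.1} with hold
    set new : Set (List V × V) := {p | p.1 ∈ W ∧ numLabels lab p.1 + 1 ≤ d + r} with hnew
    have hfinold : old.Finite := ((hfin r).prod (Set.finite_univ (α := V))).subset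
      fun p hp => by simpa using hp.1
    have hfinnew : new.Finite := (hW.finite.prod (Set.finite_univ (α := V))).subset
      fun p hp => by simpa using hp.1
    have hcover : {w ∈ SampleCov.extendRight lab W | numLabels lab w ≤ d + r} ⊆
        (fun p : List V × V => p.1 ++ [p.2]) '' (old ∪ new) := by
      rintro _ ⟨⟨hval, w, hw, u, rfl⟩, hnum⟩
      refine ⟨(w, u), ?_, rfl⟩
      obtain ⟨x, v, rfl⟩ := hsplit w hw
      rw [List.append_assoc, List.singleton_append] at hval hnum
      rw [Valid, labels_concat_concat] at hval
      simp only [List.mem_append, List.mem_singleton, not_or] at hval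
      by_cases hmem : lab v u ∈ labels lab (x ++ [v])
      · refine Or.inl ⟨⟨hw, ?_⟩, x, v, rfl, Ne.symm hval.2, hmem⟩
        refine (numLabels_append_le _ u).trans ?_
        simpa using hnum
      · refine Or.inr ⟨hw, ?_⟩
        rw [numLabels_eq, labels_concat_concat, List.toFinset_append, Finset.card_union_of_disjoint]
          at hnum
        · simpa [numLabels_eq] using hnum
        · simpa using hmem
    have hcardold : old.ncard ≤ m * B * (c * N ^ r) := by
      refine (ncard_le_of_injOn_prod old id (Wr r) (fun w => {u | ∃ x v, w = x ++ [v] ∧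
        lab v u ≠ none ∧ lab v u ∈ labels lab w}) (m * B) Function.injective_id.injOn (hfin r)
        (fun p hp => hp.1) (fun _ _ => Set.toFinite _) (fun p hp => hp.2) ?_).trans
        (Nat.mul_le_mul_left _ (hW.card r))
      intro w hw
      obtain ⟨x, v, rfl⟩ := hsplit w hw.1
      have := ncard_old_label_le hB v (labels lab (x ++ [v]))
      rw [length_labels, hW.length _ hw.1, Nat.add_sub_cancel] at this
      refine (Set.ncard_le_ncard ?_ (Set.toFinite _)).trans this
      rintro u ⟨y, v', h, hu⟩
      obtain ⟨-, h⟩ := List.append_inj' h rfl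
      obtain rfl : v = v' := by simpa using h
      exact hu
    have hcardnew : new.ncard ≤ c * N ^ r := by
      cases r with
      -- No label to spare: the shorter walk already has `d` labels, so the new edge cannot carry a
      -- fresh one.
      | zero =>
        have : new = ∅ := by
          ext p
          simp only [hnew, Set.mem_ofPred_eq, Set.mem_empty_iff_false, iff_false, not_and]
          intro hp
          have := hW.le_numLabels _ hp
          omega
        simp [this]
      | succ r =>
        refine (ncard_le_of_injOn_prod new id (Wr r) (fun _ => Set.univ) N
          Function.injective_id.injOn (hfin r) (fun p hp => ⟨hp.1, ?_⟩)
          (fun _ _ => Set.toFinite _) (fun p hp => Set.mem_univ _) ?_).trans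
          ((Nat.mul_le_mul_left _ (hW.card r)).trans (by rw [pow_succ]; apply le_of_eq; ring))
        · have := hp.2
          simp only [id]
          omega
        · intro _ _
          rw [Set.ncard_univ, Nat.card_eq_fintype_card]
    calc _ ≤ _ := Set.ncard_le_ncard hcover ((hfinold.union hfinnew).image _)
      _ ≤ _ := Set.ncard_image_le (hfinold.union hfinnew)
      _ ≤ _ := Set.ncard_union_le _ _
      _ ≤ m * B * (c * N ^ r) + c * N ^ r := add_le_add hcardold hcardnew
      _ = _ := by ring

lemma Bounded.reverse (hsymm : ∀ u v, lab u v = lab v u) {W : Set (List V)} {m d N c : ℕ}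
    (hW : Bounded lab W m d N c) : Bounded lab (List.reverse '' W) m d N c := by
  refine ⟨?_, ?_, hW.finite.image _, fun r => ?_⟩
  · rintro _ ⟨w, hw, rfl⟩
    simpa using hW.length w hw
  · rintro _ ⟨w, hw, rfl⟩
    simpa [numLabels_reverse hsymm] using hW.le_numLabels w hw
  · have : {w ∈ List.reverse '' W | numLabels lab w ≤ d + r} =
        List.reverse '' {w ∈ W | numLabels lab w ≤ d + r} := by
      ext w
      constructor
      · rintro ⟨⟨w, hw, rfl⟩, h⟩
        exact ⟨w, ⟨hw, by simpa [numLabels_reverse hsymm] using h⟩, rfl⟩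
      · rintro ⟨w, ⟨hw, h⟩, rfl⟩
        exact ⟨⟨w, hw, rfl⟩, by simpa [numLabels_reverse hsymm] using h⟩
    rw [this, List.reverse_injective.injOn.ncard_image]
    exact hW.card r

lemma Bounded.extendLeft [Fintype V] {B : ℕ} (hsymm : ∀ u v, lab u v = lab v u)
    (hB : ∀ v (c : Q), {u | lab v u = some c}.ncard ≤ B) {W : Set (List V)} {m d c : ℕ}
    (hW : Bounded lab W m d (Fintype.card V) c) :
    Bounded lab (extendLeft lab W) (m + 1) d (Fintype.card V) (c * (1 + m * B)) := by
  have h := ((hW.reverse hsymm).extendRight hB).reverse hsymm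
  convert h
  ext w
  constructor
  · rintro ⟨hval, w, hw, u, rfl⟩
    refine ⟨w.reverse ++ [u], ⟨?_, _, ⟨w, hw, rfl⟩, u, rfl⟩, by simp⟩
    rw [← List.reverse_cons]
    exact (valid_reverse hsymm _).2 hval
  · rintro ⟨_, ⟨hval, _, ⟨w, hw, rfl⟩, u, rfl⟩, rfl⟩
    rw [← List.reverse_cons, valid_reverse hsymm] at hval
    simp only [List.reverse_append, List.reverse_cons, List.reverse_nil, List.nil_append,
      List.reverse_reverse, List.singleton_append]
    exact ⟨hval, w, hw, u, rfl⟩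

/-- The constant arising from `i` successive one-step extensions of walks with `m` edges. -/
def extConst (B m : ℕ) : ℕ → ℕ
  | 0 => 1
  | i + 1 => extConst B m i * (1 + (m + i) * B)

/-- Valid walks with `i` steps before and `j` steps after a segment in `W`. -/
def extend (lab : V → V → Option Q) (W : Set (List V)) (i j : ℕ) : Set (List V) :=
  {w | Valid lab w ∧ ∃ x y, x.length = i ∧ y.length = j ∧ ∃ z ∈ W, w = x ++ z ++ y}

lemma Valid.of_append_right {x y : List V} (h : Valid lab (x ++ y)) : Valid lab y := by
  have := labels_drop (lab := lab) (x ++ y) x.length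
  rw [List.drop_left] at this
  rw [Valid, this]
  exact fun hn => h (List.mem_of_mem_drop hn)

lemma Valid.of_append_left {x y : List V} (h : Valid lab (x ++ y)) : Valid lab x := by
  rcases x with _ | ⟨a, x⟩
  · simp [Valid, labels]
  have := labels_take (lab := lab) (a :: x ++ y) x.length
  rw [show x.length + 1 = (a :: x).length from rfl, List.take_left] at this
  rw [Valid, this]
  exact fun hn => h (List.mem_of_mem_take hn)

lemma Bounded.mono {W W' : Set (List V)} {m d N c c' : ℕ} (hW : Bounded lab W m d N c)
    (h : W' ⊆ W) (hc : c ≤ c') : Bounded lab W' m d N c' :=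
  ⟨fun w hw => hW.length w (h hw), fun w hw => hW.le_numLabels w (h hw), hW.finite.subset h,
    fun r => (Set.ncard_le_ncard (t := {w ∈ W | numLabels lab w ≤ d + r})
      (fun _ hw => ⟨h hw.1, hw.2⟩) (hW.finite.subset fun _ hw => hw.1)).trans ((hW.card r).trans (Nat.mul_le_mul_right _ hc))⟩

/-- A segment that is rare for its number of labels stays rare inside longer walks, wherever it
sits; only the constant depends on the number of added steps. -/
lemma Bounded.extend [Fintype V] {B : ℕ} (hsymm : ∀ u v, lab u v = lab v u)
    (hB : ∀ v (c : Q), {u | lab v u = some c}.ncard ≤ B) {W : Set (List V)} {m d c : ℕ}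
    (hW : Bounded lab W m d (Fintype.card V) c) (i j : ℕ) :
    Bounded lab (extend lab W i j) (m + (i + j)) d (Fintype.card V)
      (c * extConst B m (i + j)) := by
  induction j with
  | zero =>
    induction i with
    | zero =>
      refine hW.mono ?_ (by simp [extConst])
      rintro _ ⟨-, x, y, hx, hy, z, hz, rfl⟩
      rw [List.length_eq_zero_iff] at hx hy
      simpa [hx, hy] using hz
    | succ i ih =>
      have h := ih.extendLeft hsymm hB
      rw [show m + (i + 1 + 0) = m + (i + 0) + 1 by omega]
      refine h.mono ?_ (le_of_eq ?_)
      · rintro _ ⟨hval, x, y, hx, hy, z, hz, rfl⟩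
        rcases x with _ | ⟨a, x⟩
        · simp at hx
        refine ⟨hval, x ++ z ++ y, ⟨?_, x, y, by simpa using hx, hy, z, hz, rfl⟩, a, rfl⟩
        exact Valid.of_append_right (x := [a]) hval
      · rw [show i + 1 + 0 = (i + 0) + 1 by omega, extConst, mul_assoc, Nat.add_zero]
  | succ j ih =>
    have h := ih.extendRight hB
    rw [show m + (i + (j + 1)) = m + (i + j) + 1 by omega]
    refine h.mono ?_ (le_of_eq ?_)
    · rintro _ ⟨hval, x, y, hx, hy, z, hz, rfl⟩
      rcases List.eq_nil_or_concat' y with rfl | ⟨y, a, rfl⟩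
      · simp at hy
      rw [← List.append_assoc] at hval
      refine ⟨by rwa [← List.append_assoc], x ++ z ++ y,
        ⟨hval.of_append_left, x, y, hx, by simpa using hy, z, hz, rfl⟩, a, by simp⟩
    · rw [show i + (j + 1) = (i + j) + 1 by omega, extConst, mul_assoc]

end Walks
end SampleCov

namespace SampleCov

/-! ### Depth-first tours of plane trees -/

section TreeWalks

variable {V Q : Type*} {lab : V → V → Option Q}

open Classical in
/-- The closed walks from `v` which traverse a plane tree, encoded as a binary tree, in depth-first
order. -/
noncomputable def treeWalks [Fintype V] (lab : V → V → Option Q) :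
    BinaryTree Unit → V → Finset (List V)
  | .nil, v => {[v]}
  | .node _ l r, v => Finset.image₂ (fun x y => v :: (x ++ y))
      ((Finset.univ.filter fun u => lab v u ≠ none).biUnion fun u => treeWalks lab l u)
      (treeWalks lab r v)

variable [Fintype V]

@[simp] lemma mem_treeWalks_nil {v : V} {w : List V} :
    w ∈ treeWalks lab .nil v ↔ w = [v] := by
  simp [treeWalks]

/-- The encoding is by first child and next sibling: `l` is the subtree at the first child `u` of
`v`, and `r` is what remains of the tree at `v`. The step from the end of `x` to the start of `y` is
the return from `u` to `v`. -/
lemma mem_treeWalks_node {a : Unit} {l r : BinaryTree Unit} {v : V} {w : List V} :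
    w ∈ treeWalks lab (.node a l r) v ↔ ∃ u x y, lab v u ≠ none ∧ x ∈ treeWalks lab l u ∧
      y ∈ treeWalks lab r v ∧ w = v :: (x ++ y) := by
  simp only [treeWalks, Finset.mem_image₂, Finset.mem_biUnion, Finset.mem_filter,
    Finset.mem_univ, true_and]
  constructor
  · rintro ⟨x, ⟨u, hu, hx⟩, y, hy, rfl⟩
    exact ⟨u, x, y, hu, hx, hy, rfl⟩
  · rintro ⟨u, x, y, hu, hx, hy, rfl⟩
    exact ⟨x, ⟨u, hu, hx⟩, y, hy, rfl⟩

lemma exists_cons_of_mem_treeWalks {T : BinaryTree Unit} {v : V} {w : List V}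
    (h : w ∈ treeWalks lab T v) : ∃ y, w = v :: y := by
  cases T with
  | nil => exact ⟨[], by simpa using h⟩
  | node a l r =>
    obtain ⟨u, x, y, -, -, -, rfl⟩ := mem_treeWalks_node.1 h
    exact ⟨_, rfl⟩

lemma exists_concat_of_mem_treeWalks {T : BinaryTree Unit} {v : V} {w : List V}
    (h : w ∈ treeWalks lab T v) : ∃ x, w = x ++ [v] := by
  induction T generalizing v w with
  | nil => exact ⟨[], by simpa using h⟩
  | node a l r _ ih =>
    obtain ⟨u, x, y, -, -, hy, rfl⟩ := mem_treeWalks_node.1 h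
    obtain ⟨z, rfl⟩ := ih hy
    exact ⟨v :: (x ++ z), by simp⟩

lemma length_of_mem_treeWalks {T : BinaryTree Unit} {v : V} {w : List V}
    (h : w ∈ treeWalks lab T v) : w.length = 2 * T.numNodes + 1 := by
  induction T generalizing v w with
  | nil => simp [mem_treeWalks_nil.1 h]
  | node a l r ihl ihr =>
    obtain ⟨u, x, y, -, hx, hy, rfl⟩ := mem_treeWalks_node.1 h
    simp only [List.length_cons, List.length_append, ihl hx, ihr hy, BinaryTree.numNodes]
    ring

lemma edges_node {l r : BinaryTree Unit} {u v : V} {x y : List V}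
    (hx : x ∈ treeWalks lab l u) (hy : y ∈ treeWalks lab r v) :
    edges (v :: (x ++ y)) = (v, u) :: (edges x ++ (u, v) :: edges y) := by
  obtain ⟨y, rfl⟩ := exists_cons_of_mem_treeWalks hy
  obtain ⟨x', hx'⟩ := exists_concat_of_mem_treeWalks hx
  obtain ⟨x, rfl⟩ := exists_cons_of_mem_treeWalks hx
  rw [List.cons_append, edges_cons_cons, ← List.cons_append, hx', List.append_assoc,
    List.singleton_append, edges_append_cons, edges_cons_cons]

lemma labels_node (hsymm : ∀ u v, lab u v = lab v u) {l r : BinaryTree Unit} {u v : V}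
    {x y : List V} (hx : x ∈ treeWalks lab l u) (hy : y ∈ treeWalks lab r v) :
    labels lab (v :: (x ++ y)) = lab v u :: (labels lab x ++ lab v u :: labels lab y) := by
  simp [labels, edges_node hx hy, hsymm u v]

lemma valid_of_mem_treeWalks (hsymm : ∀ u v, lab u v = lab v u) {T : BinaryTree Unit} {v : V}
    {w : List V} (h : w ∈ treeWalks lab T v) : Valid lab w := by
  induction T generalizing v w with
  | nil => simp [mem_treeWalks_nil.1 h, Valid]
  | node a l r ihl ihr =>
    obtain ⟨u, x, y, hu, hx, hy, rfl⟩ := mem_treeWalks_node.1 h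
    have h1 := ihl hx
    have h2 := ihr hy
    rw [Valid] at *
    rw [labels_node hsymm hx hy]
    simp [Ne.symm hu, h1, h2]

/-- The edges of a tree walk come in pairs of mutually reversed edges. -/
lemma exists_perm_of_mem_treeWalks {T : BinaryTree Unit} {v : V} {w : List V}
    (h : w ∈ treeWalks lab T v) :
    ∃ L : List (V × V), L.length = T.numNodes ∧ (edges w).Perm (L ++ L.map Prod.swap) := by
  induction T generalizing v w with
  | nil => exact ⟨[], rfl, by simp [mem_treeWalks_nil.1 h]⟩
  | node a l r ihl ihr =>
    obtain ⟨u, x, y, hu, hx, hy, rfl⟩ := mem_treeWalks_node.1 h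
    obtain ⟨L₁, hL₁, h₁⟩ := ihl hx
    obtain ⟨L₂, hL₂, h₂⟩ := ihr hy
    refine ⟨(v, u) :: (L₁ ++ L₂), by simp [hL₁, hL₂, BinaryTree.numNodes], ?_⟩
    rw [edges_node hx hy]
    classical
    rw [List.perm_iff_count] at *
    intro e
    simp only [List.count_cons, List.count_append, List.cons_append, List.map_cons, List.map_append,
      h₁ e, h₂ e, Prod.swap_prod_mk]
    ring

lemma numLabels_le_of_mem_treeWalks (hsymm : ∀ u v, lab u v = lab v u) {T : BinaryTree Unit}
    {v : V} {w : List V} (h : w ∈ treeWalks lab T v) : numLabels lab w ≤ T.numNodes := by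
  classical
  obtain ⟨L, hL, hperm⟩ := exists_perm_of_mem_treeWalks h
  have : (labels lab w).toFinset ⊆ (L.map fun e => lab e.1 e.2).toFinset := by
    intro c hc
    rw [labels, List.mem_toFinset, (hperm.map _).mem_iff] at hc
    simpa [hsymm, or_comm] using hc
  rw [numLabels_eq, ← hL]
  exact (Finset.card_le_card this).trans ((List.toFinset_card_le _).trans (by simp))

/-- When the number of labels is maximal none is wasted, so the label of the first edge does not
recur before the return to `v`, and both subtours are maximal again. -/
lemma not_mem_labels_of_numLabels_eq (hsymm : ∀ u v, lab u v = lab v u)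
    {l r : BinaryTree Unit} {u v : V} {x y : List V} (hx : x ∈ treeWalks lab l u)
    (hy : y ∈ treeWalks lab r v)
    (h : numLabels lab (v :: (x ++ y)) = l.numNodes + r.numNodes + 1) :
    lab v u ∉ labels lab x ∧ numLabels lab x = l.numNodes ∧ numLabels lab y = r.numNodes := by
  classical
  have h1 := numLabels_le_of_mem_treeWalks hsymm hx
  have h2 := numLabels_le_of_mem_treeWalks hsymm hy
  rw [numLabels_eq] at h h1 h2
  have heq : (labels lab (v :: (x ++ y))).toFinset =
      insert (lab v u) ((labels lab x).toFinset ∪ (labels lab y).toFinset) := by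
    rw [labels_node hsymm hx hy]
    ext c
    simp only [List.toFinset_cons, List.toFinset_append, Finset.mem_insert, Finset.mem_union]
    tauto
  rw [heq] at h
  have h3 := Finset.card_union_le (labels lab x).toFinset (labels lab y).toFinset
  rw [numLabels_eq, numLabels_eq]
  refine ⟨fun hmem => ?_, ?_, ?_⟩
  · rw [Finset.insert_eq_of_mem (by simp [hmem])] at h
    omega
  all_goals
    have h4 := Finset.card_insert_le (lab v u) ((labels lab x).toFinset ∪ (labels lab y).toFinset)
    omega

/-- A tree walk with the maximal number of labels determines its tree. -/
lemma tree_eq_of_mem_treeWalks (hsymm : ∀ u v, lab u v = lab v u) {T T' : BinaryTree Unit}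
    {v : V} {w : List V} (h : w ∈ treeWalks lab T v) (h' : w ∈ treeWalks lab T' v)
    (hw : numLabels lab w = T.numNodes) : T = T' := by
  have hlen := (length_of_mem_treeWalks h).symm.trans (length_of_mem_treeWalks h')
  induction T generalizing T' v w with
  | nil =>
    cases T' with
    | nil => rfl
    | node a l r => simp [BinaryTree.numNodes] at hlen
  | node a l r ihl ihr =>
    cases T' with
    | nil => simp [BinaryTree.numNodes] at hlen
    | node a' l' r' =>
      obtain ⟨u, x, y, hu, hx, hy, rfl⟩ := mem_treeWalks_node.1 h
      obtain ⟨u', x', y', hu', hx', hy', heq⟩ := mem_treeWalks_node.1 h'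
      have hw' : numLabels lab (v :: (x' ++ y')) = l'.numNodes + r'.numNodes + 1 := by
        rw [← heq, hw]
        simp only [BinaryTree.numNodes] at hlen ⊢
        omega
      obtain ⟨h1, h2, h3⟩ := not_mem_labels_of_numLabels_eq hsymm hx hy hw
      obtain ⟨h1', -, -⟩ := not_mem_labels_of_numLabels_eq hsymm hx' hy' hw'
      have hl : labels lab (v :: (x ++ y)) = labels lab (v :: (x' ++ y')) := by rw [heq]
      rw [labels_node hsymm hx hy, labels_node hsymm hx' hy'] at hl
      obtain ⟨huu, hl⟩ := List.cons.inj hl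
      rw [← huu] at hl h1'
      -- The first recurrence of the label of the first edge marks the return to `v`; its position
      -- is the length of the left subtour.
      have hlx : (labels lab x).length = (labels lab x').length := by
        classical
        have := congrArg (List.idxOf (lab v u)) hl
        rwa [List.idxOf_append_of_notMem h1, List.idxOf_append_of_notMem h1',
          List.idxOf_cons_self, List.idxOf_cons_self] at this
      rw [length_labels, length_labels] at hlx
      have hxx : x.length = x'.length := by
        have := length_of_mem_treeWalks hx
        have := length_of_mem_treeWalks hx'
        omega
      obtain ⟨rfl, rfl⟩ := List.append_inj (List.cons.inj heq).2 hxx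
      obtain ⟨z, rfl⟩ := exists_cons_of_mem_treeWalks hx
      obtain ⟨z', hz'⟩ := exists_cons_of_mem_treeWalks hx'
      obtain rfl : u = u' := (List.cons.inj hz').1
      rw [ihl hx hx' h2 ((length_of_mem_treeWalks hx).symm.trans (length_of_mem_treeWalks hx')),
        ihr hy hy' h3 ((length_of_mem_treeWalks hy).symm.trans (length_of_mem_treeWalks hy'))]

/-- All tours of one tree have the same length, so a concatenation can be cut in only one way; tours
through different children differ in their first vertex. -/
lemma card_treeWalks_node {a : Unit} {l r : BinaryTree Unit} {v : V} {b : ℕ}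
    (hb : ∀ u, lab v u ≠ none → (treeWalks lab l u).card = b) :
    (treeWalks lab (.node a l r) v).card =
      {u | lab v u ≠ none}.ncard * b * (treeWalks lab r v).card := by
  classical
  rw [treeWalks, Finset.card_image₂_iff.2, Finset.card_biUnion]
  · rw [Finset.sum_congr rfl (fun u hu => hb u (by simpa using hu)), Finset.sum_const,
      smul_eq_mul]
    congr 2
    rw [Set.ncard_eq_toFinset_card']
    congr 1
    ext; simp
  · intro u _ u' _ huu'
    rw [Function.onFun, Finset.disjoint_left]
    intro w hw hw'
    obtain ⟨y, rfl⟩ := exists_cons_of_mem_treeWalks hw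
    obtain ⟨y', h⟩ := exists_cons_of_mem_treeWalks hw'
    exact huu' (List.cons.inj h).1
  · rintro ⟨x, y⟩ hxy ⟨x', y'⟩ hxy' h
    simp only [Set.mem_prod, Finset.mem_coe, Finset.mem_biUnion] at hxy hxy'
    obtain ⟨⟨u, -, hx⟩, -⟩ := hxy
    obtain ⟨⟨u', -, hx'⟩, -⟩ := hxy'
    have hlen := (length_of_mem_treeWalks hx).trans (length_of_mem_treeWalks hx').symm
    obtain ⟨rfl, rfl⟩ := List.append_inj (List.cons.inj h).2 hlen
    rfl

/-- A walk is tree-like if it traverses some plane tree. -/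
def TreeLike (lab : V → V → Option Q) (w : List V) : Prop :=
  ∃ T v, w ∈ treeWalks lab T v

/-- The detour becomes a new leaf, made the next child of `v` at the visit that follows `x`. The
induction finds this visit in the left or the right subtour. -/
lemma mem_treeWalks_insert {T : BinaryTree Unit} {a v u : V} {x y : List V}
    (h : x ++ v :: y ∈ treeWalks lab T a) (hu : lab v u ≠ none) :
    ∃ T', x ++ v :: u :: v :: y ∈ treeWalks lab T' a := by
  have key : ∀ (T : BinaryTree Unit) (y : List V), v :: y ∈ treeWalks lab T v →
      ∃ T', v :: u :: v :: y ∈ treeWalks lab T' v := fun T y h =>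
    ⟨.node () .nil T, mem_treeWalks_node.2 ⟨u, [u], v :: y, hu, by simp, h, rfl⟩⟩
  induction T generalizing a x y with
  | nil =>
    rw [mem_treeWalks_nil, List.append_eq_singleton_iff] at h
    rcases h with ⟨rfl, h⟩ | ⟨-, h⟩
    · obtain ⟨rfl, rfl⟩ : v = a ∧ y = [] := by simpa using h
      exact key .nil [] (by simp)
    · simp at h
  | node b l r ihl ihr =>
    rcases x with _ | ⟨c, x⟩
    · obtain ⟨z, hz⟩ := exists_cons_of_mem_treeWalks h
      obtain rfl : v = a := (List.cons.inj hz).1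
      exact key _ _ h
    · obtain ⟨u', p, q, hu', hp, hq, heq⟩ := mem_treeWalks_node.1 h
      rw [List.cons_append] at heq
      obtain ⟨rfl, heq'⟩ := List.cons.inj heq
      rcases List.append_eq_append_iff.1 heq' with ⟨z, rfl, hz⟩ | ⟨z, rfl, hz⟩
      · rcases z with _ | ⟨d, z⟩
        · rw [List.nil_append] at hz
          obtain ⟨T', hT'⟩ := ihr (x := []) (y := y) (by rwa [List.nil_append, hz])
          exact ⟨.node () l T', mem_treeWalks_node.2 ⟨u', _, _, hu', hp, hT', by simp⟩⟩
        · obtain ⟨rfl, rfl⟩ := List.cons.inj hz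
          obtain ⟨T', hT'⟩ := ihl hp
          exact ⟨.node () T' r, mem_treeWalks_node.2 ⟨u', _, _, hu', hT', hq, by simp⟩⟩
      · obtain ⟨T', hT'⟩ := ihr (x := z) (y := y) (by rwa [← hz])
        exact ⟨.node () l T', mem_treeWalks_node.2 ⟨u', _, _, hu', hp, hT', by simp⟩⟩

end TreeWalks
end SampleCov

/-! ### Walks using each label twice without following a tree -/

namespace SampleCov

lemma exists_first_repetition {α : Type*} (l : List α) (h : ¬ l.Nodup) :
    ∃ P a M Q, l = P ++ a :: (M ++ a :: Q) ∧ (a :: M).Nodup := by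
  induction l using List.reverseRecOn with
  | nil => simp at h
  | append_singleton l b ih =>
    by_cases hl : l.Nodup
    · have hb : b ∈ l := by
        by_contra hb
        exact h (by simpa [List.nodup_append, hl] using fun a ha (hab : a = b) => hb (hab ▸ ha))
      obtain ⟨P, M, rfl⟩ := List.append_of_mem hb
      exact ⟨P, b, M, [], by simp, (List.nodup_append.1 hl).2.1⟩
    · obtain ⟨P, a, M, Q, rfl, hM⟩ := ih hl
      exact ⟨P, a, M, Q ++ [b], by simp, hM⟩

section BadWalks

variable {V Q : Type*} {lab : V → V → Option Q}

open Classical in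
/-- Each label of the walk occurs exactly twice. -/
def EachTwice (lab : V → V → Option Q) (w : List V) : Prop :=
  ∀ c ∈ labels lab w, (labels lab w).count c = 2

lemma EachTwice.two_mul_numLabels {w : List V} (h : EachTwice lab w) :
    2 * numLabels lab w = w.length - 1 := by
  classical
  rw [numLabels_eq, ← length_labels (lab := lab), ← List.sum_toFinset_count_eq_length]
  rw [Finset.sum_congr rfl (fun c hc => ?_), Finset.sum_const, smul_eq_mul, mul_comm]
  · convert! h c (by simpa using hc)

open Classical in
/-- Some label of the walk occurs exactly once. -/
def HasSingleLabel (lab : V → V → Option Q) (w : List V) : Prop :=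
  ∃ c, (labels lab w).count c = 1

lemma HasSingleLabel.exists_filter_eq {w : List V} (h : HasSingleLabel lab w) :
    ∃ c ∈ labels lab w, ∀ f : V × V → Bool, (∀ e, f e = true ↔ lab e.1 e.2 = c) →
      ∃ e, (edges w).filter f = [e] := by
  classical
  obtain ⟨c, hc⟩ := h
  refine ⟨c, List.count_pos_iff.1 (by rw [hc]; exact one_pos), fun f hf => ?_⟩
  rw [← List.length_eq_one_iff, ← hc, labels, List.count, List.countP_map,
    List.countP_eq_length_filter]
  congr 1
  apply List.filter_congr
  intro e _
  rw [Bool.eq_iff_iff, hf]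
  simp

/-- Every label accounts for at least two edges, and equality of the sums forces exactly two. -/
lemma two_mul_numLabels_le {w : List V} (h : ¬ HasSingleLabel lab w) :
    2 * numLabels lab w ≤ w.length - 1 ∧
      (2 * numLabels lab w = w.length - 1 → EachTwice lab w) := by
  classical
  have htwo : ∀ c ∈ (labels lab w).toFinset, 2 ≤ (labels lab w).count c := by
    intro c hc
    have h1 := List.count_pos_iff.2 (List.mem_toFinset.1 hc)
    have h2 : (labels lab w).count c ≠ 1 := fun h' => h ⟨c, by convert! h'⟩
    omega
  have hsum : ∑ c ∈ (labels lab w).toFinset, (labels lab w).count c = w.length - 1 := by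
    rw [← length_labels (lab := lab), ← List.sum_toFinset_count_eq_length]
    congr!
  have h1 := Finset.card_nsmul_le_sum _ _ 2 htwo
  rw [smul_eq_mul, ← numLabels_eq, mul_comm] at h1
  refine ⟨h1.trans hsum.le, fun heq => ?_⟩
  have h2 : ∑ c ∈ (labels lab w).toFinset, 2 =
      ∑ c ∈ (labels lab w).toFinset, (labels lab w).count c := by
    rw [hsum, Finset.sum_const, ← numLabels_eq, smul_eq_mul, mul_comm, heq]
  intro c hc
  convert! ((Finset.sum_eq_sum_iff_of_le htwo).1 h2 c (List.mem_toFinset.2 hc)).symm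

/-- Paths of length two with equal labels which do not backtrack. -/
def bentPaths (lab : V → V → Option Q) : Set (V × V × V) :=
  {x | lab x.1 x.2.1 ≠ none ∧ lab x.1 x.2.1 = lab x.2.1 x.2.2 ∧ x.1 ≠ x.2.2}

/-- Pairs of edges with equal labels. -/
def equalPairs (lab : V → V → Option Q) : Set ((V × V) × (V × V)) :=
  {x | lab x.1.1 x.1.2 ≠ none ∧ lab x.1.1 x.1.2 = lab x.2.1 x.2.2}

/-- Carries a factorization of the label list over to the vertices: the `M.length + 2` labels from
one `a` to the next span `M.length + 3` vertices. -/
lemma exists_segment {w : List V} {P M R : List (Option Q)} {a : Option Q}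
    (heq : labels lab w = P ++ a :: (M ++ a :: R)) :
    ∃ x seg y, w = x ++ seg ++ y ∧ x.length = P.length ∧ seg.length = M.length + 3 ∧
      y.length = R.length ∧ labels lab seg = a :: (M ++ [a]) := by
  have hlen := length_labels (lab := lab) w
  rw [heq] at hlen
  simp only [List.length_append, List.length_cons] at hlen
  refine ⟨w.take P.length, (w.drop P.length).take (M.length + 3),
    (w.drop P.length).drop (M.length + 3), ?_, ?_, ?_, ?_, ?_⟩
  · rw [List.append_assoc, List.take_append_drop, List.take_append_drop]
  · rw [List.length_take]; omega
  · rw [List.length_take, List.length_drop]; omega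
  · rw [List.length_drop, List.length_drop]; omega
  · rw [labels_take, labels_drop, heq, List.drop_left,
      show a :: (M ++ a :: R) = (a :: (M ++ [a])) ++ R by simp]
    exact List.take_left' (by simp)

variable [Fintype V]

/-- Walks with `k` labels, each of which occurs twice, that are not tree-like. -/
def badWalks (lab : V → V → Option Q) (k : ℕ) : Set (List V) :=
  {w | w.length = 2 * k + 1 ∧ Valid lab w ∧ EachTwice lab w ∧ ¬ TreeLike lab w}

/-- The walks along the elements of `bentPaths`. -/
def bentSegments (lab : V → V → Option Q) : Set (List V) :=
  {w | ∃ x ∈ bentPaths lab, w = [x.1, x.2.1, x.2.2]}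

/-- Walks whose first and last label agree, all other labels being distinct. -/
def arcSegments (lab : V → V → Option Q) (n : ℕ) : Set (List V) :=
  {w | n + 2 ≤ numLabels lab w ∧ ∃ x ∈ equalPairs lab, ∃ z : List V, z.length = n ∧
    w = x.1.1 :: x.1.2 :: (z ++ [x.2.1, x.2.2])}

lemma finite_length (n : ℕ) : {l : List V | l.length = n}.Finite := List.finite_length_eq V n

lemma ncard_length (n : ℕ) : {l : List V | l.length = n}.ncard = Fintype.card V ^ n := by
  rw [← Nat.card_coe_set_eq, ← card_vector (α := V) n, ← Nat.card_eq_fintype_card]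
  rfl

lemma bounded_of_ncard_le {W : Set (List V)} {m d c : ℕ}
    (hlen : ∀ w ∈ W, w.length = m + 1) (hnum : ∀ w ∈ W, d ≤ numLabels lab w)
    (hcard : W.ncard ≤ c) : Bounded lab W m d (Fintype.card V) c := by
  have hfin : W.Finite := (finite_length (m + 1)).subset hlen
  refine ⟨hlen, hnum, hfin, fun r => ?_⟩
  rcases W.eq_empty_or_nonempty with rfl | ⟨w, hw⟩
  · simp
  · have hV : 1 ≤ Fintype.card V := by
      have := hlen w hw
      rcases w with _ | ⟨v, w⟩
      · simp at this
      · exact Fintype.card_pos_iff.2 ⟨v⟩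
    exact ((Set.ncard_le_ncard (fun w hw => hw.1) hfin).trans hcard).trans
      (Nat.le_mul_of_pos_right _ (Nat.pow_pos hV))

lemma bounded_bentSegments : Bounded lab (bentSegments lab) 2 1 (Fintype.card V)
    (bentPaths lab).ncard := by
  classical
  refine bounded_of_ncard_le ?_ ?_ ?_
  · rintro _ ⟨x, -, rfl⟩
    rfl
  · rintro _ ⟨x, -, rfl⟩
    rw [numLabels_eq]
    exact Finset.card_pos.2 ⟨lab x.1 x.2.1, by simp⟩
  · refine (Set.ncard_le_ncard ?_ ((Set.toFinite (bentPaths lab)).image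
      fun x => [x.1, x.2.1, x.2.2])).trans (Set.ncard_image_le (Set.toFinite _))
    rintro _ ⟨x, hx, rfl⟩
    exact ⟨x, hx, rfl⟩

/-- With `N = card V`, walks with `n + 2` labels generally number up to order `N^(n+3)`. Under (MP1)
there are only `o(N^3)` equal pairs, so the bound here is of smaller order. -/
lemma bounded_arcSegments (n : ℕ) : Bounded lab (arcSegments lab n) (n + 3) (n + 2)
    (Fintype.card V) ((equalPairs lab).ncard * Fintype.card V ^ n) := by
  refine bounded_of_ncard_le ?_ ?_ ?_
  · rintro _ ⟨-, x, -, z, hz, rfl⟩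
    simp [hz]
  · exact fun w hw => hw.1
  · have hfin : (equalPairs lab ×ˢ {l : List V | l.length = n}).Finite :=
      (Set.toFinite _).prod (finite_length n)
    refine (Set.ncard_le_ncard ?_ (hfin.image
      fun p => p.1.1.1 :: p.1.1.2 :: (p.2 ++ [p.1.2.1, p.1.2.2]))).trans
      ((Set.ncard_image_le hfin).trans ?_)
    · rintro _ ⟨-, x, hx, z, hz, rfl⟩
      exact ⟨(x, z), ⟨hx, hz⟩, rfl⟩
    · rw [Set.ncard_prod, ncard_length]

lemma badWalks_zero : badWalks lab 0 = ∅ := by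
  rw [Set.eq_empty_iff_forall_notMem]
  rintro w ⟨hlen, -, -, htree⟩
  obtain ⟨v, rfl⟩ := List.length_eq_one_iff.1 hlen
  exact htree ⟨.nil, v, by simp⟩

lemma finite_badWalks (k : ℕ) : (badWalks lab k).Finite :=
  (finite_length (2 * k + 1)).subset fun _ hw => hw.1

/-- Insert a detour to `u` after position `i`. -/
def insertBacktrack (x : ℕ × V × List V) : List V :=
  x.2.2.take (x.1 + 1) ++ x.2.1 :: x.2.2.drop x.1

/-- The label of the deleted pair occurs nowhere else, so the other multiplicities do not change; a
tree for the shorter walk would give one for the longer walk by `mem_treeWalks_insert`. -/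
lemma badWalks_of_backtrack {k : ℕ} {x y : List V} {p q : V}
    (hw : x ++ p :: q :: p :: y ∈ badWalks lab (k + 1)) (hpq : lab p q = lab q p) :
    x ++ p :: y ∈ badWalks lab k := by
  classical
  obtain ⟨hlen, hval, htwice, htree⟩ := hw
  set P := labels lab (x ++ [p]) with hP
  set R := labels lab (p :: y) with hR
  set a := lab p q with ha
  have h1 : labels lab (x ++ p :: q :: p :: y) = P ++ a :: a :: R := by
    rw [labels_append_cons, labels_cons_cons, labels_cons_cons, ← hpq]
  have h2 : labels lab (x ++ p :: y) = P ++ R := by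
    rw [labels_append_cons]
  rw [Valid, h1] at hval
  rw [EachTwice, h1] at htwice
  refine ⟨?_, ?_, ?_, ?_⟩
  · simp only [List.length_append, List.length_cons] at hlen ⊢
    omega
  · rw [Valid, h2]
    simp only [List.mem_append, List.mem_cons] at hval ⊢
    tauto
  · rw [EachTwice, h2]
    intro c hc
    have h3 := htwice c (by simp only [List.mem_append, List.mem_cons] at hc ⊢; tauto)
    have h4 := htwice a (by simp)
    have hca : c ≠ a := by
      rintro rfl
      simp only [List.count_append, List.count_cons, beq_self_eq_true, if_true] at h4
      rcases List.mem_append.1 hc with hc | hc <;>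
      have := List.count_pos_iff.2 hc <;> omega
    simpa [List.count_append, List.count_cons, Ne.symm hca] using h3
  · rintro ⟨T, v, hT⟩
    obtain ⟨T', hT'⟩ := mem_treeWalks_insert (u := q) hT (fun h => hval (by simp [ha, h]))
    exact htree ⟨T', v, hT'⟩

/-- Consider a repeated label with distinct labels in between. If its two edges are adjacent, they
form a bent path or a backtrack, and deleting the latter leaves a shorter bad walk. Otherwise they
bound an arc segment with `p.1 + 2` of the `k + 1` labels, which leaves `k - 1 - p.1` labels for the
rest. -/
lemma badWalks_succ_subset (k : ℕ) : badWalks lab (k + 1) ⊆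
    (⋃ i ∈ Finset.range (2 * k + 2),
      {w ∈ extend lab (bentSegments lab) i (2 * k - i) | numLabels lab w ≤ 1 + k}) ∪
    insertBacktrack '' (↑(Finset.range (2 * k + 2)) ×ˢ Set.univ ×ˢ badWalks lab k) ∪
    (⋃ p ∈ Finset.range k ×ˢ Finset.range (2 * k + 2),
      {w ∈ extend lab (arcSegments lab p.1) p.2 (2 * k - 1 - p.1 - p.2) |
        numLabels lab w ≤ p.1 + 2 + (k - 1 - p.1)}) := by
  classical
  rintro w hw
  obtain ⟨hlen, hval, htwice, htree⟩ := id hw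
  have hnum := htwice.two_mul_numLabels
  have hnodup : ¬ (labels lab w).Nodup := by
    intro hn
    have h0 : 0 < (labels lab w).length := by rw [length_labels]; omega
    obtain ⟨c, hc⟩ := List.exists_mem_of_length_pos h0
    have h1 := htwice c hc
    have h2 := List.nodup_iff_count_le_one.1 hn c
    omega
  obtain ⟨P, a, M, R, heq, hM⟩ := exists_first_repetition _ hnodup
  obtain ⟨x, seg, y, rfl, hx, hseg, hy, hlab⟩ := exists_segment heq
  have ha : a ≠ none := by
    rintro rfl
    exact hval (by rw [heq]; simp)
  simp only [List.length_append] at hlen hnum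
  rcases M with _ | ⟨b, M⟩
  · obtain ⟨p, q, s, rfl⟩ := List.length_eq_three.1 hseg
    simp only [labels_cons_cons, labels_singleton, List.nil_append, List.cons.injEq,
      and_true] at hlab
    simp only [List.length_nil] at hseg
    by_cases hps : p = s
    · subst hps
      refine Or.inl (Or.inr ⟨(x.length, q, x ++ p :: y), ⟨?_, Set.mem_univ _, ?_⟩, ?_⟩)
      · simp only [Finset.coe_range, Set.mem_Iio]; omega
      · exact badWalks_of_backtrack (by simpa using hw) (hlab.1.trans hlab.2.symm)
      · simp [insertBacktrack, List.take_append]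
    · refine Or.inl (Or.inl ?_)
      simp only [Set.mem_iUnion, Finset.mem_range]
      exact ⟨x.length, by omega, ⟨hval, x, y, rfl, by omega, [p, q, s], ⟨(p, q, s),
        ⟨by rwa [hlab.1], by rw [hlab.1, hlab.2], hps⟩, rfl⟩, rfl⟩, by omega⟩
  · refine Or.inr ?_
    simp only [List.length_cons] at hseg
    obtain ⟨v₀, v₁, z, v₂, v₃, hz, rfl⟩ : ∃ v₀ v₁ z v₂ v₃, z.length = M.length ∧
        seg = v₀ :: v₁ :: (z ++ [v₂, v₃]) := by
      rcases seg with _ | ⟨v₀, _ | ⟨v₁, t⟩⟩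
      · simp at hseg
      · simp at hseg
      rcases List.eq_nil_or_concat' t with rfl | ⟨t, v₃, rfl⟩
      · simp at hseg
      rcases List.eq_nil_or_concat' t with rfl | ⟨z, v₂, rfl⟩
      · simp at hseg
      exact ⟨v₀, v₁, z, v₂, v₃, by simpa using hseg, by simp⟩
    have hlast : labels lab (v₀ :: v₁ :: z ++ [v₂, v₃]) =
        labels lab (v₀ :: v₁ :: z ++ [v₂]) ++ [lab v₂ v₃] := labels_concat_concat _ _ _
    have h23 : lab v₂ v₃ = a := by
      rw [List.cons_append, List.cons_append, hlab, ← List.cons_append] at hlast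
      simpa using (List.append_inj_right' hlast rfl).symm
    have h01 : lab v₀ v₁ = a := by
      rw [labels_cons_cons] at hlab
      exact (List.cons.inj hlab).1
    have hsegnum : numLabels lab (v₀ :: v₁ :: (z ++ [v₂, v₃])) = M.length + 2 := by
      rw [numLabels_eq, hlab]
      have : (a :: (b :: M ++ [a])).toFinset = (a :: b :: M).toFinset := by
        ext c; simp; tauto
      rw [this, List.toFinset_card_of_nodup hM]
      simp
    have hle : M.length + 2 ≤ k + 1 := by
      have h1 : numLabels lab (v₀ :: v₁ :: (z ++ [v₂, v₃])) ≤
          numLabels lab (x ++ (v₀ :: v₁ :: (z ++ [v₂, v₃])) ++ y) := by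
        rw [numLabels_eq, numLabels_eq]
        refine Finset.card_le_card fun c hc => ?_
        rw [hlab] at hc
        rw [heq]
        simp only [List.mem_toFinset, List.mem_append, List.mem_cons, List.not_mem_nil] at hc ⊢
        tauto
      omega
    simp only [Set.mem_iUnion]
    exact ⟨(M.length, x.length), by simp only [Finset.mem_product, Finset.mem_range]; omega,
      ⟨hval, x, y, rfl, by simp only; omega, _, ⟨hsegnum.ge, ((v₀, v₁), (v₂, v₃)),
        ⟨by rwa [h01], h01.trans h23.symm⟩, z, hz, rfl⟩, rfl⟩, by simp only; omega⟩

/-- The constant in the bound for the number of bad walks. -/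
def badConst (B : ℕ) : ℕ → ℕ
  | 0 => 0
  | k + 1 => (2 * k + 2) * (∑ i ∈ Finset.range (2 * k + 2), extConst B 2 (i + (2 * k - i)) +
      badConst B k + ∑ p ∈ Finset.range k ×ˢ Finset.range (2 * k + 2),
        extConst B (p.1 + 3) (p.2 + (2 * k - 1 - p.1 - p.2)))

/-- Union bound over the three cases and over the positions of the segment. A backtrack costs a
position and one free vertex on top of the induction hypothesis. The factor `card V ^ 2` on the left
avoids a division: arcs contribute the number of equal pairs times `card V ^ (k - 2)`. -/
lemma ncard_badWalks_le {B : ℕ} (hsymm : ∀ u v, lab u v = lab v u)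
    (hB : ∀ v (c : Q), {u | lab v u = some c}.ncard ≤ B) (k : ℕ) :
    (badWalks lab k).ncard * Fintype.card V ^ 2 ≤ badConst B k * Fintype.card V ^ k *
      ((bentPaths lab).ncard * Fintype.card V + (equalPairs lab).ncard) := by
  set N := Fintype.card V with hN
  set N3 := (bentPaths lab).ncard with hN3
  set N1 := (equalPairs lab).ncard with hN1
  induction k with
  | zero => simp [badWalks_zero]
  | succ k ih =>
    have h1 : ∀ i, Bounded lab (extend lab (bentSegments lab) i (2 * k - i)) _ _ _ _ := fun i =>
      bounded_bentSegments.extend hsymm hB i (2 * k - i)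
    have h2 : ∀ p : ℕ × ℕ, Bounded lab (extend lab (arcSegments lab p.1) p.2
        (2 * k - 1 - p.1 - p.2)) _ _ _ _ := fun p =>
      (bounded_arcSegments p.1).extend hsymm hB p.2 (2 * k - 1 - p.1 - p.2)
    rw [← hN, ← hN3] at h1
    rw [← hN, ← hN1] at h2
    have hfin3 : ((Finset.range (2 * k + 2) : Set ℕ) ×ˢ (Set.univ : Set V) ×ˢ
        badWalks lab k).Finite :=
      (Finset.finite_toSet _).prod (Set.finite_univ.prod (finite_badWalks k))
    have hfin : (_ : Set (List V)).Finite := (((Finset.range (2 * k + 2)).finite_toSet.biUnion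
      fun i _ => (h1 i).finite.subset (fun _ hw => hw.1 : {w ∈ extend lab (bentSegments lab) i
        (2 * k - i) | numLabels lab w ≤ 1 + k} ⊆ _)).union (hfin3.image insertBacktrack)).union
      ((Finset.range k ×ˢ Finset.range (2 * k + 2)).finite_toSet.biUnion
        fun p _ => (h2 p).finite.subset (fun _ hw => hw.1 : {w ∈ extend lab (arcSegments lab p.1)
          p.2 (2 * k - 1 - p.1 - p.2) | numLabels lab w ≤ p.1 + 2 + (k - 1 - p.1)} ⊆ _))
    have hcard := (Set.ncard_le_ncard (badWalks_succ_subset k) hfin).trans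
      ((Set.ncard_union_le _ _).trans (add_le_add (Set.ncard_union_le _ _) le_rfl))
    have b1 := (Finset.set_ncard_biUnion_le (Finset.range (2 * k + 2)) fun i =>
      {w ∈ extend lab (bentSegments lab) i (2 * k - i) | numLabels lab w ≤ 1 + k}).trans
      (Finset.sum_le_sum fun i _ => (h1 i).card k)
    have b2 := (Finset.set_ncard_biUnion_le (Finset.range k ×ˢ Finset.range (2 * k + 2)) fun p =>
      {w ∈ extend lab (arcSegments lab p.1) p.2 (2 * k - 1 - p.1 - p.2) |
        numLabels lab w ≤ p.1 + 2 + (k - 1 - p.1)}).trans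
      (Finset.sum_le_sum fun p _ => (h2 p).card (k - 1 - p.1))
    have b3 := Set.ncard_image_le (f := insertBacktrack) hfin3
    rw [Set.ncard_prod, Set.ncard_prod, Set.ncard_univ, Nat.card_eq_fintype_card, ← hN,
      Set.ncard_coe_finset, Finset.card_range] at b3
    set S1 := ∑ i ∈ Finset.range (2 * k + 2), extConst B 2 (i + (2 * k - i)) with hS1
    set S2 := ∑ p ∈ Finset.range k ×ˢ Finset.range (2 * k + 2),
        extConst B (p.1 + 3) (p.2 + (2 * k - 1 - p.1 - p.2)) with hS2
    have c1 : ∑ i ∈ Finset.range (2 * k + 2), N3 * extConst B 2 (i + (2 * k - i)) * N ^ k =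
        S1 * N3 * N ^ k := by
      rw [hS1, Finset.sum_mul, Finset.sum_mul]
      exact Finset.sum_congr rfl fun i _ => by ring
    have c2 : (∑ p ∈ Finset.range k ×ˢ Finset.range (2 * k + 2), N1 * N ^ p.1 *
        extConst B (p.1 + 3) (p.2 + (2 * k - 1 - p.1 - p.2)) * N ^ (k - 1 - p.1)) * N ^ 2 =
        S2 * N1 * N ^ (k + 1) := by
      rw [hS2, Finset.sum_mul, Finset.sum_mul, Finset.sum_mul]
      refine Finset.sum_congr rfl fun p hp => ?_
      have : p.1 < k := Finset.mem_range.1 (Finset.mem_product.1 hp).1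
      rw [show k + 1 = p.1 + (k - 1 - p.1) + 2 by omega, pow_add, pow_add]
      ring
    rw [c1] at b1
    have b2' := Nat.mul_le_mul_right (N ^ 2) b2
    rw [c2] at b2'
    refine (Nat.mul_le_mul_right (N ^ 2) hcard).trans ?_
    rw [add_mul, add_mul]
    refine (add_le_add (add_le_add (Nat.mul_le_mul_right _ b1) (Nat.mul_le_mul_right _ b3))
      b2').trans ?_
    have hih := Nat.mul_le_mul_left ((2 * k + 2) * N) ih
    have e3 : (2 * k + 2) * (N * (badWalks lab k).ncard) * N ^ 2 =
      (2 * k + 2) * N * ((badWalks lab k).ncard * N ^ 2) := by ring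
    rw [e3]
    refine (add_le_add (add_le_add le_rfl hih) le_rfl).trans ?_
    rw [badConst, ← hS1, ← hS2]
    have d1 : S1 * N3 * N ^ k * N ^ 2 ≤ (2 * k + 2) * S1 * N ^ (k + 1) * (N3 * N + N1) := by
      calc _ = S1 * N ^ (k + 1) * (N3 * N) := by ring
        _ ≤ _ := by gcongr ?_ * _ * ?_
                    · exact Nat.le_mul_of_pos_left _ (by omega)
                    · exact Nat.le_add_right _ _
    have d2 : S2 * N1 * N ^ (k + 1) ≤ (2 * k + 2) * S2 * N ^ (k + 1) * (N3 * N + N1) := by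
      calc _ = S2 * N ^ (k + 1) * N1 := by ring
        _ ≤ _ := by gcongr ?_ * _ * ?_
                    · exact Nat.le_mul_of_pos_left _ (by omega)
                    · exact Nat.le_add_left _ _
    refine (add_le_add (add_le_add d1 le_rfl) d2).trans (le_of_eq ?_)
    ring

/-- Extend single vertices, which carry no label: one factor `card V` for the start and one for each
label. -/
lemma ncard_few_labels_le {B : ℕ} (hsymm : ∀ u v, lab u v = lab v u)
    (hB : ∀ v (c : Q), {u | lab v u = some c}.ncard ≤ B) (m r : ℕ) :
    {w | w.length = m + 1 ∧ Valid lab w ∧ numLabels lab w ≤ r}.ncard ≤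
      extConst B 0 m * Fintype.card V ^ (r + 1) := by
  classical
  have h0 : Bounded lab {w : List V | w.length = 1} 0 0 (Fintype.card V) (Fintype.card V) := by
    refine bounded_of_ncard_le (fun _ hw => hw) (fun _ _ => Nat.zero_le _) ?_
    rw [ncard_length, pow_one]
  have h1 := h0.extend hsymm hB 0 m
  have h2 := h1.card r
  refine (Set.ncard_le_ncard ?_ (h1.finite.subset fun _ hw => hw.1)).trans (h2.trans ?_)
  · rintro w ⟨hlen, hval, hnum⟩
    rcases w with _ | ⟨v, w⟩
    · simp at hlen
    · exact ⟨⟨hval, [], w, rfl, by simpa using hlen, [v], rfl, rfl⟩, by simpa using hnum⟩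
  · rw [zero_add, pow_succ]
    exact le_of_eq (by ring)

end BadWalks
end SampleCov

namespace SampleCov

/-! ### Expectations of products of entries along a walk -/

section Entries

variable {s t : ℕ} {Ω : Type*}

/-- The label of an edge of the complete bipartite graph is its equivalence class. -/
def edgeLabel (r : Setoid (Fin s × Fin t)) :
    Fin s ⊕ Fin t → Fin s ⊕ Fin t → Option (Quotient r)
  | .inl p, .inr q => some ⟦(p, q)⟧
  | .inr q, .inl p => some ⟦(p, q)⟧
  | .inl _, .inl _ => none
  | .inr _, .inr _ => none

/-- The entries of the Hermitian block matrix with off-diagonal blocks `a` and `a^*`. -/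
noncomputable def blockEntry (a : Fin s × Fin t → Ω → ℂ) :
    Fin s ⊕ Fin t → Fin s ⊕ Fin t → Ω → ℂ
  | .inl p, .inr q => a (p, q)
  | .inr q, .inl p => fun ω => star (a (p, q) ω)
  | .inl _, .inl _ => 0
  | .inr _, .inr _ => 0

variable {r : Setoid (Fin s × Fin t)} {a : Fin s × Fin t → Ω → ℂ}

lemma edgeLabel_symm (u v : Fin s ⊕ Fin t) : edgeLabel r u v = edgeLabel r v u := by
  rcases u with u | u <;> rcases v with v | v <;> rfl

lemma blockEntry_eq_zero {u v : Fin s ⊕ Fin t} (h : edgeLabel r u v = none) :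
    blockEntry a u v = 0 := by
  rcases u with u | u <;> rcases v with v | v <;> simp [edgeLabel] at h <;> rfl

/-- The product of the entries along a list of edges. -/
noncomputable def listWeight (a : Fin s × Fin t → Ω → ℂ)
    (l : List ((Fin s ⊕ Fin t) × (Fin s ⊕ Fin t))) (ω : Ω) : ℂ :=
  (l.map fun e => blockEntry a e.1 e.2 ω).prod

open Classical in
lemma listWeight_eq_prod [Fintype (Quotient r)] (a : Fin s × Fin t → Ω → ℂ)
    (l : List ((Fin s ⊕ Fin t) × (Fin s ⊕ Fin t)))
    (hl : ∀ e ∈ l, edgeLabel r e.1 e.2 ≠ none) (ω : Ω) :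
    listWeight a l ω =
      ∏ c : Quotient r, listWeight a (l.filter fun e => edgeLabel r e.1 e.2 = some c) ω := by
  induction l with
  | nil => simp [listWeight]
  | cons e l ih =>
    obtain ⟨c, hc⟩ := Option.ne_none_iff_exists'.1 (hl e List.mem_cons_self)
    have h1 : listWeight a (e :: l) ω = blockEntry a e.1 e.2 ω * listWeight a l ω := by
      simp [listWeight]
    have h2 : ∀ d : Quotient r,
        listWeight a ((e :: l).filter fun e => edgeLabel r e.1 e.2 = some d) ω =
        (if c = d then blockEntry a e.1 e.2 ω else 1) *
          listWeight a (l.filter fun e => edgeLabel r e.1 e.2 = some d) ω := by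
      intro d
      by_cases hd : c = d
      · subst hd
        rw [List.filter_cons_of_pos (by simpa using hc)]
        simp [listWeight]
      · rw [List.filter_cons_of_neg (by simpa [hc] using hd)]
        simp [hd]
    rw [h1, Finset.prod_congr rfl fun d _ => h2 d, Finset.prod_mul_distrib, Finset.prod_ite_eq,
      if_pos (Finset.mem_univ _), ← ih fun e he => hl e (List.mem_cons_of_mem _ he)]

lemma edgeLabel_ne_none_of_valid {w : List (Fin s ⊕ Fin t)} (h : Valid (edgeLabel r) w) :
    ∀ e ∈ edges w, edgeLabel r e.1 e.2 ≠ none := fun e he hn =>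
  h (List.mem_map.2 ⟨e, he, hn⟩)

lemma listWeight_eq_zero_of_not_valid {w : List (Fin s ⊕ Fin t)} (h : ¬ Valid (edgeLabel r) w) :
    listWeight a (edges w) = 0 := by
  rw [Valid, not_not, labels, List.mem_map] at h
  obtain ⟨e, he, hn⟩ := h
  funext ω
  refine List.prod_eq_zero (List.mem_map.2 ⟨e, he, ?_⟩)
  rw [blockEntry_eq_zero hn]
  rfl

/-- A product of `k` numbers is at most the `k`-th power of the largest, hence at most the sum of
the `k`-th powers. This replaces Hölder's inequality at the price of a factor `k`. -/
lemma enorm_listWeight_le (l : List ((Fin s ⊕ Fin t) × (Fin s ⊕ Fin t))) (hl : l ≠ []) (ω : Ω) :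
    ‖listWeight a l ω‖ₑ ≤ (l.map fun e => ‖blockEntry a e.1 e.2 ω‖ₑ ^ l.length).sum := by
  classical
  have h1 : ‖listWeight a l ω‖ₑ = (l.map fun e => ‖blockEntry a e.1 e.2 ω‖ₑ).prod := by
    rw [listWeight]
    clear hl
    induction l with
    | nil => simp
    | cons e l ih => simp [enorm_mul, ih]
  obtain ⟨e₀, he₀, hmax⟩ := l.toFinset.exists_max_image (fun e => ‖blockEntry a e.1 e.2 ω‖ₑ)
    ((List.toFinset_nonempty_iff l).2 hl)
  rw [h1]
  calc _ ≤ ‖blockEntry a e₀.1 e₀.2 ω‖ₑ ^ (l.map fun e => ‖blockEntry a e.1 e.2 ω‖ₑ).length := by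
        refine List.prod_le_pow_card _ _ fun x hx => ?_
        obtain ⟨e, he, rfl⟩ := List.mem_map.1 hx
        exact hmax e (by simpa using he)
    _ ≤ _ := by
        rw [List.length_map]
        exact List.le_sum_of_mem (List.mem_map.2 ⟨e₀, by simpa using he₀, rfl⟩)

/-- An entry is a function of the family of entries in its class. -/
lemma exists_blockEntry_eq (a : Fin s × Fin t → Ω → ℂ) (c : Quotient r) {u v : Fin s ⊕ Fin t}
    (h : edgeLabel r u v = some c) :
    ∃ φ : ({x : Fin s × Fin t // Quotient.mk r x = c} → ℂ) → ℂ, Measurable φ ∧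
      ∀ ω, blockEntry a u v ω = φ fun x => a x.1 ω := by
  rcases u with u | u <;> rcases v with v | v <;> simp only [edgeLabel, reduceCtorEq] at h
  · exact ⟨fun y => y ⟨(u, v), Option.some.inj h⟩, measurable_pi_apply _, fun _ => rfl⟩
  · exact ⟨fun y => star (y ⟨(v, u), Option.some.inj h⟩),
      continuous_star.measurable.comp (measurable_pi_apply _), fun _ => rfl⟩

open Classical in
lemma exists_listWeight_filter_eq (a : Fin s × Fin t → Ω → ℂ) (c : Quotient r)
    (l : List ((Fin s ⊕ Fin t) × (Fin s ⊕ Fin t))) :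
    ∃ φ : ({x : Fin s × Fin t // Quotient.mk r x = c} → ℂ) → ℂ, Measurable φ ∧
      ∀ ω, listWeight a (l.filter fun e => edgeLabel r e.1 e.2 = some c) ω =
        φ fun x => a x.1 ω := by
  induction l with
  | nil => exact ⟨1, measurable_const, fun _ => by simp [listWeight]⟩
  | cons e l ih =>
    obtain ⟨φ, hφ, h⟩ := ih
    by_cases he : edgeLabel r e.1 e.2 = some c
    · obtain ⟨ψ, hψ, h'⟩ := exists_blockEntry_eq a c he
      refine ⟨fun y => ψ y * φ y, hψ.mul hφ, fun ω => ?_⟩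
      rw [List.filter_cons_of_pos (by simpa using he)]
      simp only [← h, ← h']
      simp [listWeight]
    · refine ⟨φ, hφ, fun ω => ?_⟩
      rw [List.filter_cons_of_neg (by simpa using he), h]

variable [MeasurableSpace Ω] {P : Measure Ω}

lemma measurable_blockEntry (hmeas : ∀ x, Measurable (a x)) (u v : Fin s ⊕ Fin t) :
    Measurable (blockEntry a u v) := by
  rcases u with u | u <;> rcases v with v | v
  · exact measurable_const
  · exact hmeas _
  · exact (continuous_star.measurable).comp (hmeas _)
  · exact measurable_const

lemma integral_blockEntry (hcentered : ∀ x, ∫ ω, a x ω ∂P = 0) (u v : Fin s ⊕ Fin t) :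
    ∫ ω, blockEntry a u v ω ∂P = 0 := by
  rcases u with u | u <;> rcases v with v | v
  · simp [blockEntry]
  · exact hcentered _
  · have := integral_conj (μ := P) (f := a (v, u))
    simp only [blockEntry]
    rw [hcentered, map_zero] at this
    exact this
  · simp [blockEntry]

lemma integral_blockEntry_mul_swap (hvar : ∀ x, ∫ ω, a x ω * star (a x ω) ∂P = 1)
    {u v : Fin s ⊕ Fin t} (h : edgeLabel r u v ≠ none) :
    ∫ ω, blockEntry a u v ω * blockEntry a v u ω ∂P = 1 := by
  rcases u with u | u <;> rcases v with v | v <;> simp only [edgeLabel, ne_eq, not_true] at h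
  · exact hvar _
  · simp only [blockEntry]
    simp_rw [mul_comm (star _)]
    exact hvar _

lemma lintegral_blockEntry_pow_le {k : ℕ} (hk : k ≠ 0) {C : ℝ≥0∞}
    (hC : ∀ x, ∫⁻ ω, ‖a x ω‖ₑ ^ k ∂P ≤ C) (u v : Fin s ⊕ Fin t) :
    ∫⁻ ω, ‖blockEntry a u v ω‖ₑ ^ k ∂P ≤ C := by
  rcases u with u | u <;> rcases v with v | v
  · simp [blockEntry, hk]
  · exact hC _
  · convert hC (v, u) using 4
    simp [blockEntry, enorm_eq_nnnorm]
  · simp [blockEntry, hk]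

lemma measurable_listWeight (hmeas : ∀ x, Measurable (a x))
    (l : List ((Fin s ⊕ Fin t) × (Fin s ⊕ Fin t))) : Measurable (listWeight a l) := by
  induction l with
  | nil => exact measurable_const
  | cons e l ih =>
    have : listWeight a (e :: l) = fun ω => blockEntry a e.1 e.2 ω * listWeight a l ω := by
      funext ω; simp [listWeight]
    rw [this]
    exact (measurable_blockEntry hmeas _ _).mul ih

open Classical in
lemma integral_listWeight [Fintype (Quotient r)] (hmeas : ∀ x, Measurable (a x))
    (hindep : IndepClasses P r a)
    (l : List ((Fin s ⊕ Fin t) × (Fin s ⊕ Fin t)))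
    (hl : ∀ e ∈ l, edgeLabel r e.1 e.2 ≠ none) :
    ∫ ω, listWeight a l ω ∂P = ∏ c : Quotient r,
      ∫ ω, listWeight a (l.filter fun e => edgeLabel r e.1 e.2 = some c) ω ∂P := by
  choose φ hφ h using fun c : Quotient r => exists_listWeight_filter_eq (r := r) a c l
  simp_rw [listWeight_eq_prod a l hl, h]
  exact iIndepFun.integral_fun_prod_comp hindep
    (fun c => (measurable_pi_lambda _ fun x : {x // Quotient.mk r x = c} => hmeas (x : Fin s × Fin t)).aemeasurable)
    fun c => (hφ c).aestronglyMeasurable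

open Classical in
-- Independence splits off the factor of the label used once, which is the mean of a single entry.
lemma integral_listWeight_eq_zero (hmeas : ∀ x, Measurable (a x))
    (hindep : IndepClasses P r a) (hcentered : ∀ x, ∫ ω, a x ω ∂P = 0)
    {w : List (Fin s ⊕ Fin t)} (hw : Valid (edgeLabel r) w)
    (hc : HasSingleLabel (edgeLabel r) w) :
    ∫ ω, listWeight a (edges w) ω ∂P = 0 := by
  have : Fintype (Quotient r) := Fintype.ofFinite _
  obtain ⟨c, hmem, hc⟩ := hc.exists_filter_eq
  obtain ⟨d, rfl⟩ : ∃ d, c = some d :=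
    Option.ne_none_iff_exists'.1 fun h => hw (h ▸ hmem)
  rw [integral_listWeight hmeas hindep _ (edgeLabel_ne_none_of_valid hw)]
  refine Finset.prod_eq_zero (Finset.mem_univ d) ?_
  obtain ⟨e, he⟩ := hc (fun e => edgeLabel r e.1 e.2 = some d) (by simp)
  rw [he]
  simpa [listWeight] using integral_blockEntry hcentered e.1 e.2

open Classical in
-- Maximality of the number of labels says that the tree edges lie in distinct classes. A class then
-- contributes nothing, or one edge and its reversal; as reversal conjugates the entry, the factor
-- is the given second moment.
lemma integral_listWeight_eq_one [IsProbabilityMeasure P] (hmeas : ∀ x, Measurable (a x))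
    (hindep : IndepClasses P r a) (hvar : ∀ x, ∫ ω, a x ω * star (a x ω) ∂P = 1)
    {T : BinaryTree Unit} {v : Fin s ⊕ Fin t} {w : List (Fin s ⊕ Fin t)}
    (hw : w ∈ treeWalks (edgeLabel r) T v) (hnum : numLabels (edgeLabel r) w = T.numNodes) :
    ∫ ω, listWeight a (edges w) ω ∂P = 1 := by
  have : Fintype (Quotient r) := Fintype.ofFinite _
  have hval := valid_of_mem_treeWalks edgeLabel_symm hw
  rw [integral_listWeight hmeas hindep _ (edgeLabel_ne_none_of_valid hval)]
  obtain ⟨L, hL, hperm⟩ := exists_perm_of_mem_treeWalks hw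
  refine Finset.prod_eq_one fun c _ => ?_
  set f : (Fin s ⊕ Fin t) × (Fin s ⊕ Fin t) → Bool := fun e => edgeLabel r e.1 e.2 = some c with hf
  have hperm' : ((edges w).filter f).Perm (L.filter f ++ (L.filter f).map Prod.swap) := by
    refine (hperm.filter f).trans ?_
    rw [List.filter_append, List.filter_map]
    have : f ∘ Prod.swap = f := by
      funext e
      simp [hf, edgeLabel_symm e.2 e.1]
    rw [this]
  have hnodup : (L.map fun e => edgeLabel r e.1 e.2).Nodup := by
    have h1 : (labels (edgeLabel r) w).toFinset =
        (L.map fun e => edgeLabel r e.1 e.2).toFinset := by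
      ext c
      rw [labels, List.mem_toFinset, (hperm.map _).mem_iff]
      simp [edgeLabel_symm]
    rw [numLabels_eq, h1, List.card_toFinset, ← hL] at hnum
    have h2 := (List.dedup_sublist (L.map fun e => edgeLabel r e.1 e.2)).eq_of_length
      (by simpa using hnum)
    exact List.dedup_eq_self.1 h2
  have heq : ∀ ω, listWeight a ((edges w).filter f) ω =
      listWeight a (L.filter f ++ (L.filter f).map Prod.swap) ω := fun ω =>
    (hperm'.map _).prod_eq
  simp_rw [heq]
  have hall : ∀ e ∈ L.filter f, edgeLabel r e.1 e.2 = some c := fun e he => by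
    simpa [hf] using (List.mem_filter.1 he).2
  have hnodup' := hnodup.sublist ((List.filter_sublist (p := f) (l := L)).map _)
  rcases h : L.filter f with _ | ⟨e, _ | ⟨e', l⟩⟩
  · simp [listWeight]
  · have he : edgeLabel r e.1 e.2 ≠ none := by
      rw [hall e (by simp [h])]; simp
    simpa [listWeight] using integral_blockEntry_mul_swap hvar he
  · rw [h] at hnodup'
    simp [hall e (by simp [h]), hall e' (by simp [h])] at hnodup'

lemma lintegral_enorm_listWeight_le (hmeas : ∀ x, Measurable (a x)) {k : ℕ} (hk : k ≠ 0)
    {C : ℝ≥0∞} (hC : ∀ x, ∫⁻ ω, ‖a x ω‖ₑ ^ k ∂P ≤ C)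
    (l : List ((Fin s ⊕ Fin t) × (Fin s ⊕ Fin t))) (hl : l.length = k) :
    ∫⁻ ω, ‖listWeight a l ω‖ₑ ∂P ≤ k * C := by
  have hne : l ≠ [] := by rintro rfl; exact hk hl.symm
  refine (lintegral_mono fun ω => enorm_listWeight_le l hne ω).trans ?_
  have key : ∀ l' : List ((Fin s ⊕ Fin t) × (Fin s ⊕ Fin t)),
      ∫⁻ ω, (l'.map fun e => ‖blockEntry a e.1 e.2 ω‖ₑ ^ l.length).sum ∂P ≤ l'.length * C := by
    intro l'
    induction l' with
    | nil => simp
    | cons e l' ih =>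
      simp only [List.map_cons, List.sum_cons, List.length_cons]
      rw [lintegral_add_left ((measurable_blockEntry hmeas _ _).enorm.pow_const _), hl]
      rw [hl] at ih
      push_cast
      rw [add_mul, one_mul, add_comm]
      exact add_le_add ih (lintegral_blockEntry_pow_le hk hC _ _)
  have := key l
  rwa [hl] at this ⊢

end Entries
end SampleCov

namespace SampleCov

/-! ### Measurability of the empirical eigenvalue measure -/

section Eigenvalues

lemma sum_eigenvalues_pow {m : ℕ} {M : Matrix (Fin m) (Fin m) ℂ} (hM : M.IsHermitian) (k : ℕ) :
    ((∑ j, hM.eigenvalues j ^ k : ℝ) : ℂ) = (M ^ k).trace := by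
  conv_rhs => rw [hM.spectral_theorem]
  rw [← map_pow, Unitary.conjStarAlgAut_apply, Matrix.trace_mul_cycle, Unitary.coe_star_mul_self,
    one_mul, Matrix.diagonal_pow, Matrix.trace_diagonal]
  push_cast
  rfl

variable {Ω : Type*} [MeasurableSpace Ω] {m : ℕ} {M : Ω → Matrix (Fin m) (Fin m) ℂ}

lemma measurable_matrix_pow (hM : ∀ i j, Measurable fun ω => M ω i j) (k : ℕ) (i j : Fin m) :
    Measurable fun ω => (M ω ^ k) i j := by
  induction k generalizing j with
  | zero => simp
  | succ k ih =>
    simp only [pow_succ, Matrix.mul_apply]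
    exact Finset.measurable_sum _ fun l _ => (ih l).mul (hM l j)

/-- No measurable choice of single eigenvalues is needed: power sums are traces of powers, and a
continuous function is a pointwise limit of polynomials. -/
lemma measurable_sum_eigenvalues (hM : ∀ i j, Measurable fun ω => M ω i j)
    (hH : ∀ ω, (M ω).IsHermitian) {f : ℝ → ℝ} (hf : Continuous f) :
    Measurable fun ω => ∑ j, f ((hH ω).eigenvalues j) := by
  have hpow : ∀ k : ℕ, Measurable fun ω => ∑ j, (hH ω).eigenvalues j ^ k := by
    intro k
    have h : Measurable fun ω => ((M ω ^ k).trace).re :=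
      Complex.measurable_re.comp
        (Finset.measurable_sum _ fun i _ => measurable_matrix_pow hM k i i)
    convert! h using 2 with ω
    rw [← sum_eigenvalues_pow (hH ω), Complex.ofReal_re]
  have hpoly : ∀ p : Polynomial ℝ, Measurable fun ω => ∑ j, p.eval ((hH ω).eigenvalues j) := by
    intro p
    simp_rw [Polynomial.eval_eq_sum_range]
    have : (fun ω => ∑ j, ∑ i ∈ Finset.range (p.natDegree + 1),
        p.coeff i * (hH ω).eigenvalues j ^ i) = fun ω => ∑ i ∈ Finset.range (p.natDegree + 1),
        p.coeff i * ∑ j, (hH ω).eigenvalues j ^ i := by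
      funext ω
      rw [Finset.sum_comm]
      simp_rw [Finset.mul_sum]
    rw [this]
    exact Finset.measurable_sum _ fun i _ => (hpow i).const_mul _
  -- The interval grows while the error shrinks, so the approximations converge at every real point.
  have happrox : ∀ N : ℕ, ∃ p : Polynomial ℝ, ∀ x ∈ Set.Icc (-(N : ℝ)) N,
      |p.eval x - f x| < 1 / ((N : ℝ) + 1) := fun N =>
    exists_polynomial_near_of_continuousOn _ _ f hf.continuousOn _ (by positivity)
  choose p hp using happrox
  have hlim : ∀ x, Tendsto (fun N => (p N).eval x) atTop (𝓝 (f x)) := by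
    intro x
    rw [tendsto_iff_norm_sub_tendsto_zero]
    refine squeeze_zero' (Eventually.of_forall fun _ => norm_nonneg _) ?_
      tendsto_one_div_add_atTop_nhds_zero_nat
    filter_upwards [eventually_ge_atTop ⌈|x|⌉₊] with N hN
    have hx : |x| ≤ N := (Nat.le_ceil _).trans (by exact_mod_cast hN)
    exact (hp N x (Set.mem_Icc.2 (abs_le.1 hx))).le
  refine measurable_of_tendsto_metrizable (fun N => hpoly (p N)) ?_
  rw [tendsto_pi_nhds]
  exact fun ω => tendsto_finsetSum _ fun j _ => hlim _

lemma empiricalMeasure_apply (n : ℕ) {M : Matrix (Fin m) (Fin m) ℂ} (hM : M.IsHermitian)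
    {F : Set ℝ} (hF : MeasurableSet F) : empiricalMeasure n M hM F =
      ENNReal.ofReal ((n : ℝ)⁻¹ * ∑ j, F.indicator (fun _ => (1 : ℝ)) (hM.eigenvalues j)) := by
  rw [empiricalMeasure, Measure.smul_apply, Measure.finsetSum_apply,
    ENNReal.ofReal_mul (by positivity), ENNReal.ofReal_sum_of_nonneg]
  · rw [ENNReal.smul_def, smul_eq_mul]
    congr 1
    · rw [← ENNReal.ofReal_coe_nnreal]
      simp
    · refine Finset.sum_congr rfl fun j _ => ?_
      rw [Measure.dirac_apply' _ hF]
      by_cases h : hM.eigenvalues j ∈ F <;> simp [h]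
  · intro j _
    exact Set.indicator_nonneg (fun _ _ => zero_le_one) _

instance (n : ℕ) (M : Matrix (Fin m) (Fin m) ℂ) (hM : M.IsHermitian) :
    IsFiniteMeasure (empiricalMeasure n M hM) := by
  refine ⟨?_⟩
  rw [empiricalMeasure_apply n hM MeasurableSet.univ]
  exact ENNReal.ofReal_lt_top

/-- The closed sets form a generating π-system, and their indicators are pointwise limits of
continuous functions. -/
lemma measurable_empiricalMeasure (n : ℕ) (hM : ∀ i j, Measurable fun ω => M ω i j)
    (hH : ∀ ω, (M ω).IsHermitian) : Measurable fun ω => empiricalMeasure n (M ω) (hH ω) := by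
  have hclosed : ∀ F : Set ℝ, IsClosed F →
      Measurable fun ω => empiricalMeasure n (M ω) (hH ω) F := by
    intro F hF
    simp_rw [empiricalMeasure_apply n _ hF.measurableSet]
    refine ENNReal.measurable_ofReal.comp (Measurable.const_mul ?_ _)
    refine measurable_of_tendsto_metrizable (f := fun N ω => ∑ j,
      ((hF.apprSeq N ((hH ω).eigenvalues j) : ℝ≥0) : ℝ)) (fun N =>
      measurable_sum_eigenvalues hM hH (NNReal.continuous_coe.comp (hF.apprSeq N).continuous)) ?_
    rw [tendsto_pi_nhds]
    intro ω
    refine tendsto_finsetSum _ fun j _ => ?_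
    have h := (NNReal.continuous_coe.tendsto _).comp
      ((tendsto_pi_nhds.1 (HasOuterApproxClosed.tendsto_apprSeq hF)) ((hH ω).eigenvalues j))
    convert! h using 2
    by_cases hx : (hH ω).eigenvalues j ∈ F <;> simp [hx]
  refine Measurable.measure_of_isPiSystem (S := {F | IsClosed F}) ?_ isPiSystem_isClosed
    (fun F hF => hclosed F hF) (hclosed _ isClosed_univ)
  rw [BorelSpace.measurable_eq (α := ℝ), borel_eq_generateFrom_isClosed]

lemma integral_empiricalMeasure (n : ℕ) {M : Matrix (Fin m) (Fin m) ℂ} (hM : M.IsHermitian)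
    {f : ℝ → ℝ} : ∫ x, f x ∂empiricalMeasure n M hM = (n : ℝ)⁻¹ * ∑ j, f (hM.eigenvalues j) := by
  rw [empiricalMeasure, integral_smul_nnreal_measure, integral_finsetSum_measure]
  · simp [NNReal.smul_def]
  · exact fun j _ => integrable_dirac (by simp)

lemma integrable_empiricalMeasure (n : ℕ) {M : Matrix (Fin m) (Fin m) ℂ} (hM : M.IsHermitian)
    {f : ℝ → ℝ} : Integrable f (empiricalMeasure n M hM) := by
  rw [empiricalMeasure]
  refine Integrable.smul_measure_nnreal ?_
  exact integrable_finsetSum_measure.2 fun j _ => integrable_dirac (by simp)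

end Eigenvalues

/-! ### Moments of the mean measure as expected traces -/

section MeanMeasure

/-- The unscaled random matrix. -/
def entryMatrix {s t : ℕ} {Ω : Type*} (a : Fin s × Fin t → Ω → ℂ) (ω : Ω) :
    Matrix (Fin s) (Fin t) ℂ :=
  Matrix.of fun p q => a (p, q) ω

variable {s t : ℕ} {Ω : Type*} {a : Fin s × Fin t → Ω → ℂ}

/-- This includes `n = 0`, where `1 / √0` and `0⁻¹` are both zero. -/
lemma trace_scaledMatrix_pow (n : ℕ) (a : Fin s × Fin t → Ω → ℂ) (ω : Ω) (k : ℕ) :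
    (((scaledMatrix n a ω)ᴴ * scaledMatrix n a ω) ^ k).trace =
      ((n : ℂ)⁻¹) ^ k * (((entryMatrix a ω)ᴴ * entryMatrix a ω) ^ k).trace := by
  have h1 : scaledMatrix n a ω = ((1 / Real.sqrt n : ℝ) : ℂ) • entryMatrix a ω := by
    ext p q
    simp [scaledMatrix, entryMatrix]
  have h2 : (scaledMatrix n a ω)ᴴ * scaledMatrix n a ω =
      (n : ℂ)⁻¹ • ((entryMatrix a ω)ᴴ * entryMatrix a ω) := by
    rw [h1, Matrix.conjTranspose_smul, Matrix.smul_mul, Matrix.mul_smul, smul_smul]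
    congr 1
    rw [Complex.star_def, Complex.conj_ofReal, ← Complex.ofReal_mul, div_mul_div_comm, one_mul,
      Real.mul_self_sqrt (by positivity)]
    simp
  rw [h2, smul_pow, Matrix.trace_smul, smul_eq_mul]

lemma integral_pow_sampleCovMeasure (n k : ℕ) (ω : Ω) :
    ((∫ x, x ^ k ∂sampleCovMeasure n a ω : ℝ) : ℂ) = (n : ℂ)⁻¹ ^ (k + 1) *
      (((entryMatrix a ω)ᴴ * entryMatrix a ω) ^ k).trace := by
  rw [sampleCovMeasure, integral_empiricalMeasure, Complex.ofReal_mul, sum_eigenvalues_pow,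
    trace_scaledMatrix_pow]
  push_cast
  ring

open ComplexOrder in
-- Positive semidefiniteness makes the absolute value redundant, so integrability of odd powers also
-- reduces to that of traces.
lemma integral_norm_pow_sampleCovMeasure (n k : ℕ) (ω : Ω) :
    ∫ x, ‖x ^ k‖ ∂sampleCovMeasure n a ω = ∫ x, x ^ k ∂sampleCovMeasure n a ω := by
  rw [sampleCovMeasure, integral_empiricalMeasure, integral_empiricalMeasure]
  congr 1
  refine Finset.sum_congr rfl fun j _ => ?_
  rw [Real.norm_of_nonneg (pow_nonneg ?_ _)]
  exact (Matrix.posSemidef_conjTranspose_mul_self _).eigenvalues_nonneg j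

variable [MeasurableSpace Ω] {P : Measure Ω}

lemma measurable_sampleCovMeasure (n : ℕ) (hmeas : ∀ x, Measurable (a x)) :
    Measurable (sampleCovMeasure n a) := by
  refine measurable_empiricalMeasure n (fun i j => ?_) _
  simp only [Matrix.mul_apply, Matrix.conjTranspose_apply, scaledMatrix, Matrix.of_apply]
  refine Finset.measurable_sum _ fun l _ => ?_
  exact (continuous_star.measurable.comp ((hmeas _).const_mul _)).mul ((hmeas _).const_mul _)

lemma integrable_pow_meanMeasure [IsProbabilityMeasure P] (n k : ℕ)
    (hmeas : ∀ x, Measurable (a x))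
    (hint : Integrable (fun ω => (((entryMatrix a ω)ᴴ * entryMatrix a ω) ^ k).trace) P) :
    Integrable (fun x : ℝ => x ^ k) (meanMeasure n P a) ∧
      ((∫ x, x ^ k ∂meanMeasure n P a : ℝ) : ℂ) =
        (∫ ω, (((entryMatrix a ω)ᴴ * entryMatrix a ω) ^ k).trace ∂P) / (n : ℂ) ^ (k + 1) := by
  set K : Kernel Ω ℝ := ⟨sampleCovMeasure n a, measurable_sampleCovMeasure n hmeas⟩ with hK
  have hmean : meanMeasure n P a = K ∘ₘ P := rfl
  have hsmeas : ∀ ν : Measure ℝ, AEStronglyMeasurable (fun x : ℝ => x ^ k) ν := fun ν =>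
    (continuous_pow k).aestronglyMeasurable
  have hintL : Integrable (fun ω => ∫ x, x ^ k ∂sampleCovMeasure n a ω) P := by
    have h := (hint.const_mul ((n : ℂ)⁻¹ ^ (k + 1))).re
    refine h.congr (ae_of_all _ fun ω => ?_)
    simp only
    rw [← integral_pow_sampleCovMeasure n k ω]
    exact Complex.ofReal_re _
  have h1 : Integrable (fun x : ℝ => x ^ k) (K ∘ₘ P) := by
    rw [Measure.integrable_comp_iff (hsmeas _)]
    refine ⟨ae_of_all _ fun ω => integrable_empiricalMeasure _ _, ?_⟩
    refine hintL.congr (ae_of_all _ fun ω => ?_)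
    exact (integral_norm_pow_sampleCovMeasure n k ω).symm
  refine ⟨hmean ▸ h1, ?_⟩
  have h2 : ∫ x, x ^ k ∂meanMeasure n P a = ∫ ω, ∫ x, x ^ k ∂sampleCovMeasure n a ω ∂P := by
    rw [Measure.comp_eq_comp_const_apply] at hmean h1
    rw [hmean, Kernel.integral_comp h1]
    simp [hK]
  rw [h2, ← integral_complex_ofReal]
  simp_rw [integral_pow_sampleCovMeasure]
  rw [integral_const_mul, inv_pow, ← div_eq_inv_mul]

end MeanMeasure
end SampleCov

namespace SampleCov

/-! ### Matrix powers as sums over walks -/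

section Walks

variable {V : Type*} [Fintype V]

open Classical in
/-- The walks with `m` edges from `u` to `v`. -/
noncomputable def walks : ℕ → V → V → Finset (List V)
  | 0, u, v => if u = v then {[u]} else ∅
  | m + 1, u, v => Finset.univ.biUnion fun x => (walks m x v).image (List.cons u)

lemma exists_cons_of_mem_walks {m : ℕ} {u v : V} {w : List V} (h : w ∈ walks m u v) :
    ∃ y, w = u :: y := by
  cases m with
  | zero =>
    rw [walks] at h
    split_ifs at h with huv
    · exact ⟨[], by simpa using h⟩
    · simp at h
  | succ m =>
    simp only [walks, Finset.mem_biUnion, Finset.mem_image] at h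
    obtain ⟨x, -, y, -, rfl⟩ := h
    exact ⟨y, rfl⟩

lemma mem_walks {m : ℕ} {u v : V} {w : List V} :
    w ∈ walks m u v ↔ w.length = m + 1 ∧ w.head? = some u ∧ w.getLast? = some v := by
  induction m generalizing u w with
  | zero =>
    rw [walks]
    split_ifs with huv
    · subst huv
      rw [Finset.mem_singleton]
      constructor
      · rintro rfl; simp
      · rintro ⟨h1, h2, -⟩
        obtain ⟨x, rfl⟩ := List.length_eq_one_iff.1 h1
        simpa using h2
    · simp only [Finset.notMem_empty, false_iff, not_and]
      intro h1 h2 h3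
      obtain ⟨x, rfl⟩ := List.length_eq_one_iff.1 h1
      simp only [List.head?_cons, Option.some.injEq, List.getLast?_singleton] at h2 h3
      exact huv (h2.symm.trans h3)
  | succ m ih =>
    simp only [walks, Finset.mem_biUnion, Finset.mem_image, Finset.mem_univ, true_and]
    constructor
    · rintro ⟨x, y, hy, rfl⟩
      obtain ⟨h1, h2, h3⟩ := ih.1 hy
      obtain ⟨z, rfl⟩ := exists_cons_of_mem_walks hy
      exact ⟨by simp [h1], rfl, by rwa [List.getLast?_cons_cons]⟩
    · rintro ⟨h1, h2, h3⟩
      rcases w with _ | ⟨a, _ | ⟨x, y⟩⟩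
      · simp at h1
      · simp at h1
      · rw [List.getLast?_cons_cons] at h3
        obtain rfl : a = u := by simpa using h2
        exact ⟨x, x :: y, ih.2 ⟨by simpa using h1, rfl, h3⟩, rfl⟩

open Classical in
lemma pow_apply_eq_sum_walks {R : Type*} [CommSemiring R] (H : Matrix V V R)
    (m : ℕ) (u v : V) :
    (H ^ m) u v = ∑ w ∈ walks m u v, ((edges w).map fun e => H e.1 e.2).prod := by
  induction m generalizing u with
  | zero =>
    rw [walks, pow_zero, Matrix.one_apply]
    split_ifs <;> simp
  | succ m ih =>
    rw [pow_succ', Matrix.mul_apply, walks, Finset.sum_biUnion]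
    · refine Finset.sum_congr rfl fun x _ => ?_
      rw [Finset.sum_image (List.cons_injective.injOn), ih, Finset.mul_sum]
      refine Finset.sum_congr rfl fun w hw => ?_
      obtain ⟨y, rfl⟩ := exists_cons_of_mem_walks hw
      simp
    · intro x _ x' _ hxx'
      rw [Function.onFun, Finset.disjoint_left]
      intro w hw hw'
      simp only [Finset.mem_image] at hw hw'
      obtain ⟨y, hy, rfl⟩ := hw
      obtain ⟨y', hy', h⟩ := hw'
      obtain ⟨z, rfl⟩ := exists_cons_of_mem_walks hy
      obtain ⟨z', rfl⟩ := exists_cons_of_mem_walks hy'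
      simp only [List.cons.injEq, true_and] at h
      exact hxx' h.1.symm

end Walks

/-! ### Comparison of the expected trace with the number of tree tours -/

section Trace

variable {s t : ℕ} {Ω : Type*} {r : Setoid (Fin s × Fin t)} {a : Fin s × Fin t → Ω → ℂ}

/-- Even powers of the off-diagonal block matrix hold `(B * A) ^ k` in a corner, which turns the
trace into a sum over walks in a bipartite graph. -/
lemma fromBlocks_pow_two_mul {m n R : Type*} [Fintype m] [Fintype n] [DecidableEq m]
    [DecidableEq n] [Semiring R] (A : Matrix m n R) (B : Matrix n m R) (k : ℕ) :
    Matrix.fromBlocks 0 A B 0 ^ (2 * k) = Matrix.fromBlocks ((A * B) ^ k) 0 0 ((B * A) ^ k) := by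
  have h2 : Matrix.fromBlocks 0 A B 0 ^ 2 = Matrix.fromBlocks (A * B) 0 0 (B * A) := by
    rw [pow_two, Matrix.fromBlocks_multiply]
    simp
  rw [pow_mul, h2]
  induction k with
  | zero => simp
  | succ k ih =>
    rw [pow_succ, ih, Matrix.fromBlocks_multiply]
    simp [pow_succ]

lemma trace_pow_eq_sum_walks (a : Fin s × Fin t → Ω → ℂ) (k : ℕ) (ω : Ω) :
    (((entryMatrix a ω)ᴴ * entryMatrix a ω) ^ k).trace =
      ∑ q : Fin t, ∑ w ∈ walks (2 * k) (Sum.inr q : Fin s ⊕ Fin t) (Sum.inr q),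
        listWeight a (edges w) ω := by
  have hblock : (Matrix.of fun u v => blockEntry a u v ω) =
      Matrix.fromBlocks 0 (entryMatrix a ω) (entryMatrix a ω)ᴴ 0 := by
    ext u v
    rcases u with u | u <;> rcases v with v | v <;> simp [blockEntry, entryMatrix]
  rw [Matrix.trace]
  refine Finset.sum_congr rfl fun q _ => ?_
  have := pow_apply_eq_sum_walks (Matrix.of fun u v => blockEntry a u v ω) (2 * k)
    (Sum.inr q : Fin s ⊕ Fin t) (Sum.inr q)
  have h2 : (((entryMatrix a ω)ᴴ * entryMatrix a ω) ^ k) q q =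
      (Matrix.fromBlocks 0 (entryMatrix a ω) (entryMatrix a ω)ᴴ 0 ^ (2 * k)) (Sum.inr q)
        (Sum.inr q) := by
    rw [fromBlocks_pow_two_mul, Matrix.fromBlocks_apply₂₂]
  rw [Matrix.diag_apply, h2, ← hblock]
  convert! this

/-- The number of tree walks with `k` edges traversed from the second vertex class. -/
noncomputable def numTreeWalks (r : Setoid (Fin s × Fin t)) (k : ℕ) : ℕ :=
  ∑ q : Fin t, ∑ T ∈ BinaryTree.treesOfNumNodesEq k,
    (treeWalks (edgeLabel r) T (Sum.inr q)).card

/-- The valid walks with `2k` edges and fewer than `k` labels. -/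
def fewLabels (r : Setoid (Fin s × Fin t)) (k : ℕ) : Set (List (Fin s ⊕ Fin t)) :=
  {w | w.length = 2 * k + 1 ∧ Valid (edgeLabel r) w ∧ numLabels (edgeLabel r) w ≤ k - 1}

lemma finite_fewLabels (k : ℕ) : (fewLabels r k).Finite :=
  (finite_length (2 * k + 1)).subset fun _ hw => hw.1

/-- Tree walks from the second vertex class with the maximal number `k` of labels. -/
def exactTreeWalks (r : Setoid (Fin s × Fin t)) (k : ℕ) : Set (List (Fin s ⊕ Fin t)) :=
  {w | ∃ q : Fin t, ∃ T, T.numNodes = k ∧ w ∈ treeWalks (edgeLabel r) T (Sum.inr q) ∧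
    numLabels (edgeLabel r) w = k}

open Classical in
-- A tour with `k` labels determines its tree and is counted once. Any other tour has fewer labels
-- and is counted for at most `catalan k` trees.
lemma numTreeWalks_eq (k : ℕ) : ∃ d : ℕ, d ≤ catalan k * (fewLabels r k).ncard ∧
    numTreeWalks r k = (exactTreeWalks r k).ncard + d := by
  refine ⟨∑ q : Fin t, ∑ T ∈ BinaryTree.treesOfNumNodesEq k,
    ((treeWalks (edgeLabel r) T (Sum.inr q)).filter
      fun w => ¬ numLabels (edgeLabel r) w = k).card, ?_, ?_⟩
  · rw [Finset.sum_comm, ← BinaryTree.treesOfNumNodesEq_card_eq_catalan, ← smul_eq_mul]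
    refine Finset.sum_le_card_nsmul _ _ _ fun T hT => ?_
    rw [BinaryTree.mem_treesOfNumNodesEq] at hT
    rw [← Finset.card_biUnion, ← Set.ncard_coe_finset]
    · refine Set.ncard_le_ncard ?_ (finite_fewLabels k)
      intro w hw
      simp only [Finset.coe_biUnion, Finset.mem_coe, Finset.mem_univ, Set.iUnion_true,
        Set.mem_iUnion, Finset.mem_filter] at hw
      obtain ⟨q, hw, hnum⟩ := hw
      have h1 := numLabels_le_of_mem_treeWalks edgeLabel_symm hw
      refine ⟨by rw [length_of_mem_treeWalks hw, hT], valid_of_mem_treeWalks edgeLabel_symm hw, ?_⟩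
      omega
    · intro q _ q' _ hqq'
      rw [Function.onFun, Finset.disjoint_left]
      intro w hw hw'
      obtain ⟨y, rfl⟩ := exists_cons_of_mem_treeWalks (Finset.mem_filter.1 hw).1
      obtain ⟨y', h⟩ := exists_cons_of_mem_treeWalks (Finset.mem_filter.1 hw').1
      exact hqq' (Sum.inr.inj (List.cons.inj h).1)
  · have h1 : exactTreeWalks r k = ↑((Finset.univ ×ˢ BinaryTree.treesOfNumNodesEq k).biUnion
        fun p : Fin t × BinaryTree Unit => (treeWalks (edgeLabel r) p.2 (Sum.inr p.1)).filter
          fun w => numLabels (edgeLabel r) w = k) := by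
      ext w
      simp only [exactTreeWalks, Set.mem_ofPred_eq, Finset.coe_biUnion, Finset.mem_coe,
        Finset.mem_product, Finset.mem_univ, true_and, BinaryTree.mem_treesOfNumNodesEq,
        Set.mem_iUnion, Finset.mem_filter, Prod.exists, exists_prop]
    rw [h1, Set.ncard_coe_finset, Finset.card_biUnion, Finset.sum_product, numTreeWalks,
      ← Finset.sum_add_distrib]
    · refine Finset.sum_congr rfl fun q _ => ?_
      rw [← Finset.sum_add_distrib]
      exact Finset.sum_congr rfl fun T _ => (Finset.card_filter_add_card_filter_not _).symm
    · rintro ⟨q, T⟩ hp ⟨q', T'⟩ hp' hne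
      rw [Function.onFun, Finset.disjoint_left]
      intro w hw hw'
      simp only [Finset.coe_product, Set.mem_prod, Finset.mem_coe,
        BinaryTree.mem_treesOfNumNodesEq] at hp hp'
      obtain ⟨hw, hk⟩ := Finset.mem_filter.1 hw
      obtain ⟨hw', -⟩ := Finset.mem_filter.1 hw'
      obtain ⟨y, hy⟩ := exists_cons_of_mem_treeWalks hw
      obtain ⟨y', hy'⟩ := exists_cons_of_mem_treeWalks hw'
      obtain rfl : q = q' := Sum.inr.inj (List.cons.inj (hy.symm.trans hy')).1
      exact hne (Prod.ext rfl (tree_eq_of_mem_treeWalks edgeLabel_symm hw hw' (by rw [hk, hp.2])))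

variable [MeasurableSpace Ω] {P : Measure Ω}

open Classical in
-- A walk that is invalid or has a label used once has mean zero. Any other has at most `k` labels,
-- hence exactly `k` by `hA`, hence each twice; by `hB` it is then a tree tour.
lemma integral_listWeight_cases [IsProbabilityMeasure P] (hmeas : ∀ x, Measurable (a x))
    (hindep : IndepClasses P r a) (hcentered : ∀ x, ∫ ω, a x ω ∂P = 0)
    (hvar : ∀ x, ∫ ω, a x ω * star (a x ω) ∂P = 1) {k : ℕ} {q : Fin t}
    {w : List (Fin s ⊕ Fin t)} (hw : w ∈ walks (2 * k) (Sum.inr q) (Sum.inr q))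
    (hA : w ∉ fewLabels r k) (hB : w ∉ badWalks (edgeLabel r) k) :
    ∫ ω, listWeight a (edges w) ω ∂P = if w ∈ exactTreeWalks r k then 1 else 0 := by
  obtain ⟨hlen, hhead, -⟩ := mem_walks.1 hw
  split_ifs with hC
  · obtain ⟨q', T, hT, hwT, hnum⟩ := hC
    exact integral_listWeight_eq_one hmeas hindep hvar hwT (hnum.trans hT.symm)
  by_cases hval : Valid (edgeLabel r) w
  swap
  · rw [listWeight_eq_zero_of_not_valid hval]
    simp
  by_cases hone : HasSingleLabel (edgeLabel r) w
  · exact integral_listWeight_eq_zero hmeas hindep hcentered hval hone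
  exfalso
  obtain ⟨hle, htwice⟩ := two_mul_numLabels_le hone
  have hk : numLabels (edgeLabel r) w = k := by
    by_contra hne
    exact hA ⟨hlen, hval, by omega⟩
  have htwice := htwice (by omega)
  have htree : TreeLike (edgeLabel r) w := by
    by_contra h
    exact hB ⟨hlen, hval, htwice, h⟩
  obtain ⟨T, v, hT⟩ := htree
  obtain ⟨y, rfl⟩ := exists_cons_of_mem_treeWalks hT
  obtain rfl : v = Sum.inr q := by simpa using hhead
  refine hC ⟨q, T, ?_, hT, hk⟩
  have := length_of_mem_treeWalks hT
  omega

lemma integrable_listWeight (hmeas : ∀ x, Measurable (a x)) {k : ℕ} (hk : k ≠ 0)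
    {C : ℝ≥0} (hC : ∀ x, ∫⁻ ω, ‖a x ω‖ₑ ^ k ∂P ≤ C)
    (l : List ((Fin s ⊕ Fin t) × (Fin s ⊕ Fin t))) (hl : l.length = k) :
    Integrable (listWeight a l) P := by
  refine ⟨(measurable_listWeight hmeas l).aestronglyMeasurable, ?_⟩
  refine (lintegral_enorm_listWeight_le hmeas hk hC l hl).trans_lt ?_
  exact ENNReal.mul_lt_top (by simp) (by simp)

lemma norm_integral_listWeight_le (hmeas : ∀ x, Measurable (a x)) {k : ℕ} (hk : k ≠ 0)
    {C : ℝ≥0} (hC : ∀ x, ∫⁻ ω, ‖a x ω‖ₑ ^ k ∂P ≤ C)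
    (l : List ((Fin s ⊕ Fin t) × (Fin s ⊕ Fin t))) (hl : l.length = k) :
    ‖∫ ω, listWeight a l ω ∂P‖ ≤ k * C := by
  have h := (enorm_integral_le_lintegral_enorm (listWeight a l)).trans
    (lintegral_enorm_listWeight_le hmeas hk hC l hl)
  have h2 : (‖∫ ω, listWeight a l ω ∂P‖₊ : ℝ≥0∞) ≤ ((k * C : ℝ≥0) : ℝ≥0∞) := by
    push_cast
    exact h
  have h3 := ENNReal.coe_le_coe.1 h2
  exact_mod_cast h3

lemma integrable_trace_pow (hmeas : ∀ x, Measurable (a x)) {k : ℕ} (hk : k ≠ 0)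
    {C : ℝ≥0} (hC : ∀ x, ∫⁻ ω, ‖a x ω‖ₑ ^ (2 * k) ∂P ≤ C) :
    Integrable (fun ω => (((entryMatrix a ω)ᴴ * entryMatrix a ω) ^ k).trace) P := by
  simp_rw [trace_pow_eq_sum_walks]
  refine integrable_finsetSum _ fun q _ => integrable_finsetSum _ fun w hw => ?_
  refine integrable_listWeight hmeas (by omega) hC _ ?_
  rw [length_edges, (mem_walks.1 hw).1, Nat.add_sub_cancel]

/-- Only exceptional walks contribute to the difference. In the constant, `2 * k * C` bounds the
expectation along a walk, `1` the indicator of an exact tour, and `catalan k` the multiplicity of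
tours with too few labels. -/
lemma norm_integral_trace_pow_sub_le [IsProbabilityMeasure P] (hmeas : ∀ x, Measurable (a x))
    (hindep : IndepClasses P r a) (hcentered : ∀ x, ∫ ω, a x ω ∂P = 0)
    (hvar : ∀ x, ∫ ω, a x ω * star (a x ω) ∂P = 1) {k : ℕ} (hk : k ≠ 0)
    {C : ℝ≥0} (hC : ∀ x, ∫⁻ ω, ‖a x ω‖ₑ ^ (2 * k) ∂P ≤ C) :
    ‖∫ ω, (((entryMatrix a ω)ᴴ * entryMatrix a ω) ^ k).trace ∂P - numTreeWalks r k‖ ≤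
      (2 * k * C + 1 + catalan k) * ((fewLabels r k).ncard + (badWalks (edgeLabel r) k).ncard) := by
  classical
  have hlen : ∀ (q : Fin t), ∀ w ∈ walks (2 * k) (Sum.inr q : Fin s ⊕ Fin t) (Sum.inr q),
      (edges w).length = 2 * k := fun q w hw => by
    rw [length_edges, (mem_walks.1 hw).1, Nat.add_sub_cancel]
  set W : Finset (List (Fin s ⊕ Fin t)) :=
    Finset.univ.biUnion fun q : Fin t => walks (2 * k) (Sum.inr q) (Sum.inr q) with hW
  have hsum : ∀ F : List (Fin s ⊕ Fin t) → ℂ,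
      ∑ q : Fin t, ∑ w ∈ walks (2 * k) (Sum.inr q : Fin s ⊕ Fin t) (Sum.inr q), F w =
      ∑ w ∈ W, F w := by
    intro F
    rw [hW, Finset.sum_biUnion]
    intro q _ q' _ hqq'
    rw [Function.onFun, Finset.disjoint_left]
    intro w hw hw'
    obtain ⟨y, rfl⟩ := exists_cons_of_mem_walks hw
    obtain ⟨y', h⟩ := exists_cons_of_mem_walks hw'
    exact hqq' (Sum.inr.inj (List.cons.inj h).1)
  have hint : ∫ ω, (((entryMatrix a ω)ᴴ * entryMatrix a ω) ^ k).trace ∂P =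
      ∑ w ∈ W, ∫ ω, listWeight a (edges w) ω ∂P := by
    simp_rw [trace_pow_eq_sum_walks]
    rw [integral_finsetSum, ← hsum]
    · refine Finset.sum_congr rfl fun q _ => ?_
      rw [integral_finsetSum]
      exact fun w hw => integrable_listWeight hmeas (by omega) hC _ (hlen q w hw)
    · exact fun q _ => integrable_finsetSum _ fun w hw =>
        integrable_listWeight hmeas (by omega) hC _ (hlen q w hw)
  have hsub : exactTreeWalks r k ⊆ ↑W := by
    rintro w ⟨q, T, hT, hw, -⟩
    rw [hW]
    simp only [Finset.coe_biUnion, Finset.mem_coe, Finset.mem_univ, Set.iUnion_true,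
      Set.mem_iUnion]
    obtain ⟨x, hx⟩ := exists_concat_of_mem_treeWalks hw
    obtain ⟨y, hy⟩ := exists_cons_of_mem_treeWalks hw
    exact ⟨q, mem_walks.2 ⟨by rw [length_of_mem_treeWalks hw, hT], by simp [hy], by simp [hx]⟩⟩
  have hcardC : ((exactTreeWalks r k).ncard : ℂ) =
      ∑ w ∈ W, if w ∈ exactTreeWalks r k then 1 else 0 := by
    rw [Finset.sum_ite, Finset.sum_const_zero, add_zero, Finset.sum_const, nsmul_eq_mul, mul_one]
    congr 1
    rw [← Set.ncard_coe_finset]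
    congr 1
    ext w
    simp only [Finset.coe_filter, Set.mem_ofPred_eq]
    exact ⟨fun h => ⟨hsub h, h⟩, fun h => h.2⟩
  obtain ⟨d, hd, htot⟩ := numTreeWalks_eq (r := r) k
  set A := fewLabels r k with hA
  set B := badWalks (edgeLabel r) k with hB
  have hAB : ((W.filter fun w => w ∈ A ∪ B).card : ℝ) ≤ A.ncard + B.ncard := by
    rw [← Nat.cast_add, Nat.cast_le, ← Set.ncard_coe_finset]
    refine (Set.ncard_le_ncard ?_ ((finite_fewLabels k).union (finite_badWalks k))).trans
      (Set.ncard_union_le _ _)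
    intro w hw
    exact (Finset.mem_filter.1 hw).2
  have hmain : ‖∑ w ∈ W, (∫ ω, listWeight a (edges w) ω ∂P -
      if w ∈ exactTreeWalks r k then 1 else 0)‖ ≤ (A.ncard + B.ncard) * (2 * k * C + 1) := by
    have h0 : ∑ w ∈ W, (∫ ω, listWeight a (edges w) ω ∂P -
        if w ∈ exactTreeWalks r k then 1 else 0) = ∑ w ∈ W.filter (fun w => w ∈ A ∪ B),
        (∫ ω, listWeight a (edges w) ω ∂P - if w ∈ exactTreeWalks r k then 1 else 0) := by
      symm
      refine Finset.sum_filter_of_ne fun w hw hne => ?_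
      by_contra hAB
      rw [Set.mem_union, not_or] at hAB
      rw [hW, Finset.mem_biUnion] at hw
      obtain ⟨q, -, hw⟩ := hw
      exact hne (sub_eq_zero.2
        (integral_listWeight_cases hmeas hindep hcentered hvar hw hAB.1 hAB.2))
    rw [h0]
    refine (norm_sum_le _ _).trans ?_
    refine (Finset.sum_le_card_nsmul _ _ (2 * k * C + 1 : ℝ) fun w hw => ?_).trans ?_
    · obtain ⟨hw, -⟩ := Finset.mem_filter.1 hw
      rw [hW, Finset.mem_biUnion] at hw
      obtain ⟨q, -, hw⟩ := hw
      have h1 := norm_integral_listWeight_le hmeas (by omega) hC _ (hlen q w hw)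
      push_cast at h1
      refine (norm_sub_le _ _).trans (add_le_add h1 ?_)
      split_ifs <;> simp
    · rw [nsmul_eq_mul]
      exact mul_le_mul_of_nonneg_right hAB (by positivity)
  rw [hint, htot]
  have : ∑ w ∈ W, ∫ ω, listWeight a (edges w) ω ∂P - (((exactTreeWalks r k).ncard + d : ℕ) : ℂ) =
      ∑ w ∈ W, (∫ ω, listWeight a (edges w) ω ∂P -
        if w ∈ exactTreeWalks r k then 1 else 0) - d := by
    rw [Finset.sum_sub_distrib, ← hcardC]
    push_cast
    ring
  rw [this]
  refine (norm_sub_le _ _).trans ?_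
  have hd' : ‖(d : ℂ)‖ ≤ catalan k * A.ncard := by
    rw [Complex.norm_natCast]
    exact_mod_cast hd
  have hd'' : (catalan k : ℝ) * A.ncard ≤ catalan k * (A.ncard + B.ncard) := by
    gcongr
    simp
  linarith

end Trace
end SampleCov

namespace SampleCov

/-! ### The exceptional sets in terms of (MP1)–(MP3), and the exact number of tours -/

section Counting

variable {s t : ℕ} {r : Setoid (Fin s × Fin t)}

lemma ncard_edgeLabel_le {B : ℕ}
    (h1 : ∀ p q p', {q' : Fin t | r (p, q) (p', q')}.ncard ≤ B)
    (h2 : ∀ p q q', {p' : Fin s | r (p, q) (p', q')}.ncard ≤ B)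
    (v : Fin s ⊕ Fin t) (c : Quotient r) : {u | edgeLabel r v u = some c}.ncard ≤ B := by
  obtain ⟨⟨p, q⟩, rfl⟩ := Quotient.exists_rep c
  rcases v with v | v
  · refine (Set.ncard_le_ncard ?_ (Set.toFinite _)).trans
      ((Set.ncard_image_le (f := Sum.inr) (Set.toFinite _)).trans (h1 p q v))
    rintro (u | u) hu
    · simp [edgeLabel] at hu
    · exact ⟨u, r.symm (Quotient.exact (Option.some.inj hu)), rfl⟩
  · refine (Set.ncard_le_ncard ?_ (Set.toFinite _)).trans
      ((Set.ncard_image_le (f := Sum.inl) (Set.toFinite _)).trans (h2 p q v))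
    rintro (u | u) hu
    · exact ⟨u, r.symm (Quotient.exact (Option.some.inj hu)), rfl⟩
    · simp [edgeLabel] at hu

/-- A bent path runs column–row–column or row–column–row; these are the two counts in (MP3). -/
lemma ncard_bentPaths_le : (bentPaths (edgeLabel r)).ncard ≤
    {x : Fin s × Fin t × Fin t | r (x.1, x.2.1) (x.1, x.2.2) ∧ x.2.1 ≠ x.2.2}.ncard +
    {x : Fin s × Fin s × Fin t | r (x.1, x.2.2) (x.2.1, x.2.2) ∧ x.1 ≠ x.2.1}.ncard := by
  set S1 := {x : Fin s × Fin t × Fin t | r (x.1, x.2.1) (x.1, x.2.2) ∧ x.2.1 ≠ x.2.2}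
  set S2 := {x : Fin s × Fin s × Fin t | r (x.1, x.2.2) (x.2.1, x.2.2) ∧ x.1 ≠ x.2.1}
  refine (Set.ncard_le_ncard (t := (fun x => (Sum.inr x.2.1, Sum.inl x.1, Sum.inr x.2.2)) '' S1 ∪
    (fun x => (Sum.inl x.1, Sum.inr x.2.2, Sum.inl x.2.1)) '' S2) ?_ (Set.toFinite _)).trans
    ((Set.ncard_union_le _ _).trans (add_le_add (Set.ncard_image_le (Set.toFinite _))
      (Set.ncard_image_le (Set.toFinite _))))
  rintro ⟨u, v, w⟩ ⟨h1, h2, h3⟩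
  rcases u with u | u <;> rcases v with v | v <;> rcases w with w | w <;>
    simp only [edgeLabel, ne_eq, not_true, reduceCtorEq] at h1 h2
  · exact Or.inr ⟨(u, w, v), ⟨Quotient.exact (Option.some.inj h2), fun h => h3 (by simpa using h)⟩,
      rfl⟩
  · exact Or.inl ⟨(v, u, w), ⟨Quotient.exact (Option.some.inj h2), fun h => h3 (by simpa using h)⟩,
      rfl⟩

/-- The factor 4 comes from the orientations of the two edges, the factor `s` from the row of the
first. -/
lemma ncard_equalPairs_le : (equalPairs (edgeLabel r)).ncard ≤
    4 * (s * Finset.univ.sup fun p : Fin s =>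
      {x : Fin t × Fin s × Fin t | r (p, x.1) (x.2.1, x.2.2)}.ncard) := by
  set m := Finset.univ.sup fun p : Fin s =>
      {x : Fin t × Fin s × Fin t | r (p, x.1) (x.2.1, x.2.2)}.ncard
  set S : Set (Fin s × Fin t × Fin s × Fin t) := {x | r (x.1, x.2.1) (x.2.2.1, x.2.2.2)} with hS
  have hcard : S.ncard ≤ s * m := by
    have := ncard_le_of_injOn_prod S id Set.univ
      (fun p => {x : Fin t × Fin s × Fin t | r (p, x.1) (x.2.1, x.2.2)}) m
      Function.injective_id.injOn (Set.toFinite _) (fun _ _ => Set.mem_univ _)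
      (fun _ _ => Set.toFinite _) (fun x hx => hx) (fun p _ => Finset.le_sup
        (f := fun p : Fin s => {x : Fin t × Fin s × Fin t | r (p, x.1) (x.2.1, x.2.2)}.ncard)
        (Finset.mem_univ p))
    rwa [Set.ncard_univ, Nat.card_eq_fintype_card, Fintype.card_fin, mul_comm] at this
  set o : Bool → Fin s → Fin t → (Fin s ⊕ Fin t) × (Fin s ⊕ Fin t) := fun b p q =>
    if b then (Sum.inl p, Sum.inr q) else (Sum.inr q, Sum.inl p) with ho
  have hsub : equalPairs (edgeLabel r) ⊆ (fun x : (Bool × Bool) × (Fin s × Fin t × Fin s × Fin t) =>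
      (o x.1.1 x.2.1 x.2.2.1, o x.1.2 x.2.2.2.1 x.2.2.2.2)) '' (Set.univ ×ˢ S) := by
    rintro ⟨⟨u, v⟩, ⟨u', v'⟩⟩ ⟨h1, h2⟩
    rcases u with u | u <;> rcases v with v | v <;> rcases u' with u' | u' <;>
      rcases v' with v' | v' <;> simp only [edgeLabel, ne_eq, not_true, reduceCtorEq] at h1 h2
    · exact ⟨((true, true), (u, v, u', v')), ⟨trivial, Quotient.exact (Option.some.inj h2)⟩, rfl⟩
    · exact ⟨((true, false), (u, v, v', u')), ⟨trivial, Quotient.exact (Option.some.inj h2)⟩, rfl⟩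
    · exact ⟨((false, true), (v, u, u', v')), ⟨trivial, Quotient.exact (Option.some.inj h2)⟩, rfl⟩
    · exact ⟨((false, false), (v, u, v', u')), ⟨trivial, Quotient.exact (Option.some.inj h2)⟩, rfl⟩
  refine (Set.ncard_le_ncard hsub (Set.toFinite _)).trans
    ((Set.ncard_image_le (Set.toFinite _)).trans ?_)
  rw [Set.ncard_prod, Set.ncard_univ, Nat.card_eq_fintype_card, Fintype.card_prod,
    Fintype.card_bool]
  exact Nat.mul_le_mul_left _ hcard

/-- The weight of a plane tree whose vertices at odd, respectively even, distance from the root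
carry the weight `x`, respectively `y`. -/
def treeWeight {R : Type*} [Mul R] : BinaryTree Unit → R → R → R
  | .nil, _, y => y
  | .node _ l r, x, y => treeWeight l y x * treeWeight r x y

/-- The number of tree walks from a fixed root. -/
def rootedCount : BinaryTree Unit → ℕ → ℕ → ℕ
  | .nil, _, _ => 1
  | .node _ l r, x, y => x * rootedCount l y x * rootedCount r x y

lemma mul_rootedCount (T : BinaryTree Unit) (x y : ℕ) : y * rootedCount T x y = treeWeight T x y := by
  induction T generalizing x y with
  | nil => simp [rootedCount, treeWeight]
  | node a l r ihl ihr =>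
    rw [treeWeight, ← ihl, ← ihr, rootedCount]
    ring

lemma treeWeight_cast (T : BinaryTree Unit) (x y : ℕ) :
    ((treeWeight T x y : ℕ) : ℝ) = treeWeight T (x : ℝ) (y : ℝ) := by
  induction T generalizing x y with
  | nil => rfl
  | node a l r ihl ihr => simp [treeWeight, ihl, ihr]

lemma treeWeight_mul (T : BinaryTree Unit) (c x y : ℝ) :
    treeWeight T (c * x) (c * y) = c ^ (T.numNodes + 1) * treeWeight T x y := by
  induction T generalizing x y with
  | nil => simp [treeWeight, BinaryTree.numNodes]
  | node a l r ihl ihr =>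
    simp only [treeWeight, ihl, ihr, BinaryTree.numNodes]
    ring

lemma tendsto_treeWeight (T : BinaryTree Unit) {ι : Type*} {f : Filter ι} {x y : ι → ℝ}
    {x₀ y₀ : ℝ} (hx : Tendsto x f (𝓝 x₀)) (hy : Tendsto y f (𝓝 y₀)) :
    Tendsto (fun i => treeWeight T (x i) (y i)) f (𝓝 (treeWeight T x₀ y₀)) := by
  induction T generalizing x y x₀ y₀ with
  | nil => exact hy
  | node a l r ihl ihr => exact (ihl hy hx).mul (ihr hx hy)

/-- The sum of the weights of all plane trees with `k` edges. -/
noncomputable def treeSum (k : ℕ) (x y : ℝ) : ℝ :=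
  ∑ T ∈ BinaryTree.treesOfNumNodesEq k, treeWeight T x y

lemma treeSum_zero (x y : ℝ) : treeSum 0 x y = y := by
  simp [treeSum, treeWeight]

/-- Cut off the first subtree. Its root has odd depth, so the two weights change roles there. -/
lemma treeSum_succ (k : ℕ) (x y : ℝ) : treeSum (k + 1) x y =
    ∑ p ∈ Finset.HasAntidiagonal.antidiagonal k, treeSum p.1 y x * treeSum p.2 x y := by
  rw [treeSum, BinaryTree.treesOfNumNodesEq_succ, Finset.sum_biUnion]
  · refine Finset.sum_congr rfl fun p _ => ?_
    rw [Finset.sum_map, Finset.sum_product, treeSum, treeSum, Finset.sum_mul_sum]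
    rfl
  · simp_rw [Set.PairwiseDisjoint, Set.Pairwise, Finset.disjoint_left]
    aesop

lemma card_treeWalks (T : BinaryTree Unit) :
    (∀ q : Fin t, (treeWalks (edgeLabel r) T (Sum.inr q)).card = rootedCount T s t) ∧
    ∀ p : Fin s, (treeWalks (edgeLabel r) T (Sum.inl p)).card = rootedCount T t s := by
  induction T with
  | nil => simp [treeWalks, rootedCount]
  | node a l r' ihl ihr =>
    constructor
    · intro q
      rw [card_treeWalks_node (b := rootedCount l t s), ihr.1 q, rootedCount]
      · congr 2
        have : {u | edgeLabel r (Sum.inr q) u ≠ none} = Set.range Sum.inl := by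
          ext u
          rcases u with u | u <;> simp [edgeLabel]
        rw [this, ← Set.image_univ, (Sum.inl_injective.injOn).ncard_image, Set.ncard_univ,
          Nat.card_eq_fintype_card, Fintype.card_fin]
      · rintro (u | u) hu
        · exact ihl.2 u
        · simp [edgeLabel] at hu
    · intro p
      rw [card_treeWalks_node (b := rootedCount l s t), ihr.2 p, rootedCount]
      · congr 2
        have : {u | edgeLabel r (Sum.inl p) u ≠ none} = Set.range Sum.inr := by
          ext u
          rcases u with u | u <;> simp [edgeLabel]
        rw [this, ← Set.image_univ, (Sum.inr_injective.injOn).ncard_image, Set.ncard_univ,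
          Nat.card_eq_fintype_card, Fintype.card_fin]
      · rintro (u | u) hu
        · simp [edgeLabel] at hu
        · exact ihl.1 u

lemma numTreeWalks_cast (k : ℕ) : (numTreeWalks r k : ℝ) = treeSum k s t := by
  rw [numTreeWalks, treeSum, Finset.sum_comm]
  push_cast
  refine Finset.sum_congr rfl fun T _ => ?_
  rw [Finset.sum_congr rfl fun q _ => by rw [(card_treeWalks T).1 q], Finset.sum_const,
    Finset.card_univ, Fintype.card_fin, ← treeWeight_cast, ← mul_rootedCount]
  simp

end Counting

/-! ### Limits of the normalized counts -/

section Asymptotics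

variable {s t : ℕ → ℕ} {κ μ : ℝ} {r : ∀ n, Setoid (Fin (s n) × Fin (t n))}

lemma tendsto_div_of_isLittleO {f : ℕ → ℝ} {k : ℕ} (h : f =o[atTop] fun n : ℕ => (n : ℝ) ^ k) :
    Tendsto (fun n => f n / (n : ℝ) ^ k) atTop (𝓝 0) := h.tendsto_div_nhds_zero

lemma tendsto_card_div (hs : Tendsto (fun n : ℕ => (s n : ℝ) / n) atTop (𝓝 κ))
    (ht : Tendsto (fun n : ℕ => (t n : ℝ) / n) atTop (𝓝 μ)) :
    Tendsto (fun n : ℕ => (Fintype.card (Fin (s n) ⊕ Fin (t n)) : ℝ) / n) atTop (𝓝 (κ + μ)) := by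
  simpa [add_div] using hs.add ht

lemma tendsto_fewLabels (hs : Tendsto (fun n : ℕ => (s n : ℝ) / n) atTop (𝓝 κ))
    (ht : Tendsto (fun n : ℕ => (t n : ℝ) / n) atTop (𝓝 μ)) (hMP2 : MP2 s t r) {k : ℕ}
    (hk : k ≠ 0) :
    Tendsto (fun n : ℕ => ((fewLabels (r n) k).ncard : ℝ) / (n : ℝ) ^ (k + 1)) atTop (𝓝 0) := by
  obtain ⟨B, hB⟩ := hMP2
  have hN := tendsto_card_div hs ht
  have hinv : Tendsto (fun n : ℕ => (n : ℝ)⁻¹) atTop (𝓝 0) := tendsto_inv_atTop_nhds_zero_nat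
  have hlim := ((hN.pow k).const_mul (extConst B 0 (2 * k) : ℝ)).mul hinv
  rw [mul_zero] at hlim
  refine squeeze_zero (fun n => by positivity) (fun n => ?_) hlim
  have h := ncard_few_labels_le edgeLabel_symm (ncard_edgeLabel_le (hB n).1 (hB n).2) (2 * k) (k - 1)
  rw [Nat.sub_add_cancel (Nat.one_le_iff_ne_zero.2 hk)] at h
  rw [div_pow, mul_div_assoc', ← div_eq_mul_inv, div_div, ← pow_succ]
  gcongr
  exact_mod_cast h

/-- Write `N` for the number of vertices. Divided by `n^(k+3)`, the bound of `ncard_badWalks_le`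
tends to zero by (MP1) and (MP3); the factor `(N/n)^2` on its left can be divided out because `κ +
μ` is positive. -/
lemma tendsto_badWalks (hκ : 0 < κ) (hμ : 0 < μ)
    (hs : Tendsto (fun n : ℕ => (s n : ℝ) / n) atTop (𝓝 κ))
    (ht : Tendsto (fun n : ℕ => (t n : ℝ) / n) atTop (𝓝 μ))
    (hMP1 : MP1 s t r) (hMP2 : MP2 s t r) (hMP3 : MP3 s t r) (k : ℕ) :
    Tendsto (fun n : ℕ => ((badWalks (edgeLabel (r n)) k).ncard : ℝ) / (n : ℝ) ^ (k + 1))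
      atTop (𝓝 0) := by
  obtain ⟨B, hB⟩ := hMP2
  have hN := tendsto_card_div hs ht
  have h1 : Tendsto (fun n : ℕ => ((equalPairs (edgeLabel (r n))).ncard : ℝ) / (n : ℝ) ^ 3) atTop
      (𝓝 0) := by
    have h := (hs.mul (tendsto_div_of_isLittleO hMP1)).const_mul 4
    rw [mul_zero, mul_zero] at h
    refine squeeze_zero (fun n => by positivity) (fun n => ?_) h
    rw [div_mul_div_comm, mul_div_assoc', show (n : ℝ) * (n : ℝ) ^ 2 = (n : ℝ) ^ 3 by ring]
    gcongr
    exact_mod_cast ncard_equalPairs_le (r := r n)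
  have h3 : Tendsto (fun n : ℕ => ((bentPaths (edgeLabel (r n))).ncard : ℝ) / (n : ℝ) ^ 2) atTop
      (𝓝 0) := by
    have h := (tendsto_div_of_isLittleO hMP3.1).add (tendsto_div_of_isLittleO hMP3.2)
    rw [add_zero] at h
    refine squeeze_zero (fun n => by positivity) (fun n => ?_) h
    rw [← add_div]
    gcongr
    exact_mod_cast ncard_bentPaths_le (r := r n)
  have hpos : κ + μ ≠ 0 := (add_pos hκ hμ).ne'
  have hlim := (((hN.pow k).const_mul (badConst B k : ℝ)).mul ((h3.mul hN).add h1)).div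
    (hN.pow 2) (pow_ne_zero 2 hpos)
  rw [zero_mul, add_zero, mul_zero, zero_div] at hlim
  refine tendsto_of_tendsto_of_tendsto_of_le_of_le' tendsto_const_nhds hlim
    (Eventually.of_forall fun n => by positivity) ?_
  filter_upwards [hN.eventually_const_lt (add_pos hκ hμ), eventually_gt_atTop 0] with n hn hn0
  have hn0' : (0 : ℝ) < n := by exact_mod_cast hn0
  simp only [Pi.div_apply]
  rw [le_div_iff₀ (by positivity)]
  have h := ncard_badWalks_le edgeLabel_symm (ncard_edgeLabel_le (hB n).1 (hB n).2) k
  set N := Fintype.card (Fin (s n) ⊕ Fin (t n))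
  have h' : ((badWalks (edgeLabel (r n)) k).ncard : ℝ) * (N : ℝ) ^ 2 ≤ badConst B k * (N : ℝ) ^ k *
      ((bentPaths (edgeLabel (r n))).ncard * N + (equalPairs (edgeLabel (r n))).ncard) := by
    exact_mod_cast h
  calc _ = ((badWalks (edgeLabel (r n)) k).ncard : ℝ) * (N : ℝ) ^ 2 / (n : ℝ) ^ (k + 3) := by
        field_simp
        ring
    _ ≤ _ := div_le_div_of_nonneg_right h' (by positivity)
    _ = _ := by
        rw [div_pow]
        field_simp
        ring

lemma tendsto_numTreeWalks (hs : Tendsto (fun n : ℕ => (s n : ℝ) / n) atTop (𝓝 κ))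
    (ht : Tendsto (fun n : ℕ => (t n : ℝ) / n) atTop (𝓝 μ)) (k : ℕ) :
    Tendsto (fun n : ℕ => (numTreeWalks (r n) k : ℝ) / (n : ℝ) ^ (k + 1)) atTop
      (𝓝 (treeSum k κ μ)) := by
  have h : Tendsto (fun n : ℕ => treeSum k ((s n : ℝ) / n) ((t n : ℝ) / n)) atTop
      (𝓝 (treeSum k κ μ)) := tendsto_finsetSum _ fun T _ => tendsto_treeWeight T hs ht
  refine h.congr fun n => ?_
  rw [numTreeWalks_cast, treeSum, treeSum, Finset.sum_div]
  refine Finset.sum_congr rfl fun T hT => ?_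
  rw [BinaryTree.mem_treesOfNumNodesEq] at hT
  have := treeWeight_mul T (n : ℝ)⁻¹ (s n) (t n)
  rw [← div_eq_inv_mul, ← div_eq_inv_mul, hT] at this
  rw [this, inv_pow, ← div_eq_inv_mul]

theorem tendsto_integral_trace_pow (hκ : 0 < κ) (hμ : 0 < μ)
    (hs : Tendsto (fun n : ℕ => (s n : ℝ) / n) atTop (𝓝 κ))
    (ht : Tendsto (fun n : ℕ => (t n : ℝ) / n) atTop (𝓝 μ))
    {Ω : ℕ → Type*} [∀ n, MeasurableSpace (Ω n)]
    {P : ∀ n, Measure (Ω n)} [∀ n, IsProbabilityMeasure (P n)]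
    {a : ∀ n, Fin (s n) × Fin (t n) → Ω n → ℂ}
    (hmeas : ∀ n x, Measurable (a n x)) (hindep : ∀ n, IndepClasses (P n) (r n) (a n))
    (hMP1 : MP1 s t r) (hMP2 : MP2 s t r) (hMP3 : MP3 s t r)
    (hcentered : ∀ n x, ∫ ω, a n x ω ∂(P n) = 0)
    (hvar : ∀ n x, ∫ ω, a n x ω * star (a n x ω) ∂(P n) = 1)
    (hmom : ∀ k : ℕ, ∃ C : ℝ≥0, ∀ n x, ∫⁻ ω, ‖a n x ω‖ₑ ^ k ∂(P n) ≤ C) {k : ℕ} (hk : k ≠ 0) :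
    Tendsto (fun n : ℕ => (∫ ω, (((entryMatrix (a n) ω)ᴴ * entryMatrix (a n) ω) ^ k).trace ∂(P n)) /
      (n : ℂ) ^ (k + 1)) atTop (𝓝 (treeSum k κ μ : ℂ)) := by
  obtain ⟨C, hC⟩ := hmom (2 * k)
  have hT : Tendsto (fun n : ℕ => ((numTreeWalks (r n) k : ℝ) / (n : ℝ) ^ (k + 1) : ℂ)) atTop
      (𝓝 (treeSum k κ μ : ℂ)) := by
    have := (Complex.continuous_ofReal.tendsto _).comp (tendsto_numTreeWalks (r := r) hs ht k)
    refine this.congr fun n => ?_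
    simp
  have hE := ((tendsto_fewLabels hs ht hMP2 hk).add
    (tendsto_badWalks hκ hμ hs ht hMP1 hMP2 hMP3 k)).const_mul (2 * k * C + 1 + catalan k : ℝ)
  rw [add_zero, mul_zero] at hE
  have hdiff : Tendsto (fun n : ℕ =>
      (∫ ω, (((entryMatrix (a n) ω)ᴴ * entryMatrix (a n) ω) ^ k).trace ∂(P n)) / (n : ℂ) ^ (k + 1) -
      ((numTreeWalks (r n) k : ℝ) / (n : ℝ) ^ (k + 1) : ℂ)) atTop (𝓝 0) := by
    refine squeeze_zero_norm (fun n => ?_) hE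
    have h := norm_integral_trace_pow_sub_le (hmeas n) (hindep n) (hcentered n) (hvar n) hk (hC n)
    rw [← add_div, mul_div_assoc', Complex.ofReal_natCast, Complex.ofReal_natCast, ← sub_div,
      norm_div, norm_pow, Complex.norm_natCast]
    gcongr
  simpa using hdiff.add hT

end Asymptotics
end SampleCov

namespace SampleCov

/-! ### From convergence of moments to weak convergence -/

section MomentMethod

lemma integrable_polynomial {ρ : Measure ℝ} (h : ∀ k : ℕ, Integrable (fun x : ℝ => x ^ k) ρ)
    (p : Polynomial ℝ) : Integrable (fun x => p.eval x) ρ := by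
  simp_rw [Polynomial.eval_eq_sum_range]
  exact integrable_finsetSum _ fun i _ => (h i).const_mul _

lemma integral_polynomial {ρ : Measure ℝ} (h : ∀ k : ℕ, Integrable (fun x : ℝ => x ^ k) ρ)
    (p : Polynomial ℝ) : ∫ x, p.eval x ∂ρ =
      ∑ i ∈ Finset.range (p.natDegree + 1), p.coeff i * ∫ x, x ^ i ∂ρ := by
  simp_rw [Polynomial.eval_eq_sum_range]
  rw [integral_finsetSum _ fun i _ => (h i).const_mul _]
  simp_rw [integral_const_mul]

lemma integrable_pow_of_bounded_support {ν : Measure ℝ} [IsFiniteMeasure ν] {R : ℝ}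
    (hν : ∀ᵐ x ∂ν, |x| ≤ R) (k : ℕ) : Integrable (fun x : ℝ => x ^ k) ν := by
  refine Integrable.of_bound (continuous_pow k).aestronglyMeasurable (R ^ k) ?_
  filter_upwards [hν] with x hx
  rw [norm_pow, Real.norm_eq_abs]
  gcongr

/-- Outside of a large interval a bounded function and a polynomial are dominated by high powers. -/
lemma exists_polynomial_approx (f : BoundedContinuousFunction ℝ ℝ) {S : ℝ} (hS : 1 ≤ S) {ε : ℝ}
    (hε : 0 < ε) : ∃ p : Polynomial ℝ, ∃ K : ℝ, 0 ≤ K ∧ ∃ d : ℕ, ∀ m, d ≤ m → ∀ x : ℝ,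
      |f x - p.eval x| ≤ ε + K * (x / S) ^ (2 * m) := by
  obtain ⟨p, hp⟩ := exists_polynomial_near_of_continuousOn (-S) S f f.continuous.continuousOn ε hε
  set A := ∑ i ∈ Finset.range (p.natDegree + 1), |p.coeff i| with hA
  have hA0 : 0 ≤ A := Finset.sum_nonneg fun _ _ => abs_nonneg _
  -- Beyond `S`, `f` is at most `‖f‖` and `p` at most `A * |x| ^ p.natDegree`. As `|x| / S ≥ 1`
  -- there, both are absorbed by every power of `|x| / S` whose exponent is at least the degree;
  -- rescaling costs `S ^ p.natDegree`.
  refine ⟨p, ‖f‖ + A * S ^ p.natDegree, by positivity, p.natDegree, fun m hm x => ?_⟩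
  have heven : 0 ≤ (x / S) ^ (2 * m) := by rw [pow_mul]; positivity
  by_cases hx : |x| ≤ S
  · have h := hp x (abs_le.1 hx)
    rw [abs_sub_comm] at h
    exact h.le.trans (le_add_of_nonneg_right (mul_nonneg (by positivity) heven))
  · rw [not_le] at hx
    have hx1 : 1 ≤ |x| := hS.trans hx.le
    have hy1 : 1 ≤ |x| / S := (one_le_div (by positivity)).2 hx.le
    have hpow : (x / S) ^ (2 * m) = (|x| / S) ^ (2 * m) := by
      rw [pow_mul, pow_mul, div_pow x, div_pow |x|, sq_abs]
    have h1 : |p.eval x| ≤ A * |x| ^ p.natDegree := by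
      rw [Polynomial.eval_eq_sum_range, hA, Finset.sum_mul]
      refine (Finset.abs_sum_le_sum_abs _ _).trans (Finset.sum_le_sum fun i hi => ?_)
      rw [abs_mul, abs_pow]
      gcongr
      exact Nat.lt_succ_iff.1 (Finset.mem_range.1 hi)
    have h2 : |x| ^ p.natDegree ≤ S ^ p.natDegree * (|x| / S) ^ (2 * m) := by
      calc |x| ^ p.natDegree = S ^ p.natDegree * (|x| / S) ^ p.natDegree := by
            rw [← mul_pow, mul_div_cancel₀ _ (by positivity)]
        _ ≤ _ := by
            gcongr
            omega
    have h3 : |f x| ≤ ‖f‖ * (|x| / S) ^ (2 * m) :=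
      (f.norm_coe_le_norm x).trans (le_mul_of_one_le_right (norm_nonneg _) (one_le_pow₀ hy1))
    rw [hpow]
    calc |f x - p.eval x| ≤ |f x| + |p.eval x| := abs_sub _ _
      _ ≤ ‖f‖ * (|x| / S) ^ (2 * m) + A * (S ^ p.natDegree * (|x| / S) ^ (2 * m)) :=
          add_le_add h3 (h1.trans (by gcongr))
      _ = (‖f‖ + A * S ^ p.natDegree) * (|x| / S) ^ (2 * m) := by ring
      _ ≤ _ := le_add_of_nonneg_left hε.le

/-- The method of moments for a compactly supported limit. -/
theorem tendsto_of_tendsto_moments {ρ : ℕ → FiniteMeasure ℝ} {ν : FiniteMeasure ℝ} {R : ℝ}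
    (hν : ∀ᵐ x ∂(ν : Measure ℝ), |x| ≤ R)
    (hint : ∀ n k, Integrable (fun x : ℝ => x ^ k) (ρ n : Measure ℝ))
    (hlim : ∀ k : ℕ, Tendsto (fun n => ∫ x, x ^ k ∂(ρ n : Measure ℝ)) atTop
      (𝓝 (∫ x, x ^ k ∂(ν : Measure ℝ)))) : Tendsto ρ atTop (𝓝 ν) := by
  rw [FiniteMeasure.tendsto_iff_forall_integral_tendsto]
  intro f
  have hintν := integrable_pow_of_bounded_support hν
  have hpolylim : ∀ p : Polynomial ℝ, Tendsto (fun n => ∫ x, p.eval x ∂(ρ n : Measure ℝ)) atTop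
      (𝓝 (∫ x, p.eval x ∂(ν : Measure ℝ))) := by
    intro p
    simp_rw [fun n => integral_polynomial (hint n) p, integral_polynomial hintν p]
    exact tendsto_finsetSum _ fun i _ => (hlim i).const_mul _
  set T := max R 0 with hT
  -- Strictly beyond the support of `ν`, so that `(T / S) ^ (2 * m)` decays.
  set S := T + 1 with hS
  have hT0 : 0 ≤ T := le_max_right _ _
  have hS1 : 1 ≤ S := by linarith
  set v := (ν : Measure ℝ).real Set.univ with hv
  have hv0 : 0 ≤ v := measureReal_nonneg
  rw [Metric.tendsto_atTop']
  intro δ hδ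
  -- The final error is below `ε * (4 * v + 2)`: the integral of `q` against `ν` is at most `2 * ε *
  -- v` and is used twice, and the convergence for `q` and for `p` costs one `ε` each.
  set ε := δ / (4 * v + 3) with hε
  have hε0 : 0 < ε := by positivity
  obtain ⟨p, K, hK, d, hp⟩ := exists_polynomial_approx f hS1 hε0
  have hgeom : Tendsto (fun m : ℕ => K * ((T / S) ^ 2) ^ m) atTop (𝓝 (K * 0)) := by
    refine (tendsto_pow_atTop_nhds_zero_of_lt_one (by positivity) ?_).const_mul K
    have : T / S < 1 := (div_lt_one (by linarith)).2 (by linarith)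
    exact pow_lt_one₀ (by positivity) this (by norm_num)
  rw [mul_zero] at hgeom
  -- Possible because `K` does not depend on `m`.
  obtain ⟨m, hm, hdm⟩ := ((hgeom.eventually_lt_const hε0).and (eventually_ge_atTop d)).exists
  set q : Polynomial ℝ := Polynomial.C ε + Polynomial.C (K / S ^ (2 * m)) * Polynomial.X ^ (2 * m)
    with hq
  have hpq : ∀ x, |f x - p.eval x| ≤ q.eval x := by
    intro x
    refine (hp m hdm x).trans (le_of_eq ?_)
    simp only [hq, Polynomial.eval_add, Polynomial.eval_C, Polynomial.eval_mul, Polynomial.eval_pow,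
      Polynomial.eval_X]
    rw [div_pow]
    ring
  have hdist : ∀ ρ : Measure ℝ, IsFiniteMeasure ρ →
      (∀ k : ℕ, Integrable (fun x : ℝ => x ^ k) ρ) →
      |∫ x, f x ∂ρ - ∫ x, p.eval x ∂ρ| ≤ ∫ x, q.eval x ∂ρ := by
    intro ρ _ hρ
    rw [← integral_sub (f.integrable ρ) (integrable_polynomial hρ p)]
    refine (abs_integral_le_integral_abs).trans ?_
    exact integral_mono_of_nonneg (ae_of_all _ fun x => abs_nonneg _) (integrable_polynomial hρ q)
      (ae_of_all _ hpq)
  have hqν : ∫ x, q.eval x ∂(ν : Measure ℝ) ≤ 2 * ε * v := by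
    have : ∫ x, q.eval x ∂(ν : Measure ℝ) ≤ ∫ _, 2 * ε ∂(ν : Measure ℝ) := by
      refine integral_mono_ae (integrable_polynomial hintν q) (integrable_const _) ?_
      filter_upwards [hν] with x hx
      simp only [hq, Polynomial.eval_add, Polynomial.eval_C, Polynomial.eval_mul,
        Polynomial.eval_pow, Polynomial.eval_X]
      have h1 : x ^ (2 * m) ≤ T ^ (2 * m) := by
        rw [pow_mul, pow_mul, ← sq_abs]
        gcongr
        exact hx.trans (le_max_left _ _)
      have h2 : K / S ^ (2 * m) * x ^ (2 * m) ≤ K * ((T / S) ^ 2) ^ m := by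
        calc _ ≤ K / S ^ (2 * m) * T ^ (2 * m) := by gcongr
          _ = _ := by rw [← pow_mul, div_pow]; ring
      linarith
    rw [integral_const, smul_eq_mul, ← hv] at this
    linarith
  have e1 := (hpolylim q).eventually_lt_const (lt_add_of_pos_right _ hε0)
  have e2 := (Metric.tendsto_nhds.1 (hpolylim p)) ε hε0
  obtain ⟨N, hN⟩ := eventually_atTop.1 (e1.and e2)
  refine ⟨N, fun n hn => ?_⟩
  obtain ⟨h1, h2⟩ := hN n hn.le
  rw [Real.dist_eq] at h2 ⊢
  have h3 := hdist (ρ n) inferInstance (hint n)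
  have h4 := hdist ν inferInstance hintν
  have h5 : ε * (4 * v + 3) = δ := div_mul_cancel₀ _ (by positivity)
  rw [abs_le] at h3 h4
  rw [abs_lt] at h2 ⊢
  constructor <;> nlinarith [h3.1, h3.2, h4.1, h4.2, h2.1, h2.2]

end MomentMethod
end SampleCov

namespace SampleCov

/-! ### Recursion for noncrossing partitions by their last element -/

section Noncrossing

/-- A noncrossing partition of `{0, …, k - 1}`, encoded by the function that maps each element to
the minimum of its block and is the identity from `k` on. -/
structure IsMinMap (k : ℕ) (f : ℕ → ℕ) : Prop where
  le : ∀ i, f i ≤ i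
  idem : ∀ i, f (f i) = f i
  fix : ∀ i, k ≤ i → f i = i
  -- An element enclosed by a block belongs to it or to a block starting inside. Equality `b = f c`
  -- does no harm, since `idem` then gives `f b = f c`.
  noncrossing : ∀ b c d, b < c → c < d → f b = f d → f c = f b ∨ b ≤ f c

/-- The number of blocks. -/
def fixCount (k : ℕ) (f : ℕ → ℕ) : ℕ := ((Finset.range k).filter fun i => f i = i).card

lemma fixCount_le (k : ℕ) (f : ℕ → ℕ) : fixCount k f ≤ k := by
  exact (Finset.card_filter_le _ _).trans (by simp)

/-- Append an element to the block of `j`, after a noncrossing partition of the elements strictly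
between `j` and `k`. -/
def glue (j k : ℕ) (f : (ℕ → ℕ) × (ℕ → ℕ)) (i : ℕ) : ℕ :=
  if i ≤ j then f.1 i else if i < k then f.2 (i - (j + 1)) + (j + 1) else
    if i = k then f.1 j else i

lemma isMinMap_zero {f : ℕ → ℕ} : IsMinMap 0 f ↔ f = id := by
  constructor
  · intro h
    funext i
    exact h.fix i (Nat.zero_le i)
  · rintro rfl
    exact ⟨fun _ => le_rfl, fun _ => rfl, fun _ _ => rfl, fun b c d h1 h2 h => by
      simp only [id] at *; omega⟩

lemma IsMinMap.succ {k : ℕ} {f : ℕ → ℕ} (h : IsMinMap k f) : IsMinMap (k + 1) f :=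
  ⟨h.le, h.idem, fun i hi => h.fix i (by omega), h.noncrossing⟩

lemma IsMinMap.of_succ {k : ℕ} {f : ℕ → ℕ} (h : IsMinMap (k + 1) f) (hk : f k = k) :
    IsMinMap k f :=
  ⟨h.le, h.idem, fun i hi => (eq_or_lt_of_le hi).elim (fun e => e ▸ hk) fun e => h.fix i e,
    h.noncrossing⟩

section Glue

variable {j k : ℕ} {f : (ℕ → ℕ) × (ℕ → ℕ)}

lemma glue_of_le {i : ℕ} (hi : i ≤ j) : glue j k f i = f.1 i := if_pos hi

lemma glue_of_lt {i : ℕ} (hi : j < i) (hik : i < k) :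
    glue j k f i = f.2 (i - (j + 1)) + (j + 1) := by
  rw [glue, if_neg (by omega), if_pos hik]

lemma glue_self (hj : j < k) : glue j k f k = f.1 j := by
  rw [glue, if_neg (by omega), if_neg (by omega), if_pos rfl]

lemma glue_of_gt {i : ℕ} (hj : j < k) (hi : k < i) : glue j k f i = i := by
  rw [glue, if_neg (by omega), if_neg (by omega), if_neg (by omega)]

variable (hj : j < k) (h₁ : IsMinMap (j + 1) f.1) (h₂ : IsMinMap (k - 1 - j) f.2)
include hj h₁ h₂

lemma isMinMap_glue : IsMinMap (k + 1) (glue j k f) := by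
  have hle : ∀ i, glue j k f i ≤ i := by
    intro i
    rcases le_or_gt i j with hi | hi
    · rw [glue_of_le hi]; exact h₁.le i
    rcases lt_trichotomy i k with hik | rfl | hik
    · rw [glue_of_lt hi hik]
      have := h₂.le (i - (j + 1))
      omega
    · rw [glue_self hj]
      have := h₁.le j
      omega
    · rw [glue_of_gt hj hik]
  refine ⟨hle, ?_, fun i hi => glue_of_gt hj hi, ?_⟩
  · intro i
    rcases le_or_gt i j with hi | hi
    · rw [glue_of_le hi, glue_of_le ((h₁.le i).trans hi), h₁.idem]
    rcases lt_trichotomy i k with hik | rfl | hik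
    · have h := h₂.le (i - (j + 1))
      rw [glue_of_lt hi hik, glue_of_lt (by omega) (by omega), Nat.add_sub_cancel, h₂.idem]
    · rw [glue_self hj, glue_of_le (h₁.le j), h₁.idem]
    · rw [glue_of_gt hj hik, glue_of_gt hj hik]
  · intro b c d hbc hcd heq
    rcases lt_or_ge k d with hd | hd
    · rw [glue_of_gt hj hd] at heq
      have := hle b
      omega
    rcases le_or_gt b j with hb | hb
    · rw [glue_of_le hb] at heq ⊢
      have hb' := h₁.le b
      rcases le_or_gt c j with hc | hc
      · rw [glue_of_le hc]
        rcases le_or_gt d j with hd' | hd'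
        · rw [glue_of_le hd'] at heq
          exact h₁.noncrossing b c d hbc hcd heq
        rcases lt_or_eq_of_le hd with hd | rfl
        · rw [glue_of_lt hd' hd] at heq
          omega
        · rw [glue_self hj] at heq
          rcases lt_or_eq_of_le hc with hc | rfl
          · exact h₁.noncrossing b c j hbc hc heq
          · exact Or.inl heq.symm
      · rw [glue_of_lt hc (by omega)]
        omega
    · rw [glue_of_lt hb (by omega)] at heq ⊢
      rw [glue_of_lt (by omega) (by omega)]
      rcases lt_or_eq_of_le hd with hd | rfl
      · rw [glue_of_lt (by omega) hd] at heq
        have := h₂.noncrossing (b - (j + 1)) (c - (j + 1)) (d - (j + 1)) (by omega) (by omega)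
          (by omega)
        omega
      · rw [glue_self hj] at heq
        have := h₁.le j
        omega

/-- The element `k` joins the block of `j`, so it starts no block of its own. -/
lemma fixCount_glue : fixCount (k + 1) (glue j k f) =
    fixCount (j + 1) f.1 + fixCount (k - 1 - j) f.2 := by
  have hsplit : (Finset.range (k + 1)).filter (fun i => glue j k f i = i) =
      ((Finset.range (j + 1)).filter fun i => f.1 i = i) ∪
      ((Finset.range (k - 1 - j)).filter fun i => f.2 i = i).map
        (addRightEmbedding (j + 1)) := by
    ext i
    simp only [Finset.mem_filter, Finset.mem_range, Finset.mem_union, Finset.mem_map,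
      addRightEmbedding_apply]
    rcases le_or_gt i j with hi | hi
    · rw [glue_of_le hi]
      constructor
      · rintro ⟨-, h⟩
        exact Or.inl ⟨by omega, h⟩
      · rintro (⟨-, h⟩ | ⟨x, -, hx⟩)
        · exact ⟨by omega, h⟩
        · omega
    rcases lt_trichotomy i k with hik | rfl | hik
    · rw [glue_of_lt hi hik]
      constructor
      · rintro ⟨-, h⟩
        exact Or.inr ⟨i - (j + 1), ⟨by omega, by omega⟩, by omega⟩
      · rintro (⟨h, -⟩ | ⟨x, ⟨-, hx⟩, rfl⟩)
        · omega
        · rw [Nat.add_sub_cancel, hx]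
          exact ⟨by omega, rfl⟩
    · rw [glue_self hj]
      have := h₁.le j
      constructor
      · rintro ⟨-, h⟩
        omega
      · rintro (⟨h, -⟩ | ⟨x, ⟨hx, -⟩, h⟩) <;> omega
    · constructor
      · rintro ⟨h, -⟩
        omega
      · rintro (⟨h, -⟩ | ⟨x, ⟨hx, -⟩, h⟩) <;> omega
  rw [fixCount, hsplit, Finset.card_union_of_disjoint, Finset.card_map, fixCount, fixCount]
  rw [Finset.disjoint_left]
  intro i hi hi'
  simp only [Finset.mem_filter, Finset.mem_range, Finset.mem_map, addRightEmbedding_apply] at hi hi'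
  obtain ⟨x, -, hx⟩ := hi'
  omega

end Glue

/-- Let `j` be the predecessor of `k` in its block. A block meeting the gap between `j` and `k`
cannot reach down to `j` without crossing, so the partition splits into its restrictions to the
elements up to `j` and to the gap. -/
lemma exists_glue_eq {k : ℕ} {g : ℕ → ℕ} (h : IsMinMap (k + 1) g) (hk : g k ≠ k) :
    ∃ j < k, ∃ f : (ℕ → ℕ) × (ℕ → ℕ), IsMinMap (j + 1) f.1 ∧ IsMinMap (k - 1 - j) f.2 ∧
      glue j k f = g := by
  set A := (Finset.range k).filter fun i => g i = g k with hA
  have hne : A.Nonempty := ⟨g k, by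
    rw [hA, Finset.mem_filter, Finset.mem_range]
    exact ⟨lt_of_le_of_ne (h.le k) hk, h.idem k⟩⟩
  set j := A.max' hne with hj
  obtain ⟨hjk, hgj⟩ := Finset.mem_filter.1 (A.max'_mem hne)
  rw [Finset.mem_range, ← hj] at hjk
  rw [← hj] at hgj
  have hmax : ∀ i, j < i → i < k → g i ≠ g k := fun i hji hik hi =>
    absurd (A.le_max' i (Finset.mem_filter.2 ⟨Finset.mem_range.2 hik, hi⟩)) (by omega)
  have hbig : ∀ c, j < c → c < k → j + 1 ≤ g c := by
    intro c hjc hck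
    rcases h.noncrossing j c k hjc hck hgj with h1 | h1
    · exact absurd (h1.trans hgj) (hmax c hjc hck)
    · rcases lt_or_eq_of_le h1 with h1 | h1
      · exact h1
      · have h2 := h.idem c
        rw [← h1, hgj] at h2
        exact absurd (h1.symm.trans h2.symm) (hmax c hjc hck)
  refine ⟨j, hjk, (fun i => if i ≤ j then g i else i,
    fun i => if i < k - 1 - j then g (i + (j + 1)) - (j + 1) else i), ?_, ?_, ?_⟩
  · refine ⟨fun i => ?_, fun i => ?_, fun i hi => ?_, fun b c d hbc hcd heq => ?_⟩
    · simp only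
      split_ifs
      exacts [h.le i, le_rfl]
    · by_cases hi : i ≤ j
      · have := h.le i
        simp only [hi, if_true]
        rw [if_pos (by omega), h.idem]
      · simp [hi]
    · exact if_neg (by omega)
    · simp only at heq ⊢
      by_cases hd : d ≤ j
      · rw [if_pos hd, if_pos (by omega)] at heq
        rw [if_pos (by omega), if_pos (by omega)]
        exact h.noncrossing b c d hbc hcd heq
      · rw [if_neg hd] at heq
        have := h.le b
        split_ifs at heq <;> omega
  · refine ⟨fun i => ?_, fun i => ?_, fun i hi => ?_, fun b c d hbc hcd heq => ?_⟩
    · simp only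
      split_ifs
      · have := h.le (i + (j + 1))
        omega
      · exact le_rfl
    · by_cases hi : i < k - 1 - j
      · have h1 := h.le (i + (j + 1))
        have h2 := hbig (i + (j + 1)) (by omega) (by omega)
        simp only [hi, if_true]
        rw [if_pos (by omega), Nat.sub_add_cancel h2, h.idem]
      · simp [hi]
    · exact if_neg (by omega)
    · simp only at heq ⊢
      by_cases hd : d < k - 1 - j
      · rw [if_pos hd, if_pos (by omega)] at heq
        rw [if_pos (by omega), if_pos (by omega)]
        have h1 := hbig (b + (j + 1)) (by omega) (by omega)
        have h2 := hbig (c + (j + 1)) (by omega) (by omega)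
        have h3 := hbig (d + (j + 1)) (by omega) (by omega)
        have := h.noncrossing (b + (j + 1)) (c + (j + 1)) (d + (j + 1)) (by omega) (by omega)
          (by omega)
        omega
      · rw [if_neg hd] at heq
        have := h.le (b + (j + 1))
        split_ifs at heq <;> omega
  · funext i
    rcases le_or_gt i j with hi | hi
    · rw [glue_of_le hi]
      exact if_pos hi
    rcases lt_trichotomy i k with hik | rfl | hik
    · rw [glue_of_lt hi hik]
      have := hbig i hi hik
      simp only
      rw [if_pos (by omega), show i - (j + 1) + (j + 1) = i by omega]
      omega
    · rw [glue_self hjk]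
      simp [hgj]
    · rw [glue_of_gt hjk hik, h.fix i hik]

/-- The index `j` can be recovered: the value at `k` is at most `j`, whereas the values strictly
between `j` and `k` exceed `j`. -/
lemma glue_inj {k j j' : ℕ} {f f' : (ℕ → ℕ) × (ℕ → ℕ)} (hj : j < k) (hj' : j' < k)
    (h₁ : IsMinMap (j + 1) f.1) (h₂ : IsMinMap (k - 1 - j) f.2)
    (h₁' : IsMinMap (j' + 1) f'.1) (h₂' : IsMinMap (k - 1 - j') f'.2)
    (h : glue j k f = glue j' k f') : j = j' ∧ f = f' := by
  have key : ∀ {j j' : ℕ} {f f' : (ℕ → ℕ) × (ℕ → ℕ)}, j < k → j' < k → IsMinMap (j + 1) f.1 →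
      glue j k f = glue j' k f' → ¬ j < j' := by
    intro j j' f f' hj hj' h₁ h hlt
    have e1 := congrFun h k
    have e2 := congrFun h j'
    rw [glue_self hj, glue_self hj'] at e1
    rw [glue_of_lt hlt hj', glue_of_le le_rfl, ← e1] at e2
    have := h₁.le j
    omega
  obtain rfl : j = j' := by
    have h1 := key hj hj' h₁ h
    have h2 := key hj' hj h₁' h.symm
    omega
  refine ⟨rfl, Prod.ext (funext fun i => ?_) (funext fun i => ?_)⟩
  · rcases le_or_gt i j with hi | hi
    · have := congrFun h i
      rwa [glue_of_le hi, glue_of_le hi] at this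
    · rw [h₁.fix i hi, h₁'.fix i hi]
  · rcases lt_or_ge i (k - 1 - j) with hi | hi
    · have := congrFun h (i + (j + 1))
      rw [glue_of_lt (by omega) (by omega), glue_of_lt (by omega) (by omega),
        Nat.add_sub_cancel] at this
      omega
    · rw [h₂.fix i hi, h₂'.fix i hi]

lemma finite_isMinMap (k : ℕ) : {f | IsMinMap k f}.Finite := by
  refine Set.Finite.of_finite_image (f := fun f => fun i : Fin k => (⟨f i % (k + 1),
    Nat.mod_lt _ (Nat.succ_pos k)⟩ : Fin (k + 1))) (Set.toFinite _) ?_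
  intro f hf g hg h
  funext i
  rcases lt_or_ge i k with hi | hi
  · have := congrArg Fin.val (congrFun h ⟨i, hi⟩)
    simp only at this
    rwa [Nat.mod_eq_of_lt, Nat.mod_eq_of_lt] at this
    · have := hg.le i; omega
    · have := hf.le i; omega
  · rw [hf.fix i hi, hg.fix i hi]

/-- The noncrossing partitions of `{0, …, k - 1}`. -/
noncomputable def minMaps (k : ℕ) : Finset (ℕ → ℕ) := (finite_isMinMap k).toFinset

@[simp] lemma mem_minMaps {k : ℕ} {f : ℕ → ℕ} : f ∈ minMaps k ↔ IsMinMap k f := by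
  simp [minMaps]

/-- The generating polynomial of noncrossing partitions by their number of blocks. -/
noncomputable def ncSum (k : ℕ) (x y : ℝ) : ℝ :=
  ∑ f ∈ minMaps k, x ^ fixCount k f * y ^ (k + 1 - fixCount k f)

lemma ncSum_zero (x y : ℝ) : ncSum 0 x y = y := by
  have : minMaps 0 = {id} := by
    ext f
    simp [isMinMap_zero]
  rw [ncSum, this, Finset.sum_singleton]
  simp [fixCount]

/-- The last element is a singleton block, giving the factor `x`, or is glued to its predecessor
`j`. The exponents of `y` add up because `k + 2 = (j + 2) + (k - j)`. -/
lemma ncSum_succ (k : ℕ) (x y : ℝ) : ncSum (k + 1) x y =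
    x * ncSum k x y + ∑ j ∈ Finset.range k, ncSum (j + 1) x y * ncSum (k - 1 - j) x y := by
  classical
  have hdecomp : minMaps (k + 1) = minMaps k ∪ (Finset.range k).biUnion fun j =>
      (minMaps (j + 1) ×ˢ minMaps (k - 1 - j)).image (glue j k) := by
    ext g
    simp only [Finset.mem_union, mem_minMaps, Finset.mem_biUnion, Finset.mem_range,
      Finset.mem_image, Finset.mem_product]
    constructor
    · intro h
      by_cases hk : g k = k
      · exact Or.inl (h.of_succ hk)
      · obtain ⟨j, hj, f, h1, h2, hf⟩ := exists_glue_eq h hk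
        exact Or.inr ⟨j, hj, f, ⟨h1, h2⟩, hf⟩
    · rintro (h | ⟨j, hj, f, ⟨h1, h2⟩, rfl⟩)
      · exact h.succ
      · exact isMinMap_glue hj h1 h2
  rw [ncSum, hdecomp, Finset.sum_union, Finset.sum_biUnion]
  · congr 1
    · rw [ncSum, Finset.mul_sum]
      refine Finset.sum_congr rfl fun f hf => ?_
      have h1 : fixCount (k + 1) f = fixCount k f + 1 := by
        rw [fixCount, Finset.range_add_one, Finset.filter_insert,
          if_pos ((mem_minMaps.1 hf).fix k le_rfl), Finset.card_insert_of_notMem (by simp)]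
        rfl
      rw [h1, Nat.add_sub_add_right]
      ring
    · refine Finset.sum_congr rfl fun j hj => ?_
      have hj := Finset.mem_range.1 hj
      rw [Finset.sum_image, Finset.sum_product, ncSum, ncSum, Finset.sum_mul_sum]
      · refine Finset.sum_congr rfl fun f₁ hf₁ => Finset.sum_congr rfl fun f₂ hf₂ => ?_
        rw [fixCount_glue hj (mem_minMaps.1 hf₁) (mem_minMaps.1 hf₂)]
        have e1 := fixCount_le (j + 1) f₁
        have e2 := fixCount_le (k - 1 - j) f₂
        rw [show k + 1 + 1 - (fixCount (j + 1) f₁ + fixCount (k - 1 - j) f₂) =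
          (j + 1 + 1 - fixCount (j + 1) f₁) + (k - 1 - j + 1 - fixCount (k - 1 - j) f₂) by omega,
          pow_add, pow_add]
        ring
      · intro f hf f' hf' h
        simp only [Finset.coe_product, Set.mem_prod, Finset.mem_coe, mem_minMaps] at hf hf'
        exact (glue_inj hj hj hf.1 hf.2 hf'.1 hf'.2 h).2
  · intro j hj j' hj' hne
    rw [Function.onFun, Finset.disjoint_left]
    intro g hg hg'
    simp only [Finset.mem_image, Finset.mem_product, mem_minMaps] at hg hg'
    obtain ⟨f, hf, rfl⟩ := hg
    obtain ⟨f', hf', h⟩ := hg'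
    exact hne (glue_inj (Finset.mem_range.1 hj) (Finset.mem_range.1 hj') hf.1 hf.2 hf'.1 hf'.2
      h.symm).1
  · rw [Finset.disjoint_left]
    intro g hg hg'
    simp only [Finset.mem_biUnion, Finset.mem_range, Finset.mem_image, Finset.mem_product,
      mem_minMaps] at hg hg'
    obtain ⟨j, hj, f, hf, rfl⟩ := hg'
    have h1 := hg.fix k le_rfl
    rw [glue_self hj] at h1
    have := hf.1.le j
    omega

end Noncrossing
end SampleCov

/-! ### Plane trees and noncrossing partitions have the same weighted count -/

namespace SampleCov

/-- Moving the root along the first edge exchanges the two subtrees and the parity of all depths. -/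
lemma treeSum_succ_symm (k : ℕ) (x y : ℝ) : treeSum (k + 1) x y = treeSum (k + 1) y x := by
  rw [treeSum_succ, treeSum_succ, ← Finset.Nat.sum_antidiagonal_swap]
  exact Finset.sum_congr rfl fun p _ => mul_comm _ _

/-- A first subtree consisting of one vertex gives the term with factor `x`. In all other terms
`treeSum_succ_symm` undoes the exchange of weights, and the recursion becomes `ncSum_succ`. -/
theorem treeSum_eq_ncSum (k : ℕ) (x y : ℝ) : treeSum k x y = ncSum k x y := by
  induction k using Nat.strong_induction_on with
  | _ k ih =>
    cases k with
    | zero => rw [treeSum_zero, ncSum_zero]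
    | succ k =>
      rw [treeSum_succ, ncSum_succ, Finset.Nat.sum_antidiagonal_eq_sum_range_succ_mk,
        Finset.sum_range_succ', treeSum_zero, Nat.sub_zero, ih k (Nat.lt_succ_self k), add_comm]
      congr 1
      refine Finset.sum_congr rfl fun j hj => ?_
      have hj := Finset.mem_range.1 hj
      rw [treeSum_succ_symm, ih (j + 1) (by omega), show k - (j + 1) = k - 1 - j by omega,
        ih (k - 1 - j) (by omega)]

/-! ### Block-minimum maps correspond to noncrossing `Finpartition`s -/

section Finpartition

variable {k : ℕ} {π π' : Finpartition (Finset.univ : Finset (Fin k))}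

lemma mem_part_self (π : Finpartition (Finset.univ : Finset (Fin k))) (i : Fin k) :
    i ∈ π.part i := π.mem_part (Finset.mem_univ i)

/-- The function that maps an element to the minimum of its block. -/
def minMap (π : Finpartition (Finset.univ : Finset (Fin k))) (i : ℕ) : ℕ :=
  if h : i < k then (π.part ⟨i, h⟩).min' ⟨_, mem_part_self π _⟩ else i

lemma minMap_val (π : Finpartition (Finset.univ : Finset (Fin k))) (i : Fin k) :
    minMap π i = (π.part i).min' ⟨_, mem_part_self π i⟩ := dif_pos i.2

lemma minMap_of_ge {i : ℕ} (hi : k ≤ i) : minMap π i = i := dif_neg hi.not_gt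

lemma minMap_le (π : Finpartition (Finset.univ : Finset (Fin k))) (i : ℕ) : minMap π i ≤ i := by
  rcases lt_or_ge i k with hi | hi
  · exact (minMap_val π ⟨i, hi⟩).le.trans (Finset.min'_le _ _ (mem_part_self π ⟨i, hi⟩))
  · exact (minMap_of_ge hi).le

lemma part_eq_part_iff {i j : Fin k} : π.part i = π.part j ↔ i ∈ π.part j :=
  (π.mem_part_iff_part_eq_part (Finset.mem_univ _) (Finset.mem_univ _)).symm

lemma minMap_eq_iff {i j : Fin k} : minMap π i = minMap π j ↔ π.part i = π.part j := by
  rw [minMap_val, minMap_val, Fin.val_inj]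
  constructor
  · intro h
    have h1 := Finset.min'_mem (π.part i) ⟨_, mem_part_self π i⟩
    have h2 := Finset.min'_mem (π.part j) ⟨_, mem_part_self π j⟩
    rw [← part_eq_part_iff] at h1 h2
    rw [← h1, h, h2]
  · intro h
    congr 1

lemma minMap_minMap (π : Finpartition (Finset.univ : Finset (Fin k))) (i : ℕ) :
    minMap π (minMap π i) = minMap π i := by
  rcases lt_or_ge i k with hi | hi
  · have h := minMap_val π ⟨i, hi⟩
    simp only at h
    rw [h, minMap_eq_iff (j := ⟨i, hi⟩) |>.2, h]
    exact part_eq_part_iff.2 (Finset.min'_mem _ _)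
  · rw [minMap_of_ge hi, minMap_of_ge hi]

/-- If the block of `c` starts before `b`, then its minimum, `b`, `c`, `d` form a crossing unless
the two blocks coincide. -/
lemma isMinMap_minMap (hπ : IsNoncrossing π) : IsMinMap k (minMap π) := by
  refine ⟨minMap_le π, minMap_minMap π, fun i hi => minMap_of_ge hi, fun b c d hbc hcd h => ?_⟩
  rcases lt_or_ge d k with hd | hd
  · refine (le_or_gt b (minMap π c)).symm.imp (fun hlt => ?_) id
    have hb : π.part ⟨d, hd⟩ = π.part ⟨b, by omega⟩ := minMap_eq_iff.1 h.symm
    have hc : π.part ⟨minMap π c, by omega⟩ = π.part ⟨c, by omega⟩ :=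
      minMap_eq_iff.1 (minMap_minMap π c)
    refine minMap_eq_iff (π := π) (i := ⟨c, by omega⟩) (j := ⟨b, by omega⟩) |>.2 ?_
    exact hπ _ (π.part_mem.2 (Finset.mem_univ _)) _ (π.part_mem.2 (Finset.mem_univ _))
      ⟨minMap π c, by omega⟩ ⟨b, by omega⟩ ⟨c, by omega⟩ ⟨d, hd⟩ hlt hbc hcd
      (part_eq_part_iff.1 hc) (mem_part_self _ _) (mem_part_self _ _) (part_eq_part_iff.1 hb)
  · rw [minMap_of_ge hd] at h
    have := minMap_le π b
    omega

lemma parts_eq_image (π : Finpartition (Finset.univ : Finset (Fin k))) :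
    π.parts = Finset.univ.image π.part := by
  ext A
  simp only [Finset.mem_image, Finset.mem_univ, true_and]
  constructor
  · intro hA
    obtain ⟨i, -, h⟩ := π.part_surjOn hA
    exact ⟨i, h⟩
  · rintro ⟨i, rfl⟩
    exact π.part_mem.2 (Finset.mem_univ _)

lemma minMap_injective :
    Function.Injective (minMap (k := k)) := by
  intro π π' h
  refine Finpartition.ext ?_
  rw [parts_eq_image, parts_eq_image]
  congr 1
  funext j
  ext i
  rw [← part_eq_part_iff, ← part_eq_part_iff, ← minMap_eq_iff, ← minMap_eq_iff, h]

lemma fixCount_minMap (π : Finpartition (Finset.univ : Finset (Fin k))) :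
    fixCount k (minMap π) = π.parts.card := by
  rw [fixCount]
  refine (Finset.card_nbij' (s := π.parts) (t := (Finset.range k).filter fun i => minMap π i = i)
    (fun A => if h : A.Nonempty then (A.min' h : ℕ) else 0)
    (fun i => if h : i < k then π.part ⟨i, h⟩ else ∅) ?_ ?_ ?_ ?_).symm
  · intro A hA
    rw [parts_eq_image] at hA
    simp only [Finset.coe_image, Finset.coe_univ, Set.image_univ, Set.mem_range] at hA
    obtain ⟨i, rfl⟩ := hA
    have h : (π.part i).Nonempty := ⟨i, mem_part_self π i⟩
    simp only [dif_pos h]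
    rw [← minMap_val]
    simp only [Finset.coe_filter, Finset.mem_range]
    exact ⟨(minMap_le π i).trans_lt i.2, minMap_minMap π i⟩
  · intro i hi
    simp only [Finset.coe_filter, Finset.mem_range] at hi
    simp only [dif_pos hi.1]
    exact π.part_mem.2 (Finset.mem_univ _)
  · intro A hA
    rw [parts_eq_image] at hA
    simp only [Finset.coe_image, Finset.coe_univ, Set.image_univ, Set.mem_range] at hA
    obtain ⟨i, rfl⟩ := hA
    have h : (π.part i).Nonempty := ⟨i, mem_part_self π i⟩
    simp only [dif_pos h, Fin.is_lt, dite_true, Fin.eta]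
    exact part_eq_part_iff.2 (Finset.min'_mem _ _)
  · intro i hi
    simp only [Finset.coe_filter, Finset.mem_range] at hi
    have h : (π.part ⟨i, hi.1⟩).Nonempty := ⟨_, mem_part_self π _⟩
    simp only [dif_pos hi.1, dif_pos h]
    rw [← minMap_val]
    exact hi.2

/-- The blocks are the level sets of `f`: by `idem` the value `f i` lies in the block of `i`, and by
`le` nothing in it is smaller. -/
lemma exists_minMap_eq {f : ℕ → ℕ} (hf : IsMinMap k f) :
    ∃ π : Finpartition (Finset.univ : Finset (Fin k)), IsNoncrossing π ∧ minMap π = f := by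
  classical
  let S : Setoid (Fin k) := Setoid.ker fun i => f i
  have hmem : ∀ i j, i ∈ (Finpartition.ofSetoid S).part j ↔ f i = f j := fun i j =>
    Finpartition.mem_part_ofSetoid_iff_rel.trans eq_comm
  refine ⟨Finpartition.ofSetoid S, ?_, ?_⟩
  · intro A hA B hB a b c d hab hbc hcd ha hc hb hd
    rw [parts_eq_image] at hA hB
    obtain ⟨i, -, rfl⟩ := Finset.mem_image.1 hA
    obtain ⟨j, -, rfl⟩ := Finset.mem_image.1 hB
    rw [hmem] at ha hb hc hd
    rw [part_eq_part_iff, hmem, ← hb, ← hc]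
    refine (hf.noncrossing b c d hbc hcd (hb.trans hd.symm)).resolve_right ?_
    have := hf.le a
    rw [hc, ← ha]
    have : (a : ℕ) < b := hab
    omega
  · funext i
    rcases lt_or_ge i k with hi | hi
    · rw [← Fin.val_mk hi, minMap_val]
      apply le_antisymm
      · exact Finset.min'_le _ (⟨f i, (hf.le i).trans_lt hi⟩ : Fin k) ((hmem _ _).2 (hf.idem i))
      · have h := (hmem _ _).1 (Finset.min'_mem _ ⟨_, mem_part_self (.ofSetoid S) ⟨i, hi⟩⟩)
        rw [← h]
        exact hf.le _
    · rw [minMap_of_ge hi, hf.fix i hi]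

lemma ncCount_eq_card (i k : ℕ) :
    ncCount i k = ((minMaps k).filter fun f => fixCount k f = i).card := by
  rw [ncCount, ← minMap_injective.injOn.ncard_image, ← Set.ncard_coe_finset]
  congr 1
  ext f
  simp only [Set.mem_image, Finset.coe_filter, mem_minMaps]
  constructor
  · rintro ⟨π, ⟨h1, h2⟩, rfl⟩
    exact ⟨isMinMap_minMap h2, (fixCount_minMap π).trans h1⟩
  · rintro ⟨h1, h2⟩
    obtain ⟨π, hπ, rfl⟩ := exists_minMap_eq h1
    exact ⟨π, ⟨(fixCount_minMap π).symm.trans h2, hπ⟩, rfl⟩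

theorem ncSum_eq_sum_ncCount {k : ℕ} (hk : 1 ≤ k) (x y : ℝ) :
    ncSum k x y = ∑ i ∈ Finset.Icc 1 k, (ncCount i k : ℝ) * x ^ i * y ^ (k - i + 1) := by
  have hmaps : ∀ f ∈ minMaps k, fixCount k f ∈ Finset.Icc 1 k := by
    intro f hf
    rw [Finset.mem_Icc]
    refine ⟨Finset.card_pos.2 ⟨0, Finset.mem_filter.2 ⟨Finset.mem_range.2 hk, ?_⟩⟩, fixCount_le k f⟩
    exact Nat.le_zero.1 ((mem_minMaps.1 hf).le 0)
  rw [ncSum, ← Finset.sum_fiberwise_of_maps_to hmaps]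
  refine Finset.sum_congr rfl fun i hi => ?_
  have hi := Finset.mem_Icc.1 hi
  rw [ncCount_eq_card, Finset.sum_congr rfl (g := fun _ => x ^ i * y ^ (k - i + 1)),
    Finset.sum_const, nsmul_eq_mul, mul_assoc]
  intro f hf
  rw [(Finset.mem_filter.1 hf).2, show k + 1 - i = k - i + 1 by omega]

end Finpartition
end SampleCov

namespace SampleCov

/-! ### The quadratic equation of the moment generating function -/

section GeneratingFunction

open PowerSeries

/-- The shifted generating function of the numbers `ncSum k κ 1`. -/
noncomputable def ncSeries (κ : ℝ) : PowerSeries ℝ := PowerSeries.mk fun n => ncSum (n + 1) κ 1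

lemma mk_ncSum (κ : ℝ) : (PowerSeries.mk fun n => ncSum n κ 1) = 1 + X * ncSeries κ := by
  ext n
  cases n with
  | zero => simp [ncSum_zero]
  | succ n => simp [ncSeries, coeff_succ_X_mul, coeff_one]

/-- With `A = ncSeries κ` and `M = 1 + X * A`, the recursion `ncSum_succ` at `y = 1` reads `A = κ M
+ X A M`. -/
lemma ncSeries_eq (κ : ℝ) : ncSeries κ =
    C κ + C (1 + κ) * (X * ncSeries κ) + X ^ 2 * ncSeries κ ^ 2 := by
  have h : ncSeries κ = C κ * (1 + X * ncSeries κ) +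
      X * (ncSeries κ * (1 + X * ncSeries κ)) := by
    conv_lhs => rw [ncSeries]
    rw [← mk_ncSum]
    ext k
    rw [map_add, coeff_C_mul, coeff_mk, coeff_mk, ncSum_succ]
    congr 1
    cases k with
    | zero => simp
    | succ k =>
      rw [coeff_succ_X_mul, coeff_mul, Finset.Nat.sum_antidiagonal_eq_sum_range_succ_mk]
      refine Finset.sum_congr rfl fun j _ => ?_
      rw [coeff_mk, ncSeries, coeff_mk, Nat.add_sub_cancel]
  conv_lhs => rw [h]
  rw [map_add, map_one]
  ring

/-- The tridiagonal recurrences determine `J`. The series `X^m A^(m+1)`, with `A = ncSeries κ`,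
satisfy them as well: multiply the quadratic equation of `A` by a power of `X * A`. -/
lemma eq_coeff_ncSeries {κ : ℝ} {J : ℕ → ℕ → ℝ} (h₀ : J 0 0 = κ) (h₁ : ∀ m, J 0 (m + 1) = 0)
    (h₂ : ∀ n, J (n + 1) 0 = (1 + κ) * J n 0 + J n 1)
    (h₃ : ∀ n m, J (n + 1) (m + 1) = (1 + κ) * J n (m + 1) + J n (m + 2) + κ * J n m) (n m : ℕ) :
    J n m = coeff n (X ^ m * ncSeries κ ^ (m + 1)) := by
  have hA := ncSeries_eq κ
  have hz : ncSeries κ = C κ + X * (C (1 + κ) * (X ^ 0 * ncSeries κ ^ (0 + 1)) +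
      X ^ 1 * ncSeries κ ^ (1 + 1)) := by
    conv_lhs => rw [hA]
    ring
  have hs : ∀ m, X ^ (m + 1) * ncSeries κ ^ (m + 1 + 1) =
      X * (C (1 + κ) * (X ^ (m + 1) * ncSeries κ ^ (m + 1 + 1)) +
        X ^ (m + 2) * ncSeries κ ^ (m + 2 + 1) + C κ * (X ^ m * ncSeries κ ^ (m + 1))) := by
    intro m
    linear_combination X ^ (m + 1) * ncSeries κ ^ (m + 1) * hA
  induction n generalizing m with
  | zero =>
    cases m with
    | zero =>
      rw [h₀, pow_zero, one_mul, zero_add, pow_one, hz]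
      simp
    | succ m =>
      rw [h₁, hs]
      simp
  | succ n ih =>
    cases m with
    | zero =>
      rw [h₂, pow_zero, one_mul, zero_add, pow_one, hz, map_add, coeff_succ_X_mul, map_add,
        coeff_C_mul, ← ih, ← ih, coeff_C, if_neg (Nat.succ_ne_zero n), zero_add]
    | succ m =>
      rw [h₃, hs, coeff_succ_X_mul, map_add, map_add, coeff_C_mul, coeff_C_mul, ← ih, ← ih, ← ih]

end GeneratingFunction

/-! ### Trigonometric integrals for moments and mass -/

section Integrals

open Real

lemma integral_sin_mul_sin (m : ℕ) : ∫ θ in (0)..π, sin ((m + 1 : ℝ) * θ) * sin θ =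
    if m = 0 then π / 2 else 0 := by
  have hcos : ∀ c : ℕ, c ≠ 0 → ∫ θ in (0)..π, cos ((c : ℝ) * θ) = 0 := by
    intro c hc
    rw [intervalIntegral.integral_comp_mul_left _ (Nat.cast_ne_zero.2 hc)]
    simp
  have h : ∀ θ : ℝ, sin ((m + 1 : ℝ) * θ) * sin θ =
      (cos ((m : ℝ) * θ) - cos (((m + 2 : ℕ) : ℝ) * θ)) / 2 := by
    intro θ
    have e1 : (m : ℝ) * θ = (m + 1 : ℝ) * θ - θ := by ring
    have e2 : ((m + 2 : ℕ) : ℝ) * θ = (m + 1 : ℝ) * θ + θ := by push_cast; ring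
    rw [e1, e2, cos_sub, cos_add]
    ring
  simp_rw [h]
  rw [intervalIntegral.integral_div, intervalIntegral.integral_sub
    (Continuous.intervalIntegrable (by fun_prop) _ _)
    (Continuous.intervalIntegrable (by fun_prop) _ _), hcos (m + 2) (by omega), sub_zero]
  split_ifs with hm
  · subst hm
    simp
  · rw [hcos m hm, zero_div]

/-- The parametrization of the support of the Marčenko–Pastur distribution by an angle. -/
noncomputable def mpParam (κ θ : ℝ) : ℝ := 1 + κ + 2 * √κ * cos θ

lemma continuous_mpParam (κ : ℝ) : Continuous (mpParam κ) := by
  unfold mpParam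
  fun_prop

/-- Since `2 cos θ sin ((m+1)θ) = sin ((m+2)θ) + sin (mθ)`, multiplication by `mpParam κ θ` is
tridiagonal on these sines with off-diagonal entries `√κ`. The factor `√κ ^ m` in `J` changes them
to `1` and `κ`, as `eq_coeff_ncSeries` requires; the claim is the column `m = 0`. -/
lemma integral_mpParam_pow {κ : ℝ} (hκ : 0 < κ) (n : ℕ) :
    ∫ θ in (0)..π, mpParam κ θ ^ n * (2 * κ / π * sin θ ^ 2) = ncSum (n + 1) κ 1 := by
  have hsq : √κ * √κ = κ := mul_self_sqrt hκ.le
  set J : ℕ → ℕ → ℝ := fun n m => κ * (2 / π) * √κ ^ m *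
    ∫ θ in (0)..π, mpParam κ θ ^ n * (sin ((m + 1 : ℝ) * θ) * sin θ) with hJ
  have hint : ∀ n m : ℕ, IntervalIntegrable
      (fun θ => mpParam κ θ ^ n * (sin ((m + 1 : ℝ) * θ) * sin θ)) volume 0 π := fun n m =>
    Continuous.intervalIntegrable (by have := continuous_mpParam κ; fun_prop) _ _
  have key := eq_coeff_ncSeries (κ := κ) (J := J) ?_ ?_ ?_ ?_ n 0
  · rw [pow_zero, one_mul, zero_add, pow_one, ncSeries, PowerSeries.coeff_mk] at key
    rw [← key, hJ]
    simp only [pow_zero, mul_one, Nat.cast_zero, zero_add, one_mul]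
    rw [← intervalIntegral.integral_const_mul]
    congr 1
    funext θ
    ring
  · simp only [hJ, pow_zero, one_mul, integral_sin_mul_sin]
    have := pi_pos.ne'
    rw [if_pos trivial]
    field_simp
  · intro m
    simp only [hJ, pow_zero, one_mul, integral_sin_mul_sin]
    simp
  · intro n
    have h : ∀ θ, mpParam κ θ ^ (n + 1) * (sin (((0 : ℕ) + 1 : ℝ) * θ) * sin θ) =
        (1 + κ) * (mpParam κ θ ^ n * (sin (((0 : ℕ) + 1 : ℝ) * θ) * sin θ)) +
        √κ * (mpParam κ θ ^ n * (sin (((1 : ℕ) + 1 : ℝ) * θ) * sin θ)) := by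
      intro θ
      have e2 : ((1 : ℕ) + 1 : ℝ) * θ = 2 * θ := by norm_num
      rw [e2, sin_two_mul, pow_succ]
      nth_rewrite 2 [mpParam]
      simp only [Nat.cast_zero, zero_add, one_mul]
      ring
    simp only [hJ]
    simp_rw [h]
    rw [intervalIntegral.integral_add ((hint _ _).const_mul _) ((hint _ _).const_mul _),
      intervalIntegral.integral_const_mul, intervalIntegral.integral_const_mul]
    ring
  · intro n m
    have h : ∀ θ, mpParam κ θ ^ (n + 1) * (sin (((m + 1 : ℕ) + 1 : ℝ) * θ) * sin θ) =
        (1 + κ) * (mpParam κ θ ^ n * (sin (((m + 1 : ℕ) + 1 : ℝ) * θ) * sin θ)) +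
        √κ * (mpParam κ θ ^ n * (sin (((m + 2 : ℕ) + 1 : ℝ) * θ) * sin θ)) +
        √κ * (mpParam κ θ ^ n * (sin ((m + 1 : ℝ) * θ) * sin θ)) := by
      intro θ
      have e2 : ((m + 2 : ℕ) + 1 : ℝ) * θ = ((m + 1 : ℕ) + 1 : ℝ) * θ + θ := by push_cast; ring
      have e3 : (m + 1 : ℝ) * θ = ((m + 1 : ℕ) + 1 : ℝ) * θ - θ := by push_cast; ring
      rw [e2, e3, sin_add, sin_sub, pow_succ]
      nth_rewrite 2 [mpParam]
      ring
    simp only [hJ]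
    simp_rw [h]
    rw [intervalIntegral.integral_add (((hint _ _).const_mul _).add ((hint _ _).const_mul _))
      ((hint _ _).const_mul _), intervalIntegral.integral_add ((hint _ _).const_mul _)
      ((hint _ _).const_mul _),
      intervalIntegral.integral_const_mul, intervalIntegral.integral_const_mul,
      intervalIntegral.integral_const_mul]
    generalize (∫ θ in (0)..π, mpParam κ θ ^ n * (sin ((m + 1 : ℝ) * θ) * sin θ)) = I
    have e : κ * (2 / π) * √κ ^ (m + 1) * (√κ * I) = κ * (κ * (2 / π) * √κ ^ m * I) := by
      rw [pow_succ]
      linear_combination κ * (2 / π) * √κ ^ m * I * hsq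
    rw [mul_add, mul_add, e]
    ring

/-- The integrand is a Poisson kernel up to a factor. The arctangent in the antiderivative is the
argument of `1 + u e^(iθ)` and vanishes at both ends. -/
lemma integral_inv_poisson_of_lt_one {u : ℝ} (h0 : 0 ≤ u) (h1 : u < 1) :
    ∫ θ in (0)..π, (1 + u ^ 2 + 2 * u * cos θ)⁻¹ = π / (1 - u ^ 2) := by
  have hpos : ∀ θ, 0 < 1 + u * cos θ := fun θ => by nlinarith [neg_one_le_cos θ]
  have hD : ∀ θ, 0 < 1 + u ^ 2 + 2 * u * cos θ := fun θ => by nlinarith [neg_one_le_cos θ]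
  have hu : 0 < 1 - u ^ 2 := by nlinarith
  have hderiv : ∀ θ ∈ Set.uIcc 0 π, HasDerivAt
      (fun θ => (θ - 2 * arctan (u * sin θ / (1 + u * cos θ))) / (1 - u ^ 2))
      ((1 + u ^ 2 + 2 * u * cos θ)⁻¹) θ := by
    intro θ _
    have h := (((hasDerivAt_id θ).sub ((((hasDerivAt_sin θ).const_mul u).div
      (((hasDerivAt_cos θ).const_mul u).const_add 1) (hpos θ).ne').arctan.const_mul 2))).div_const
      (1 - u ^ 2)
    convert! h using 1
    have e : 1 + (u * sin θ / (1 + u * cos θ)) ^ 2 =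
        (1 + u ^ 2 + 2 * u * cos θ) / (1 + u * cos θ) ^ 2 := by
      have := (hpos θ).ne'
      field_simp
      linear_combination u ^ 2 * sin_sq_add_cos_sq θ
    have h1 := (hpos θ).ne'
    have h2 := (hD θ).ne'
    -- The rational part of the identity, with `q = 1 + u cos θ` and `w = 1 - u ^ 2`; trigonometry
    -- enters only through `D - 2 * N = w`.
    have aux : ∀ D q N w : ℝ, D ≠ 0 → q ≠ 0 → w ≠ 0 → D - 2 * N = w →
        D⁻¹ = (1 - 2 * (1 / (D / q ^ 2) * (N / q ^ 2))) / w := by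
      intro D q N w hD hq hw h
      field_simp
      exact h.symm
    rw [Pi.div_apply, e]
    exact aux _ _ _ _ h2 h1 hu.ne' (by linear_combination -2 * u ^ 2 * sin_sq_add_cos_sq θ)
  rw [intervalIntegral.integral_eq_sub_of_hasDerivAt hderiv]
  · simp
  · refine Continuous.intervalIntegrable (Continuous.inv₀ (by fun_prop) fun θ => (hD θ).ne') _ _

lemma mpParam_pos {κ θ : ℝ} (hκ : 0 < κ) (hθ : θ ∈ Set.Ioo 0 π) : 0 < mpParam κ θ := by
  have h1 : -1 < cos θ := by
    rw [← cos_pi]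
    exact cos_lt_cos_of_nonneg_of_le_pi hθ.1.le le_rfl hθ.2
  have h2 := sqrt_pos.2 hκ
  have h3 := mul_self_sqrt hκ.le
  rw [mpParam]
  nlinarith [sq_nonneg (1 - √κ), mul_pos h2 (by linarith : 0 < 1 + cos θ)]

lemma mpParam_pos_of_ne_one {κ : ℝ} (hκ : 0 < κ) (h1 : κ ≠ 1) (θ : ℝ) : 0 < mpParam κ θ := by
  have h2 := sqrt_pos.2 hκ
  have h3 := mul_self_sqrt hκ.le
  have h4 : √κ ≠ 1 := fun h => h1 (by rw [← h3, h, mul_one])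
  rw [mpParam]
  nlinarith [pow_pos (abs_pos.2 (sub_ne_zero.2 h4)) 2, sq_abs (√κ - 1), neg_one_le_cos θ]

lemma integral_inv_mpParam {κ : ℝ} (hκ : 0 < κ) (h1 : κ ≠ 1) :
    ∫ θ in (0)..π, (mpParam κ θ)⁻¹ = π / |1 - κ| := by
  have hsq : √κ ^ 2 = κ := sq_sqrt hκ.le
  have h0 := sqrt_pos.2 hκ
  rcases lt_or_gt_of_ne h1 with h | h
  · rw [abs_of_pos (by linarith)]
    have := integral_inv_poisson_of_lt_one (sqrt_nonneg κ) ((sqrt_lt' one_pos).2 (by simpa using h))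
    rwa [hsq] at this
  · rw [abs_of_neg (by linarith)]
    have hlt : (√κ)⁻¹ < 1 := inv_lt_one_of_one_lt₀ ((lt_sqrt zero_le_one).2 (by simpa using h))
    have := integral_inv_poisson_of_lt_one (inv_nonneg.2 h0.le) hlt
    -- For `κ > 1`, taking out `κ` replaces `√κ` by its inverse, which is less than 1.
    have e : ∀ θ, (mpParam κ θ)⁻¹ =
        κ⁻¹ * (1 + (√κ)⁻¹ ^ 2 + 2 * (√κ)⁻¹ * cos θ)⁻¹ := by
      intro θ
      have e1 : κ * κ⁻¹ = 1 := mul_inv_cancel₀ hκ.ne'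
      have e2 : κ * (√κ)⁻¹ = √κ := by
        nth_rewrite 1 [← hsq]
        rw [pow_two, mul_assoc, mul_inv_cancel₀ h0.ne', mul_one]
      rw [← mul_inv, mpParam, inv_pow, hsq]
      congr 1
      linear_combination -e1 - 2 * cos θ * e2
    simp_rw [e]
    rw [intervalIntegral.integral_const_mul, this, inv_pow, hsq]
    have h2 : κ - 1 ≠ 0 := by linarith
    have h3 : 1 - κ⁻¹ ≠ 0 := by
      rw [sub_ne_zero]
      exact fun h => h1 (inv_eq_one.1 h.symm)
    have h4 : -(1 - κ) ≠ 0 := by rwa [neg_sub]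
    field_simp
    ring

/-- Polynomial division: with `x = mpParam κ θ`, one has `4κ sin² θ = 4κ - (x - 1 - κ)² = -x² + 2(1
+ κ)x - (1 - κ)²`. -/
lemma inv_mpParam_mul_sin_sq {κ θ : ℝ} (hκ : 0 < κ) (hθ : θ ∈ Set.Ioo 0 π) :
    (mpParam κ θ)⁻¹ * (2 * κ / π * sin θ ^ 2) =
      (1 + κ) / (2 * π) - √κ / π * cos θ - (1 - κ) ^ 2 / (2 * π) * (mpParam κ θ)⁻¹ := by
  have h := (mpParam_pos hκ hθ).ne'
  have hsq := mul_self_sqrt hκ.le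
  field_simp
  rw [sin_sq, mpParam]
  linear_combination (4 * cos θ ^ 2) * hsq

/-- The terms integrate to `(1 + κ) / 2 - |1 - κ| / 2`. At `κ = 1` the inverse of `mpParam` is not
integrable, but its coefficient vanishes. -/
lemma integral_inv_mpParam_mul_sin_sq {κ : ℝ} (hκ : 0 < κ) :
    IntegrableOn (fun θ => (mpParam κ θ)⁻¹ * (2 * κ / π * sin θ ^ 2)) (Set.Ioo 0 π) ∧
    ∫ θ in Set.Ioo 0 π, (mpParam κ θ)⁻¹ * (2 * κ / π * sin θ ^ 2) = min 1 κ := by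
  have hint : IntervalIntegrable (fun θ => (1 - κ) ^ 2 / (2 * π) * (mpParam κ θ)⁻¹) volume 0 π := by
    by_cases h : κ = 1
    · simp [h]
    · exact Continuous.intervalIntegrable (((continuous_mpParam κ).inv₀ fun θ =>
        (mpParam_pos_of_ne_one hκ h θ).ne').const_mul _) _ _
  have hint' : IntervalIntegrable (fun θ => (1 + κ) / (2 * π) - √κ / π * cos θ) volume 0 π :=
    Continuous.intervalIntegrable (by fun_prop) _ _
  constructor
  · rw [integrableOn_congr_fun (fun θ hθ => inv_mpParam_mul_sin_sq hκ hθ) measurableSet_Ioo,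
      ← integrableOn_Ioc_iff_integrableOn_Ioo,
      ← intervalIntegrable_iff_integrableOn_Ioc_of_le pi_pos.le]
    exact hint'.sub hint
  · rw [setIntegral_congr_fun measurableSet_Ioo fun θ hθ => inv_mpParam_mul_sin_sq hκ hθ,
      ← integral_Ioc_eq_integral_Ioo, ← intervalIntegral.integral_of_le pi_pos.le,
      intervalIntegral.integral_sub hint' hint, intervalIntegral.integral_sub
      (Continuous.intervalIntegrable (by fun_prop) _ _)
      (Continuous.intervalIntegrable (by fun_prop) _ _), intervalIntegral.integral_const_mul,
      intervalIntegral.integral_const_mul, integral_cos, sin_pi, sin_zero,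
      intervalIntegral.integral_const]
    have hπ := pi_pos.ne'
    by_cases h : κ = 1
    · subst h
      simp
      field_simp
      norm_num
    · rw [integral_inv_mpParam hκ h, ← sq_abs (1 - κ)]
      have h' : |1 - κ| ≠ 0 := abs_ne_zero.2 (sub_ne_zero.2 (Ne.symm h))
      have e : min 1 κ = (1 + κ - |1 - κ|) / 2 := by
        rcases le_total κ 1 with hle | hle
        · rw [min_eq_right hle, abs_of_nonneg (sub_nonneg.2 hle)]
          ring
        · rw [min_eq_left hle, abs_of_nonpos (sub_nonpos.2 hle)]
          ring
      rw [e, smul_eq_mul]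
      field_simp
      ring

end Integrals
end SampleCov

namespace SampleCov

/-! ### Mass, support and moments of the limit law -/

section MarchenkoPastur

open Real

variable {κ : ℝ}

lemma image_mpParam (hκ : 0 < κ) :
    mpParam κ '' Set.Icc 0 π = Set.Icc ((1 - √κ) ^ 2) ((1 + √κ) ^ 2) := by
  have hsq := mul_self_sqrt hκ.le
  have h0 := sqrt_pos.2 hκ
  have h : mpParam κ = (fun y => 1 + κ + 2 * √κ * y) ∘ cos := rfl
  rw [h, Set.image_comp, bijOn_cos.image_eq]
  ext x
  simp only [Set.mem_image, Set.mem_Icc]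
  constructor
  · rintro ⟨y, ⟨h1, h2⟩, rfl⟩
    constructor <;> nlinarith
  · rintro ⟨h1, h2⟩
    refine ⟨(x - 1 - κ) / (2 * √κ), ⟨?_, ?_⟩, ?_⟩
    · rw [le_div_iff₀ (by positivity)]
      nlinarith
    · rw [div_le_iff₀ (by positivity)]
      nlinarith
    · field_simp
      ring

lemma sqrt_mpParam (hκ : 0 < κ) {θ : ℝ} (hθ : θ ∈ Set.Icc 0 π) :
    √(4 * κ - (mpParam κ θ - 1 - κ) ^ 2) = 2 * √κ * sin θ := by
  have hsq := mul_self_sqrt hκ.le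
  have h : 4 * κ - (mpParam κ θ - 1 - κ) ^ 2 = (2 * √κ * sin θ) ^ 2 := by
    rw [mpParam]
    linear_combination (-4 * sin θ ^ 2 - 4 * cos θ ^ 2) * hsq - 4 * κ * sin_sq_add_cos_sq θ
  rw [h, sqrt_sq (mul_nonneg (by positivity) (sin_nonneg_of_mem_Icc hθ))]

/-- Integration against the semicircle-like weight in the angular coordinate. -/
lemma setIntegral_sqrt_mul (hκ : 0 < κ) (g : ℝ → ℝ) :
    ((IntegrableOn (fun x => g x * (√(4 * κ - (x - 1 - κ) ^ 2) / (2 * π)))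
        (Set.Icc ((1 - √κ) ^ 2) ((1 + √κ) ^ 2)) ↔
      IntegrableOn (fun θ => g (mpParam κ θ) * (2 * κ / π * sin θ ^ 2)) (Set.Ioo 0 π))) ∧
    ∫ x in Set.Icc ((1 - √κ) ^ 2) ((1 + √κ) ^ 2), g x * (√(4 * κ - (x - 1 - κ) ^ 2) / (2 * π)) =
      ∫ θ in Set.Ioo 0 π, g (mpParam κ θ) * (2 * κ / π * sin θ ^ 2) := by
  have hsq := mul_self_sqrt hκ.le
  have h0 := sqrt_pos.2 hκ
  have hderiv : ∀ θ ∈ Set.Icc 0 π,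
      HasDerivWithinAt (mpParam κ) (2 * √κ * -sin θ) (Set.Icc 0 π) θ := fun θ _ =>
    (((hasDerivAt_cos θ).const_mul (2 * √κ)).const_add (1 + κ)).hasDerivWithinAt
  have hinj : Set.InjOn (mpParam κ) (Set.Icc 0 π) := by
    intro x hx y hy h
    refine injOn_cos hx hy ?_
    have h : 1 + κ + 2 * √κ * cos x = 1 + κ + 2 * √κ * cos y := h
    have := add_left_cancel h
    exact mul_left_cancel₀ (by positivity) this
  have hfun : ∀ θ ∈ Set.Icc 0 π, |2 * √κ * -sin θ| •
      (g (mpParam κ θ) * (√(4 * κ - (mpParam κ θ - 1 - κ) ^ 2) / (2 * π))) =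
      g (mpParam κ θ) * (2 * κ / π * sin θ ^ 2) := by
    intro θ hθ
    rw [sqrt_mpParam hκ hθ, mul_neg, abs_neg, smul_eq_mul,
      abs_of_nonneg (mul_nonneg (by positivity) (sin_nonneg_of_mem_Icc hθ))]
    field_simp
    linear_combination sin θ ^ 2 * g (mpParam κ θ) * hsq
  rw [← image_mpParam hκ, integrableOn_image_iff_integrableOn_abs_deriv_smul measurableSet_Icc
    hderiv hinj, integral_image_eq_integral_abs_deriv_smul measurableSet_Icc hderiv hinj,
    integrableOn_congr_fun hfun measurableSet_Icc, setIntegral_congr_fun measurableSet_Icc hfun,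
    integrableOn_Icc_iff_integrableOn_Ioo, integral_Icc_eq_integral_Ioo]
  exact ⟨Iff.rfl, rfl⟩

/-- The density of the absolutely continuous part of the Marčenko–Pastur distribution. -/
noncomputable def mpDensity (κ : ℝ) : ℝ → ℝ :=
  Set.indicator (Set.Icc ((1 - √κ) ^ 2) ((1 + √κ) ^ 2))
    (fun x => √(4 * κ - (x - 1 - κ) ^ 2) / (2 * π * x))

lemma mpDensity_nonneg (κ x : ℝ) : 0 ≤ mpDensity κ x := by
  refine Set.indicator_nonneg (fun y hy => ?_) x
  have : 0 ≤ y := (sq_nonneg _).trans hy.1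
  positivity

lemma measurable_mpDensity (κ : ℝ) : Measurable (mpDensity κ) := by
  refine Measurable.indicator ?_ measurableSet_Icc
  fun_prop

lemma marchenkoPastur_eq (κ : ℝ) : marchenkoPastur κ =
    ENNReal.ofReal (max 0 (1 - κ)) • Measure.dirac 0 +
      volume.withDensity fun x => ENNReal.ofReal (mpDensity κ x) := rfl

lemma integral_mpDensity (hκ : 0 < κ) :
    Integrable (mpDensity κ) ∧ ∫ x, mpDensity κ x = min 1 κ := by
  have h := setIntegral_sqrt_mul hκ fun x => x⁻¹
  have e : (fun x : ℝ => x⁻¹ * (√(4 * κ - (x - 1 - κ) ^ 2) / (2 * π))) =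
      fun x => √(4 * κ - (x - 1 - κ) ^ 2) / (2 * π * x) := by
    funext x
    rw [inv_mul_eq_div, div_div]
  obtain ⟨h1, h2⟩ := integral_inv_mpParam_mul_sin_sq hκ
  rw [e] at h
  constructor
  · rw [mpDensity, integrable_indicator_iff measurableSet_Icc]
    exact h.1.2 h1
  · simp only [mpDensity]
    rw [integral_indicator measurableSet_Icc, h.2, h2]

lemma isProbabilityMeasure_marchenkoPastur (hκ : 0 < κ) :
    IsProbabilityMeasure (marchenkoPastur κ) := by
  constructor
  rw [marchenkoPastur_eq, Measure.add_apply, Measure.smul_apply, measure_univ, smul_eq_mul,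
    mul_one, withDensity_apply _ MeasurableSet.univ, Measure.restrict_univ,
    ← ofReal_integral_eq_lintegral_ofReal (integral_mpDensity hκ).1
      (ae_of_all _ (mpDensity_nonneg κ)), (integral_mpDensity hκ).2,
    ← ENNReal.ofReal_add (le_max_left _ _) (le_min zero_le_one hκ.le), ← ENNReal.ofReal_one]
  congr 1
  rcases le_total κ 1 with h | h
  · rw [max_eq_right (by linarith), min_eq_right h]
    ring
  · rw [max_eq_left (by linarith), min_eq_left h]
    ring

lemma ae_abs_le_marchenkoPastur (κ : ℝ) :
    ∀ᵐ x ∂marchenkoPastur κ, |x| ≤ (1 + √κ) ^ 2 := by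
  rw [marchenkoPastur_eq, ae_add_measure_iff]
  constructor
  · refine Measure.ae_smul_measure ?_ _
    rw [ae_dirac_eq]
    simp only [Filter.eventually_pure, abs_zero]
    positivity
  · rw [ae_withDensity_iff (measurable_mpDensity κ).ennreal_ofReal]
    refine ae_of_all _ fun x hx => ?_
    have hmem : x ∈ Set.Icc ((1 - √κ) ^ 2) ((1 + √κ) ^ 2) := by
      by_contra hmem
      exact hx (by rw [mpDensity, Set.indicator_of_notMem hmem, ENNReal.ofReal_zero])
    rw [abs_of_nonneg ((sq_nonneg _).trans hmem.1)]
    exact hmem.2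

/-- A positive power does not see the atom at 0, and one factor `x` cancels the denominator of the
density. -/
lemma integral_pow_succ_marchenkoPastur (hκ : 0 < κ) (n : ℕ) :
    ∫ x, x ^ (n + 1) ∂marchenkoPastur κ = ncSum (n + 1) κ 1 := by
  have := isProbabilityMeasure_marchenkoPastur hκ
  have hint := integrable_pow_of_bounded_support (ae_abs_le_marchenkoPastur κ) (n + 1)
  rw [marchenkoPastur_eq] at hint ⊢
  rw [integral_add_measure hint.left_of_add_measure hint.right_of_add_measure,
    integral_smul_measure, integral_dirac, zero_pow (Nat.succ_ne_zero n), smul_zero, zero_add,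
    integral_withDensity_eq_integral_toReal_smul (measurable_mpDensity κ).ennreal_ofReal
      (ae_of_all _ fun _ => ENNReal.ofReal_lt_top)]
  have e : ∀ x : ℝ, (ENNReal.ofReal (mpDensity κ x)).toReal • x ^ (n + 1) =
      Set.indicator (Set.Icc ((1 - √κ) ^ 2) ((1 + √κ) ^ 2))
        (fun x => x ^ n * (√(4 * κ - (x - 1 - κ) ^ 2) / (2 * π))) x := by
    intro x
    rw [ENNReal.toReal_ofReal (mpDensity_nonneg κ x), mpDensity, smul_eq_mul]
    by_cases hx : x ∈ Set.Icc ((1 - √κ) ^ 2) ((1 + √κ) ^ 2)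
    · rw [Set.indicator_of_mem hx, Set.indicator_of_mem hx]
      -- At `x = 0` the cancellation fails, but the square root is zero there, so both sides vanish.
      by_cases h0 : x = 0
      · have : 4 * κ - (x - 1 - κ) ^ 2 ≤ 0 := by
          rw [h0]
          nlinarith [sq_nonneg (1 - κ)]
        rw [sqrt_eq_zero_of_nonpos this]
        simp
      · field_simp
        ring
    · rw [Set.indicator_of_notMem hx, Set.indicator_of_notMem hx, zero_mul]
  simp_rw [e]
  rw [integral_indicator measurableSet_Icc, (setIntegral_sqrt_mul hκ fun x => x ^ n).2,
    ← integral_Ioc_eq_integral_Ioo, ← intervalIntegral.integral_of_le pi_pos.le,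
    integral_mpParam_pow hκ]

lemma integral_pow_marchenkoPastur (hκ : 0 < κ) (k : ℕ) :
    ∫ x, x ^ k ∂marchenkoPastur κ = ncSum k κ 1 := by
  cases k with
  | zero =>
    have := isProbabilityMeasure_marchenkoPastur hκ
    simp [ncSum_zero]
  | succ n => exact integral_pow_succ_marchenkoPastur hκ n

/-- The limit distribution: the Marčenko–Pastur distribution with parameter `κ / μ`, rescaled to
total mass `μ`. -/
noncomputable def limitMeasure (κ μ : ℝ) : Measure ℝ :=
  ENNReal.ofReal μ • (marchenkoPastur (κ / μ)).map (μ * ·)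

lemma limitMeasure_one (κ : ℝ) : limitMeasure κ 1 = marchenkoPastur κ := by
  simp [limitMeasure]

variable {μ : ℝ}

lemma limitMeasure_univ (hκ : 0 < κ) (hμ : 0 < μ) :
    limitMeasure κ μ Set.univ = ENNReal.ofReal μ := by
  have := isProbabilityMeasure_marchenkoPastur (div_pos hκ hμ)
  rw [limitMeasure, Measure.smul_apply, Measure.map_apply (by fun_prop) MeasurableSet.univ]
  simp

lemma ae_abs_le_limitMeasure (κ : ℝ) (hμ : 0 < μ) :
    ∀ᵐ x ∂limitMeasure κ μ, |x| ≤ μ * (1 + √(κ / μ)) ^ 2 := by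
  refine Measure.ae_smul_measure ?_ _
  rw [ae_map_iff (by fun_prop) (measurableSet_le (by fun_prop) (by fun_prop))]
  filter_upwards [ae_abs_le_marchenkoPastur (κ / μ)] with x hx
  rw [abs_mul, abs_of_pos hμ]
  gcongr

/-- `ncSum k` is homogeneous of degree `k + 1`: the dilation supplies `μ ^ k` and the total mass one
more factor `μ`. -/
lemma integral_pow_limitMeasure (hκ : 0 < κ) (hμ : 0 < μ) (k : ℕ) :
    ∫ x, x ^ k ∂limitMeasure κ μ = ncSum k κ μ := by
  rw [limitMeasure, integral_smul_measure, integral_map (by fun_prop) (by fun_prop),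
    ENNReal.toReal_ofReal hμ.le]
  simp_rw [mul_pow]
  rw [integral_const_mul, integral_pow_marchenkoPastur (div_pos hκ hμ), smul_eq_mul, ← mul_assoc,
    ncSum, ncSum, Finset.mul_sum]
  refine Finset.sum_congr rfl fun f _ => ?_
  have hle := fixCount_le k f
  have h : μ * μ ^ k = μ ^ fixCount k f * μ ^ (k + 1 - fixCount k f) := by
    rw [← pow_add, ← pow_succ']
    congr 1
    omega
  rw [h, one_pow, mul_one, div_pow]
  field_simp

end MarchenkoPastur
end SampleCov

/-! ### Conclusion by the method of moments -/

theorem theorem4p1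
    (s t : ℕ → ℕ) (κ μ : ℝ) (hκ : 0 < κ) (hμ : 0 < μ)
    (hs : Tendsto (fun n : ℕ => (s n : ℝ) / n) atTop (𝓝 κ))
    (ht : Tendsto (fun n : ℕ => (t n : ℝ) / n) atTop (𝓝 μ))
    {Ω : ℕ → Type*} [∀ n, MeasurableSpace (Ω n)]
    (P : ∀ n, Measure (Ω n)) [∀ n, IsProbabilityMeasure (P n)]
    (r : ∀ n, Setoid (Fin (s n) × Fin (t n)))
    (a : ∀ n, Fin (s n) × Fin (t n) → Ω n → ℂ)
    (hmeas : ∀ n x, Measurable (a n x))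
    (hindep : ∀ n, SampleCov.IndepClasses (P n) (r n) (a n))
    (hMP1 : SampleCov.MP1 s t r) (hMP2 : SampleCov.MP2 s t r) (hMP3 : SampleCov.MP3 s t r)
    (hcentered : ∀ n x, ∫ ω, a n x ω ∂(P n) = 0)
    (hvar : ∀ n x, ∫ ω, a n x ω * star (a n x ω) ∂(P n) = 1)
    (hmom : ∀ k : ℕ, ∃ C : ℝ≥0, ∀ n x, ∫⁻ ω, ‖a n x ω‖ₑ ^ k ∂(P n) ≤ C) :
    ∃ ν : FiniteMeasure ℝ,
      Tendsto (fun n => SampleCov.meanFiniteMeasure n (P n) (a n)) atTop (𝓝 ν) ∧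
      (ν : Measure ℝ) Set.univ = ENNReal.ofReal μ ∧
      (∀ k : ℕ, 1 ≤ k →
        Integrable (fun x : ℝ => x ^ k) (ν : Measure ℝ) ∧
        ∫ x, x ^ k ∂(ν : Measure ℝ) =
          ∑ i ∈ Finset.Icc 1 k, (SampleCov.ncCount i k : ℝ) * κ ^ i * μ ^ (k - i + 1)) ∧
      (μ = 1 → (ν : Measure ℝ) = SampleCov.marchenkoPastur κ) := by
  have hmass : IsFiniteMeasure (SampleCov.limitMeasure κ μ) :=
    ⟨by rw [SampleCov.limitMeasure_univ hκ hμ]; exact ENNReal.ofReal_lt_top⟩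
  have hbound := SampleCov.ae_abs_le_limitMeasure κ hμ
  have hint : ∀ n k, Integrable (fun x : ℝ => x ^ k) (SampleCov.meanMeasure n (P n) (a n)) ∧
      ((∫ x, x ^ k ∂SampleCov.meanMeasure n (P n) (a n) : ℝ) : ℂ) =
        (∫ ω, (((SampleCov.entryMatrix (a n) ω)ᴴ * SampleCov.entryMatrix (a n) ω) ^ k).trace
          ∂(P n)) / (n : ℂ) ^ (k + 1) := by
    intro n k
    refine SampleCov.integrable_pow_meanMeasure n k (hmeas n) ?_
    rcases Nat.eq_zero_or_pos k with rfl | hk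
    · simp only [pow_zero]
      exact integrable_const _
    · obtain ⟨C, hC⟩ := hmom (2 * k)
      exact SampleCov.integrable_trace_pow (hmeas n) hk.ne' (hC n)
  refine ⟨⟨SampleCov.limitMeasure κ μ, hmass⟩, ?_, SampleCov.limitMeasure_univ hκ hμ,
    fun k hk => ⟨SampleCov.integrable_pow_of_bounded_support hbound k, ?_⟩, ?_⟩
  · refine SampleCov.tendsto_of_tendsto_moments hbound (fun n k => (hint n k).1) fun k => ?_
    change Tendsto (fun n => ∫ x, x ^ k ∂SampleCov.meanMeasure n (P n) (a n)) atTop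
      (𝓝 (∫ x, x ^ k ∂SampleCov.limitMeasure κ μ))
    rw [SampleCov.integral_pow_limitMeasure hκ hμ]
    have hlim : Tendsto (fun n : ℕ => (∫ ω, (((SampleCov.entryMatrix (a n) ω)ᴴ *
        SampleCov.entryMatrix (a n) ω) ^ k).trace ∂(P n)) / (n : ℂ) ^ (k + 1)) atTop
        (𝓝 ((SampleCov.ncSum k κ μ : ℝ) : ℂ)) := by
      rcases Nat.eq_zero_or_pos k with rfl | hk
      -- The zeroth moment is `t n / n`. The walk count excludes it, but the method of moments needs
      -- it for convergence of the total mass.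
      · rw [SampleCov.ncSum_zero]
        refine ((Complex.continuous_ofReal.tendsto μ).comp ht).congr fun n => ?_
        simp
      · rw [← SampleCov.treeSum_eq_ncSum]
        exact SampleCov.tendsto_integral_trace_pow hκ hμ hs ht hmeas hindep hMP1 hMP2 hMP3
          hcentered hvar hmom hk.ne'
    refine ((Complex.continuous_re.tendsto _).comp hlim).congr fun n => ?_
    rw [Function.comp_apply, ← (hint n k).2, Complex.ofReal_re]
  · exact (SampleCov.integral_pow_limitMeasure hκ hμ k).trans
      (SampleCov.ncSum_eq_sum_ncCount hk κ μ)
  · rintro rfl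
    exact SampleCov.limitMeasure_one κ
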